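/- Let $d\ge 1$, write $\mathbf H=\Delta-\partial_t$ and $d\gamma_d=(4\pi)^{-d/2}e^{-|x|^2/4}\,dx$ on $\mathbb R^d$. Let $2<\lambda<3$ and let $q\colon\mathbb R^d\times(-\infty,0)\to\mathbb R$ be a locally Lipschitz solution of the parabolic Signorini (thin obstacle) problem with zero obstacle, that is, $$q\,\mathbf Hq=0\ \text{ in }\mathbb R^d\times(-\infty,0),\qquad \mathbf Hq=0\ \text{ in }\big(\mathbb R^d\times(-\infty,0)\big)\setminus\{x_d=0,\ q=0\},$$ $$q\ge 0\ \text{ and }\ \partial_{d}q\le 0\ \text{ on }\{x_d=0\}\times(-\infty,0).$$ Here $\mathbf Hq$ is the distribution $\langle\mathbf Hq,\psi\rangle=-\iint(\nabla q\cdot\nabla\psi+\partial_tq\,\psi)\,dx\,dt$ and $\langle q\mathbf Hq,\varphi\rangle=\langle\mathbf Hq,q\varphi\rangle$. The condition $\partial_dq\le0$ may be read either one-sidedly, as $$\limsup_{h\downarrow0}\frac{q(x+he_d,t)-q(x,t)}{h}\le0\quad\text{whenever }x_d=0,\ t<0,$$ or two-sidedly, as $\mathbf Hq\le0$ in the sense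 of distributions in $\mathbb R^d\times(-\infty,0)$ (the jump of $\partial_dq$ across $\{x_d=0\}$ is nonpositive). Suppose that $q$ is parabolically $\lambda$-homogeneous, $q(rx,r^2t)=r^\lambda q(x,t)$ for all $r>0$, $x\in\mathbb R^d$, $t<0$, and that $$\int_{\mathbb R^d}\big(q(x,-1)^2+|\nabla q(x,-1)|^2\big)\,d\gamma_d(x)<+\infty .$$ Then $q\equiv0$ in $\mathbb R^d\times(-\infty,0)$. -/

import Mathlib

open MeasureTheory Set Filter Topology
open scoped ContDiff

noncomputable section

namespace ParabolicSignorini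

/-- The space `ℝ^d` with `d = n + 1 ≥ 1`; the distinguished (last) coordinate of `x` is
`x (Fin.last n)`, written `x_d` in the comments below. -/
abbrev Sp (n : ℕ) : Type := EuclideanSpace ℝ (Fin (n + 1))

/-- The open space-time region `ℝ^d × (-∞, 0)`. -/
def past (n : ℕ) : Set (Sp n × ℝ) := {z | z.2 < 0}

/-- The part `{x_d = 0} × (-∞, 0)` of the thin space. -/
def thin (n : ℕ) : Set (Sp n × ℝ) := {z | z.1 (Fin.last n) = 0 ∧ z.2 < 0}

/-- The last coordinate vector `e_d`. -/
def eLast (n : ℕ) : Sp n := EuclideanSpace.single (Fin.last n) (1 : ℝ)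

/-- The partial derivative `∂_{x_i} f` at a space-time point. -/
def dx {n : ℕ} (i : Fin (n + 1)) (f : Sp n × ℝ → ℝ) (z : Sp n × ℝ) : ℝ :=
  fderiv ℝ f z (EuclideanSpace.single i (1 : ℝ), 0)

/-- The time derivative `∂_t f` at a space-time point. -/
def dt {n : ℕ} (f : Sp n × ℝ → ℝ) (z : Sp n × ℝ) : ℝ :=
  fderiv ℝ f z (0, 1)

/-- `φ ∈ C_c^∞(U)`. -/
structure IsTest {n : ℕ} (U : Set (Sp n × ℝ)) (φ : Sp n × ℝ → ℝ) : Prop where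
  smooth : ContDiff ℝ ∞ φ
  compact : HasCompactSupport φ
  support : tsupport φ ⊆ U

/-- The pairing `⟨Hf, ψ⟩ = -∫∫ (∇f · ∇ψ + ∂_t f ψ) dx dt` of the distribution
`Hf = Δf - ∂_t f` with `ψ`. For `f` locally Lipschitz it is meaningful (Rademacher) for every
Lipschitz `ψ` with compact support, in particular for smooth `ψ` and for products `f * φ` with
`φ` smooth and compactly supported. -/
def heatPairing {n : ℕ} (f ψ : Sp n × ℝ → ℝ) : ℝ :=
  -∫ z : Sp n × ℝ, ((∑ i, dx i f z * dx i ψ z) + dt f z * ψ z)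

/-- The conditions of the parabolic Signorini problem with zero obstacle other than the sign
of the normal derivative. -/
structure IsComplementary {n : ℕ} (q : Sp n × ℝ → ℝ) : Prop where
  /-- `q` is locally Lipschitz in `ℝ^d × (-∞, 0)`. -/
  lipschitz : LocallyLipschitzOn (past n) q
  /-- `q Hq = 0` in `ℝ^d × (-∞, 0)`, where `⟨q Hq, φ⟩ = ⟨Hq, q φ⟩`. -/
  mul_heat : ∀ φ, IsTest (past n) φ → heatPairing q (fun z => q z * φ z) = 0
  /-- `Hq = 0` in `ℝ^d × (-∞, 0)` outside of `{x_d = 0, q = 0}`. -/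
  heat : ∀ φ, IsTest (past n \ {z | z.1 (Fin.last n) = 0 ∧ q z = 0}) φ → heatPairing q φ = 0
  /-- `q ≥ 0` on `{x_d = 0}`. -/
  nonneg : ∀ z ∈ thin n, 0 ≤ q z

/-- `∂_d q ≤ 0` at every point of `{x_d = 0} × (-∞, 0)`, for the derivative in direction `e_d`
from the side `{x_d > 0}`: the upper right derivative
`limsup_{h ↓ 0} (q (x + h e_d, t) - q (x, t)) / h` is `≤ 0`. No differentiability of `q` on the
thin space is presupposed. -/
def NormalDerivNonpos {n : ℕ} (q : Sp n × ℝ → ℝ) : Prop :=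
  ∀ z ∈ thin n, ∀ ε > (0 : ℝ), ∀ᶠ h in 𝓝[>] (0 : ℝ),
    q (z.1 + h • eLast n, z.2) - q z ≤ ε * h

/-- `Hq ≤ 0` in `ℝ^d × (-∞, 0)` as a distribution. For `q` caloric on both sides of `{x_d = 0}`
this says that the jump of `∂_d q` across `{x_d = 0}` is `≤ 0`. -/
def HeatNonpos {n : ℕ} (q : Sp n × ℝ → ℝ) : Prop :=
  ∀ φ, IsTest (past n) φ → (∀ z, 0 ≤ φ z) → heatPairing q φ ≤ 0

/-- Solution of the parabolic Signorini problem with zero obstacle, with the boundary condition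
`∂_d q ≤ 0` on `{x_d = 0}`, taken from the side `{x_d > 0}`. -/
structure IsSignoriniSolution {n : ℕ} (q : Sp n × ℝ → ℝ) : Prop extends IsComplementary q where
  normal : NormalDerivNonpos q

/-- Solution of the parabolic thin obstacle problem with zero obstacle, with the two-sided form
of the boundary condition: the jump of `∂_d q` across `{x_d = 0}` is `≤ 0`, that is, `Hq ≤ 0`.
For `q` even in `x_d` the two forms agree. -/
structure IsThinObstacleSolution {n : ℕ} (q : Sp n × ℝ → ℝ) : Prop
    extends IsComplementary q where
  supercaloric : HeatNonpos q

/-- `q` is parabolically `lam`-homogeneous in `ℝ^d × (-∞, 0)`. -/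
def IsParabolicHomogeneous {n : ℕ} (lam : ℝ) (q : Sp n × ℝ → ℝ) : Prop :=
  ∀ r : ℝ, 0 < r → ∀ (x : Sp n) (t : ℝ), t < 0 → q (r • x, r ^ 2 * t) = r ^ lam * q (x, t)

/-- The Gaussian measure `(4π)^{-d/2} e^{-|x|²/4} dx` on `ℝ^d`. -/
def gammaMeasure (n : ℕ) : Measure (Sp n) :=
  volume.withDensity fun x =>
    ENNReal.ofReal ((4 * Real.pi) ^ (-((n : ℝ) + 1) / 2) * Real.exp (-‖x‖ ^ 2 / 4))

/-- `∫_{t = -1} (q² + |∇q|²) dγ < ∞`. -/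
def HasFiniteEnergy {n : ℕ} (q : Sp n × ℝ → ℝ) : Prop :=
  Integrable (fun x => q (x, -1) ^ 2 + ‖gradient (fun y => q (y, -1)) x‖ ^ 2) (gammaMeasure n)

end ParabolicSignorini

end

/-! Homogeneity reduces the problem to the slice `u = q (·, -1)`. Let `L u = Δu - (x/2)·∇u + (lam/2)
u`, and let `heatForm lam u f` be the Gaussian weak form of `-L u` tested with `f`. Off the thin
space `L u = 0`. The distribution `μ = -L u` lives on `{x_d = 0}`, and the boundary condition makes
it nonnegative. The heart of the matter is that `μ` has total mass `0`.

Since `e^{-k|x_d|}` equals `1` on the thin space, testing with it gives the same mass `M = μ(1)` for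
every `k > 0` (`SolvesOffThin.heatForm_expAbs_mul`). An integration by parts on each side of the
thin space turns this into `M - kβ = -(lam/2 + k²) A + (k/2) A'`. Here `A(k) = ∫ u e^{-k|x_d|} dγ`,
and `β`, formally twice the Gaussian integral of `u` over the thin space, is nonnegative. After
multiplication by `2e^{-k²}` and subtraction of a quadratic polynomial, this is the Euler equation
`k K' - lam K = ρ`, where `ρ ≥ 0` vanishes to third order at `0`.

Smoothness at `0` forces `K = O(k³)`, so `k^{-lam} K` tends to `0` at `0` because `lam < 3`. It is
nondecreasing because `ρ ≥ 0`. It tends to `0` at infinity because `A` is bounded there and `lam >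
2` beats the quadratic polynomial. Hence `K = 0`, so `ρ = 0` and `M = 0` (`euler_ode_monotone`,
`heatForm_one_eq_zero`).

Positivity of `μ` on `1 ± cos` then makes `μ` vanish on all plane waves, so `u` is an eigenfunction
of the Ornstein-Uhlenbeck operator with `lam/2` strictly between `1` and `3/2`. The same Euler
equation with `ρ = 0`, along rays in frequency space, annihilates the Fourier transform of the
Gaussian density times `u` (`eq_zero_of_heatForm_wave`).

The two-sided boundary condition says directly that `μ ≥ 0`. In the one-sided case the odd part of
`u` satisfies the equation across the thin space, so it is an eigenfunction and vanishes
(`SolvesOffThin.comp_reflectLast`). For even `u` the one-sided condition yields `μ ≥ 0` by testing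
with `e^{-N|x_d|} f`, `N → ∞` (`supersolution_of_normalDeriv`). -/

noncomputable section

namespace ParabolicSignorini

/-! ### Locally Lipschitz functions and integration by parts across a hyperplane. -/

section LocallyLipschitz

variable {E : Type*} [NormedAddCommGroup E] [NormedSpace ℝ E]

omit [NormedSpace ℝ E] in
theorem locallyLipschitz_mul {f g : E → ℝ} (hf : LocallyLipschitz f) (hg : LocallyLipschitz g) :
    LocallyLipschitz (fun x => f x * g x) := by
  have h : LocallyLipschitz (fun p : ℝ × ℝ => p.1 * p.2) :=
    ContDiff.locallyLipschitz (𝕂 := ℝ) (by fun_prop)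
  exact h.comp (hf.prodMk hg)

theorem exists_norm_fderiv_le_of_isCompact {f : E → ℝ} {s K : Set E}
    (hf : LocallyLipschitzOn s f) (hs : IsOpen s) (hK : IsCompact K) (hKs : K ⊆ s) :
    ∃ C : ℝ, 0 ≤ C ∧ ∀ x ∈ K, ‖fderiv ℝ f x‖ ≤ C := by
  refine hK.induction_on (p := fun S => ∃ C : ℝ, 0 ≤ C ∧ ∀ x ∈ S, ‖fderiv ℝ f x‖ ≤ C)
    ⟨0, le_rfl, by simp⟩ ?_ ?_ ?_
  · rintro S T hST ⟨C, hC, h⟩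
    exact ⟨C, hC, fun x hx => h x (hST hx)⟩
  · rintro S T ⟨C, hC, h⟩ ⟨D, hD, h'⟩
    refine ⟨max C D, le_max_of_le_left hC, ?_⟩
    rintro x (hx | hx)
    · exact (h x hx).trans (le_max_left _ _)
    · exact (h' x hx).trans (le_max_right _ _)
  · intro x hx
    obtain ⟨L, t, ht, hL⟩ := hf (hKs hx)
    rw [hs.nhdsWithin_eq (hKs hx)] at ht
    obtain ⟨o, hot, ho, hxo⟩ := mem_nhds_iff.1 ht
    refine ⟨o, mem_nhdsWithin_of_mem_nhds (ho.mem_nhds hxo), L, L.2, fun y hy => ?_⟩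
    exact norm_fderiv_le_of_lipschitzOn ℝ (mem_of_superset (ho.mem_nhds hy) hot) hL

theorem exists_lipschitzWith_of_hasCompactSupport {f : E → ℝ} (hf : LocallyLipschitz f)
    [FiniteDimensional ℝ E] (hc : HasCompactSupport f) : ∃ C, LipschitzWith C f := by
  have : ProperSpace E := FiniteDimensional.proper ℝ E
  obtain ⟨R, hR⟩ := hc.isCompact.isBounded.subset_closedBall (0 : E)
  have hz : ∀ x, R < ‖x‖ → f x = 0 := fun x hx => by
    by_contra h
    have := hR (subset_tsupport f h)
    rw [mem_closedBall_zero_iff] at this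
    linarith
  obtain ⟨L, hL⟩ := LocallyLipschitzOn.exists_lipschitzOnWith_of_compact
    (isCompact_closedBall (0 : E) (R + 1)) (hf.locallyLipschitzOn.mono (subset_univ _))
  obtain ⟨M, hM⟩ := hc.exists_bound_of_continuous hf.continuous
  have hM0 : 0 ≤ M := (norm_nonneg _).trans (hM 0)
  have key : ∀ x y, ‖x‖ ≤ R + 1 → dist (f x) (f y) ≤ (L + M) * dist x y := by
    intro x y hx
    by_cases hy : ‖y‖ ≤ R + 1
    · have := hL.dist_le_mul x (by simpa using hx) y (by simpa using hy)
      nlinarith [dist_nonneg (x := x) (y := y)]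
    · push Not at hy
      rw [hz y (by linarith), Real.dist_eq, sub_zero]
      by_cases hx' : ‖x‖ ≤ R
      · have h1 : 1 ≤ dist x y := by
          rw [dist_comm, dist_eq_norm]
          linarith [norm_sub_norm_le y x]
        have := hM x
        rw [Real.norm_eq_abs] at this
        nlinarith [L.2, mul_nonneg L.2 (dist_nonneg (x := x) (y := y)),
          mul_le_mul_of_nonneg_left h1 hM0]
      · rw [hz x (by linarith), abs_zero]
        have := L.2
        positivity
  refine ⟨L + ⟨M, hM0⟩, LipschitzWith.of_dist_le_mul fun x y => ?_⟩
  change _ ≤ ((L : ℝ) + M) * _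
  by_cases hx : ‖x‖ ≤ R + 1
  · exact key x y hx
  by_cases hy : ‖y‖ ≤ R + 1
  · rw [dist_comm, dist_comm x y]
    exact key y x hy
  · rw [hz x (by linarith), hz y (by linarith), dist_self]
    have := L.2
    positivity

variable [FiniteDimensional ℝ E] [MeasurableSpace E] [BorelSpace E] (μ : Measure E)
  [μ.IsAddHaarMeasure]

theorem ae_differentiableAt_of_locallyLipschitz {f : E → ℝ} (hf : LocallyLipschitz f) :
    ∀ᵐ x ∂μ, DifferentiableAt ℝ f x := by
  have : ProperSpace E := FiniteDimensional.proper ℝ E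
  have h : ∀ k : ℕ, ∀ᵐ x ∂μ, x ∈ Metric.closedBall (0 : E) k →
      DifferentiableWithinAt ℝ f (Metric.closedBall (0 : E) k) x := fun k => by
    obtain ⟨L, hL⟩ := LocallyLipschitzOn.exists_lipschitzOnWith_of_compact
      (isCompact_closedBall (0 : E) k) (hf.locallyLipschitzOn.mono (subset_univ _))
    exact hL.ae_differentiableWithinAt_of_mem
  filter_upwards [ae_all_iff.2 h] with x hx
  obtain ⟨k, hk⟩ := exists_nat_gt ‖x‖
  refine (hx k (by simpa using hk.le)).differentiableAt ?_
  exact mem_of_superset (Metric.isOpen_ball.mem_nhds (by simpa using hk)) Metric.ball_subset_closedBall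

theorem integral_fderiv_eq_zero_of_hasCompactSupport {f : E → ℝ} (hf : LocallyLipschitz f)
    (hc : HasCompactSupport f) (e : E) : ∫ x, fderiv ℝ f x e ∂μ = 0 := by
  obtain ⟨C, hC⟩ := exists_lipschitzWith_of_hasCompactSupport hf hc
  have h := LipschitzWith.integral_lineDeriv_mul_eq (μ := μ) (LipschitzWith.const (1 : ℝ)) hC hc (-e)
  have h0 : ∀ x : E, lineDeriv ℝ (fun _ : E => (1 : ℝ)) x (-e) = 0 := fun x => by simp [lineDeriv]
  simp only [h0, zero_mul, integral_zero, neg_neg, mul_one] at h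
  rw [h]
  refine integral_congr_ae ?_
  filter_upwards [hC.ae_differentiableAt (μ := μ)] with x hx
  exact hx.lineDeriv_eq_fderiv.symm

theorem lipschitz_sigma (N : ℕ) : ∃ C, LipschitzWith C (fun s : ℝ => Real.arctan (N * s)) := by
  refine ⟨N, lipschitzWith_of_nnnorm_deriv_le
    (Real.differentiable_arctan.comp (differentiable_id.const_mul _)) fun s => ?_⟩
  have h : HasDerivAt (fun s : ℝ => Real.arctan (N * s)) (1 / (1 + (N * s) ^ 2) * (N * 1)) s :=
    ((hasDerivAt_id s).const_mul (N : ℝ)).arctan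
  rw [h.deriv, ← NNReal.coe_le_coe, coe_nnnorm, Real.norm_eq_abs, abs_of_nonneg (by positivity)]
  rw [mul_one, one_div, NNReal.coe_natCast]
  have : (1 + (N * s) ^ 2)⁻¹ ≤ (1 : ℝ) := inv_le_one_of_one_le₀ (by nlinarith [sq_nonneg (N * s)])
  nlinarith [Nat.cast_nonneg (α := ℝ) N]

/-- These Lipschitz approximations of a multiple of the sign function make integration by parts
against the sign possible without traces. -/
theorem tendsto_arctan_mul (s : ℝ) : Tendsto (fun N : ℕ => Real.arctan (N * s)) atTop
    (𝓝 (Real.pi / 2 * SignType.sign s)) := by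
  rcases lt_trichotomy s 0 with hs | rfl | hs
  · rw [sign_neg hs]
    have : Tendsto (fun N : ℕ => (N : ℝ) * s) atTop atBot :=
      tendsto_natCast_atTop_atTop.atTop_mul_const_of_neg hs
    have h := (Real.tendsto_arctan_atBot.mono_right nhdsWithin_le_nhds).comp this
    simpa [Function.comp_def] using h
  · simp
  · rw [sign_pos hs]
    have : Tendsto (fun N : ℕ => (N : ℝ) * s) atTop atTop :=
      tendsto_natCast_atTop_atTop.atTop_mul_const hs
    have h := (Real.tendsto_arctan_atTop.mono_right nhdsWithin_le_nhds).comp this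
    simpa [Function.comp_def] using h

theorem measurable_signType_cast : Measurable (fun s : ℝ => ((SignType.sign s : SignType) : ℝ)) := by
  have : (fun s : ℝ => ((SignType.sign s : SignType) : ℝ)) =
      fun s => if 0 < s then 1 else if s < 0 then -1 else 0 := by
    funext s
    rcases lt_trichotomy s 0 with hs | rfl | hs
    · simp [sign_neg hs, hs, hs.not_gt]
    · simp
    · simp [sign_pos hs, hs]
  rw [this]
  exact Measurable.ite measurableSet_Ioi measurable_const
    (Measurable.ite measurableSet_Iio measurable_const measurable_const)

theorem abs_sign_le_one (s : ℝ) : |((SignType.sign s : SignType) : ℝ)| ≤ 1 := by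
  rcases lt_trichotomy s 0 with hs | rfl | hs
  · simp [sign_neg hs]
  · simp
  · simp [sign_pos hs]

/-- If a compactly supported Lipschitz function is nonnegative up to `C |ℓ|`, then the integral of
`sign ℓ` times its derivative in direction `e` is nonpositive when `ℓ e ≥ 0`. -/
theorem integral_sign_mul_fderiv_nonpos {F : E → ℝ} (hF : LocallyLipschitz F)
    (hc : HasCompactSupport F) (ℓ : E →L[ℝ] ℝ) (e : E) (he : ℓ e = 1)
    (hpos : ∀ x, ℓ x = 0 → 0 ≤ F x) :
    ∫ x, (SignType.sign (ℓ x) : ℝ) * fderiv ℝ F x e ∂μ ≤ 0 := by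
  obtain ⟨C, hC⟩ := exists_lipschitzWith_of_hasCompactSupport hF hc
  have hdiff := hC.ae_differentiableAt (μ := μ)
  have hFint : Integrable F μ := hF.continuous.integrable_of_hasCompactSupport hc
  have hbd : ∀ x, ‖fderiv ℝ F x e‖ ≤ C * ‖e‖ := fun x =>
    (ContinuousLinearMap.le_opNorm _ _).trans
      (mul_le_mul_of_nonneg_right (norm_fderiv_le_of_lipschitz ℝ hC) (norm_nonneg _))
  have hmeas : Measurable fun x => fderiv ℝ F x e := measurable_fderiv_apply_const ℝ F e
  have hsupp : ∀ x, x ∉ tsupport F → fderiv ℝ F x e = 0 := fun x hx => by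
    have : fderiv ℝ F x = 0 := by
      by_contra h
      exact hx (support_fderiv_subset ℝ h)
    simp [this]
  have hind : ∀ c : ℝ, Integrable ((tsupport F).indicator fun _ => c) μ := fun c =>
    (integrable_indicator_iff hc.isCompact.measurableSet).2
      (integrableOn_const hc.isCompact.measure_lt_top.ne)
  -- Compare `x` with its projection `x - ℓ x • e` onto the hyperplane, where `F` is nonnegative.
  have hlow : ∀ x, F x ≥ -(C * ‖e‖ * |ℓ x|) := fun x => by
    have h0 := hpos (x - ℓ x • e) (by simp [he])
    have h1 := hC.dist_le_mul x (x - ℓ x • e)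
    rw [dist_eq_norm x, sub_sub_cancel, norm_smul, Real.norm_eq_abs, Real.dist_eq] at h1
    have := (abs_le.1 h1).1
    nlinarith
  -- integration by parts against `arctan (N ℓ)`
  have key : ∀ N : ℕ, ∫ x, Real.arctan (N * ℓ x) * fderiv ℝ F x e ∂μ
      = -∫ x, (N / (1 + (N * ℓ x) ^ 2)) * F x ∂μ := fun N => by
    obtain ⟨D, hD⟩ := lipschitz_sigma N
    have h := (hD.comp ℓ.lipschitz).integral_lineDeriv_mul_eq (μ := μ) hC hc (-e)
    have h1 : ∀ x, lineDeriv ℝ ((fun s : ℝ => Real.arctan (N * s)) ∘ ℓ) x (-e)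
        = -(N / (1 + (N * ℓ x) ^ 2)) := fun x => by
      have h2 : HasFDerivAt ((fun s : ℝ => Real.arctan (N * s)) ∘ ℓ)
          ((1 / (1 + (N * ℓ x) ^ 2) * (N * 1)) • (ℓ : E →L[ℝ] ℝ)) x :=
        (((hasDerivAt_id (ℓ x)).const_mul (N : ℝ)).arctan).comp_hasFDerivAt x ℓ.hasFDerivAt
      rw [h2.differentiableAt.lineDeriv_eq_fderiv, h2.fderiv]
      simp [he]
      ring
    simp only [h1, neg_neg] at h
    rw [← integral_neg]
    simp only [← neg_mul]
    rw [h]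
    refine integral_congr_ae ?_
    filter_upwards [hdiff] with x hx
    simp only [Function.comp]
    rw [hx.lineDeriv_eq_fderiv, mul_comm]
  have lim1 : Tendsto (fun N : ℕ => ∫ x, Real.arctan (N * ℓ x) * fderiv ℝ F x e ∂μ) atTop
      (𝓝 (∫ x, (Real.pi / 2 * SignType.sign (ℓ x)) * fderiv ℝ F x e ∂μ)) := by
    refine tendsto_integral_of_dominated_convergence
      ((tsupport F).indicator fun _ => Real.pi / 2 * (C * ‖e‖)) ?_ (hind _) ?_ ?_
    · intro N
      exact ((Real.continuous_arctan.comp (by fun_prop)).measurable.mul hmeas).aestronglyMeasurable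
    · intro N
      refine Eventually.of_forall fun x => ?_
      by_cases hx : x ∈ tsupport F
      · rw [indicator_of_mem hx, norm_mul]
        refine mul_le_mul ?_ (hbd x) (norm_nonneg _) (by positivity)
        rw [Real.norm_eq_abs, abs_le]
        exact ⟨(Real.neg_pi_div_two_lt_arctan _).le, (Real.arctan_lt_pi_div_two _).le⟩
      · rw [indicator_of_notMem hx, hsupp x hx]
        simp
    · exact Eventually.of_forall fun x => (tendsto_arctan_mul _).mul_const _
  -- The derivative of `arctan (N ℓ)` is an approximate delta on the hyperplane. Weighted by `|ℓ|`
  -- it is at most `1` and tends to `0` pointwise, so the Lipschitz error in `hlow` disappears in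
  -- the limit.
  have lim2 : Tendsto (fun N : ℕ => ∫ x, (tsupport F).indicator
      (fun x => (N / (1 + (N * ℓ x) ^ 2)) * (C * ‖e‖ * |ℓ x|)) x ∂μ) atTop
      (𝓝 (∫ _, (0 : ℝ) ∂μ)) := by
    refine tendsto_integral_of_dominated_convergence
      ((tsupport F).indicator fun _ => C * ‖e‖) ?_ (hind _) ?_ ?_
    · intro N
      refine (Measurable.indicator ?_ hc.isCompact.measurableSet).aestronglyMeasurable
      have : Continuous ℓ := ℓ.continuous
      fun_prop
    · intro N
      refine Eventually.of_forall fun x => ?_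
      by_cases hx : x ∈ tsupport F
      · rw [indicator_of_mem hx, indicator_of_mem hx, Real.norm_eq_abs,
          abs_of_nonneg (by positivity)]
        have h1 : (N / (1 + (N * ℓ x) ^ 2)) * |ℓ x| ≤ 1 := by
          rw [div_mul_eq_mul_div, div_le_one (by positivity)]
          have : (N * ℓ x) ^ 2 = (N * |ℓ x|) ^ 2 := by rw [mul_pow, mul_pow, sq_abs]
          rw [this]
          nlinarith [sq_nonneg (N * |ℓ x| - 1)]
        calc _ = (C * ‖e‖) * ((N / (1 + (N * ℓ x) ^ 2)) * |ℓ x|) := by ring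
          _ ≤ (C * ‖e‖) * 1 := mul_le_mul_of_nonneg_left h1 (by positivity)
          _ = _ := mul_one _
      · rw [indicator_of_notMem hx, indicator_of_notMem hx]
        simp
    · refine Eventually.of_forall fun x => ?_
      by_cases hx : x ∈ tsupport F
      · simp only [indicator_of_mem hx]
        by_cases hl : ℓ x = 0
        · simp [hl]
        · have h1 : Tendsto (fun N : ℕ => (N : ℝ) / (1 + (N * ℓ x) ^ 2)) atTop (𝓝 0) := by
            have h3 : Tendsto (fun N : ℕ => (ℓ x ^ 2)⁻¹ * ((N : ℝ))⁻¹) atTop (𝓝 0) := by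
              simpa using tendsto_inv_atTop_nhds_zero_nat.const_mul ((ℓ x ^ 2)⁻¹)
            refine squeeze_zero (fun N => by positivity) (fun N => ?_) h3
            rcases Nat.eq_zero_or_pos N with rfl | hN
            · simp
            have hN' : (0 : ℝ) < N := by exact_mod_cast hN
            rw [← mul_inv, div_le_iff₀ (by positivity), inv_mul_eq_div,
              le_div_iff₀ (by positivity)]
            nlinarith
          simpa using h1.mul_const (C * ‖e‖ * |ℓ x|)
      · simp only [indicator_of_notMem hx]
        exact tendsto_const_nhds
  have hle : ∀ N : ℕ, ∫ x, Real.arctan (N * ℓ x) * fderiv ℝ F x e ∂μ ≤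
      ∫ x, (tsupport F).indicator
      (fun x => (N / (1 + (N * ℓ x) ^ 2)) * (C * ‖e‖ * |ℓ x|)) x ∂μ := fun N => by
    rw [key N, ← integral_neg]
    have hcont : Continuous fun x => (N : ℝ) / (1 + (N * ℓ x) ^ 2) := by
      refine continuous_const.div (by fun_prop) fun x => by positivity
    refine integral_mono ?_ ?_ fun x => ?_
    · refine Integrable.neg ?_
      exact (hcont.mul hF.continuous).integrable_of_hasCompactSupport hc.mul_left
    · refine (integrable_indicator_iff hc.isCompact.measurableSet).2 ?_
      refine ContinuousOn.integrableOn_compact hc.isCompact (Continuous.continuousOn ?_)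
      exact hcont.mul (by fun_prop)
    · by_cases hx : x ∈ tsupport F
      · simp only [indicator_of_mem hx]
        rw [← mul_neg]
        refine mul_le_mul_of_nonneg_left ?_ (by positivity)
        linarith [hlow x]
      · simp only [indicator_of_notMem hx, image_eq_zero_of_notMem_tsupport hx]
        simp
  have hfin := le_of_tendsto_of_tendsto' lim1 lim2 hle
  simp only [integral_zero, mul_assoc] at hfin
  rw [integral_const_mul] at hfin
  by_contra! hcon
  have := mul_pos (div_pos Real.pi_pos two_pos) hcon
  linarith

end LocallyLipschitz

/-! ### The Gaussian measure and the integrability class of the slice. -/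

section Gaussian

variable {n : ℕ}

/-- The density of `gammaMeasure n`. -/
def gaussDensity (n : ℕ) (x : Sp n) : ℝ :=
  (4 * Real.pi) ^ (-((n : ℝ) + 1) / 2) * Real.exp (-‖x‖ ^ 2 / 4)

theorem gaussDensity_pos (x : Sp n) : 0 < gaussDensity n x := by
  unfold gaussDensity
  have := Real.pi_pos
  positivity

theorem contDiff_gaussDensity {m : WithTop ℕ∞} : ContDiff ℝ m (gaussDensity n) := by
  unfold gaussDensity
  exact contDiff_const.mul (((contDiff_norm_sq ℝ).neg.div_const _).exp)

theorem hasFDerivAt_gaussDensity (x : Sp n) :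
    HasFDerivAt (gaussDensity n) ((-(gaussDensity n x / 2)) • innerSL ℝ x) x := by
  unfold gaussDensity
  have h := (((hasStrictFDerivAt_norm_sq x).hasFDerivAt.neg.mul_const (4 : ℝ)⁻¹).exp).const_mul
    ((4 * Real.pi) ^ (-((n : ℝ) + 1) / 2))
  simp only [← div_eq_mul_inv] at h
  convert! h using 1
  ext y
  simp
  ring

theorem fderiv_gaussDensity_apply (x e : Sp n) :
    fderiv ℝ (gaussDensity n) x e = -(1 / 2) * inner ℝ x e * gaussDensity n x := by
  rw [(hasFDerivAt_gaussDensity x).fderiv]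
  simp
  ring

theorem gammaMeasure_eq : gammaMeasure n =
    volume.withDensity fun x => ENNReal.ofReal (gaussDensity n x) := rfl

theorem measurable_gaussDensity : Measurable (gaussDensity n) :=
  (contDiff_gaussDensity (m := 0)).continuous.measurable

theorem integral_gammaMeasure (f : Sp n → ℝ) :
    ∫ x, f x ∂gammaMeasure n = ∫ x, gaussDensity n x * f x := by
  rw [gammaMeasure_eq, integral_withDensity_eq_integral_toReal_smul
    (measurable_gaussDensity.ennreal_ofReal) (by simp)]
  simp [ENNReal.toReal_ofReal (gaussDensity_pos _).le]

theorem integrable_gammaMeasure_iff (f : Sp n → ℝ) :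
    Integrable f (gammaMeasure n) ↔ Integrable (fun x => gaussDensity n x * f x) := by
  rw [gammaMeasure_eq, integrable_withDensity_iff_integrable_smul'
    (measurable_gaussDensity.ennreal_ofReal) (by simp)]
  simp [ENNReal.toReal_ofReal (gaussDensity_pos _).le]

theorem gammaMeasure_absolutelyContinuous : gammaMeasure n ≪ volume :=
  withDensity_absolutelyContinuous _ _

/-- Half of the Gaussian exponent absorbs the linear one: `c s ≤ s²/8 + 2c²`. The other half is
still integrable. -/
theorem integrable_exp_mul_norm (c : ℝ) :
    Integrable (fun x : Sp n => Real.exp (c * ‖x‖)) (gammaMeasure n) := by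
  rw [integrable_gammaMeasure_iff]
  have h := (GaussianFourier.integrable_cexp_neg_mul_sq_norm_add (V := Sp n) (b := (1 / 8 : ℂ))
    (by norm_num) 0 0).norm
  refine (h.const_mul ((4 * Real.pi) ^ (-((n : ℝ) + 1) / 2) * Real.exp (2 * c ^ 2))).mono'
    ?_ (Eventually.of_forall fun x => ?_)
  · refine (measurable_gaussDensity.mul ?_).aestronglyMeasurable
    fun_prop
  · rw [Real.norm_of_nonneg (by have := gaussDensity_pos x; positivity), Complex.norm_exp,
      gaussDensity, mul_assoc, mul_assoc, ← Real.exp_add, ← Real.exp_add]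
    refine mul_le_mul_of_nonneg_left (Real.exp_le_exp.2 ?_) (by have := Real.pi_pos; positivity)
    have : (-(1 / 8 : ℂ) * (‖x‖ : ℂ) ^ 2 + 0 * ((inner ℝ (0 : Sp n) x : ℝ) : ℂ)).re
        = -(1 / 8) * ‖x‖ ^ 2 := by
      rw [zero_mul, add_zero, ← Complex.ofReal_pow]
      have : (-(1 / 8 : ℂ)) = ((-(1 / 8) : ℝ) : ℂ) := by push_cast; ring
      rw [this, ← Complex.ofReal_mul, Complex.ofReal_re]
    rw [this]
    nlinarith [sq_nonneg (‖x‖ - 4 * c)]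

instance : IsFiniteMeasure (gammaMeasure n) := by
  have h := integrable_exp_mul_norm (n := n) 0
  simp only [zero_mul, Real.exp_zero] at h
  exact (integrable_const_iff_isFiniteMeasure one_ne_zero).1 h

/-- Locally Lipschitz functions with the integrability that the weak formulation with bounded test
functions needs. -/
structure Admissible (u : Sp n → ℝ) : Prop where
  lip : LocallyLipschitz u
  int_exp : ∀ c : ℝ, Integrable (fun x => Real.exp (c * ‖x‖) * u x) (gammaMeasure n)
  int_fderiv : Integrable (fun x => ‖fderiv ℝ u x‖) (gammaMeasure n)

theorem Admissible.integrable {u : Sp n → ℝ} (hu : Admissible u) :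
    Integrable u (gammaMeasure n) := by
  simpa using hu.int_exp 0

theorem Admissible.ae_differentiableAt {u : Sp n → ℝ} (hu : Admissible u) :
    ∀ᵐ x ∂gammaMeasure n, DifferentiableAt ℝ u x :=
  gammaMeasure_absolutelyContinuous.ae_le (ae_differentiableAt_of_locallyLipschitz volume hu.lip)

/-- By `2ab ≤ a² + b²`, finite energy together with the Gaussian integrability of every exponential
controls all exponential moments of `u`. -/
theorem admissible_of_sq {u : Sp n → ℝ} (hu : LocallyLipschitz u)
    (h : Integrable (fun x => u x ^ 2 + ‖gradient u x‖ ^ 2) (gammaMeasure n)) : Admissible u := by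
  have hn : ∀ x, ‖gradient u x‖ = ‖fderiv ℝ u x‖ := fun x => by
    rw [gradient, LinearIsometryEquiv.norm_map]
  have hmf : Measurable fun x => ‖fderiv ℝ u x‖ := (measurable_fderiv ℝ u).norm
  have hmu : Measurable u := hu.continuous.measurable
  refine ⟨hu, fun c => ?_, ?_⟩
  · refine ((integrable_exp_mul_norm (2 * c)).add h).mono'
      ((Measurable.aestronglyMeasurable (by fun_prop))) (Eventually.of_forall fun x => ?_)
    have : Real.exp (2 * c * ‖x‖) = Real.exp (c * ‖x‖) ^ 2 := by
      rw [← Real.exp_nat_mul]; push_cast; ring_nf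
    simp only [Pi.add_apply, this, norm_mul, Real.norm_eq_abs, Real.abs_exp]
    nlinarith [sq_nonneg (Real.exp (c * ‖x‖) - |u x|), sq_abs (u x), sq_nonneg ‖gradient u x‖,
      sq_nonneg (u x), sq_nonneg (Real.exp (c * ‖x‖))]
  · refine ((integrable_const (1 : ℝ)).add h).mono' hmf.aestronglyMeasurable
      (Eventually.of_forall fun x => ?_)
    simp only [Pi.add_apply, hn, norm_norm]
    nlinarith [sq_nonneg (‖fderiv ℝ u x‖ - 1), sq_nonneg (u x)]

end Gaussian

/-! ### Cutoffs at infinity. -/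

section Cutoff

variable {n : ℕ}

theorem exists_abs_deriv_smoothTransition_le :
    ∃ C : ℝ, 0 ≤ C ∧ ∀ x, |deriv Real.smoothTransition x| ≤ C := by
  have hc : Continuous (deriv Real.smoothTransition) :=
    (Real.smoothTransition.contDiff (n := 1)).continuous_deriv le_rfl
  have hs : HasCompactSupport (deriv Real.smoothTransition) := by
    refine HasCompactSupport.intro (isCompact_Icc (a := (0 : ℝ)) (b := 1)) fun x hx => ?_
    by_cases h0 : x < 0
    · have : Real.smoothTransition =ᶠ[𝓝 x] fun _ => (0 : ℝ) := by
        filter_upwards [Iio_mem_nhds h0] with y hy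
        exact Real.smoothTransition.zero_of_nonpos (le_of_lt hy)
      rw [this.deriv_eq, deriv_const]
    · have h1 : 1 < x := by
        by_contra h
        exact hx ⟨not_lt.1 h0, not_lt.1 h⟩
      have : Real.smoothTransition =ᶠ[𝓝 x] fun _ => (1 : ℝ) := by
        filter_upwards [Ioi_mem_nhds h1] with y hy
        exact Real.smoothTransition.one_of_one_le (le_of_lt hy)
      rw [this.deriv_eq, deriv_const]
  obtain ⟨C, hC⟩ := hs.exists_bound_of_continuous hc
  exact ⟨C, (norm_nonneg _).trans (hC 0), hC⟩

/-- A smooth cutoff that is `1` on the ball of radius `N + 1` and vanishes outside of the ball of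
twice that radius. -/
def cutoff (N : ℕ) (x : Sp n) : ℝ := Real.smoothTransition (2 - ‖x‖ ^ 2 / ((N : ℝ) + 1) ^ 2)

theorem contDiff_cutoff (N : ℕ) {m : ℕ∞} : ContDiff ℝ m (cutoff (n := n) N) :=
  Real.smoothTransition.contDiff.comp (contDiff_const.sub ((contDiff_norm_sq ℝ).div_const _))

theorem cutoff_nonneg (N : ℕ) (x : Sp n) : 0 ≤ cutoff N x := Real.smoothTransition.nonneg _

theorem cutoff_le_one (N : ℕ) (x : Sp n) : cutoff N x ≤ 1 := Real.smoothTransition.le_one _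

theorem cutoff_eq_one {N : ℕ} {x : Sp n} (hx : ‖x‖ ≤ N + 1) : cutoff N x = 1 := by
  refine Real.smoothTransition.one_of_one_le ?_
  have : ‖x‖ ^ 2 / ((N : ℝ) + 1) ^ 2 ≤ 1 := by
    rw [div_le_one (by positivity)]
    gcongr
  linarith

theorem cutoff_eq_zero {N : ℕ} {x : Sp n} (hx : 2 * ((N : ℝ) + 1) ≤ ‖x‖) : cutoff N x = 0 := by
  refine Real.smoothTransition.zero_of_nonpos ?_
  have : 2 ≤ ‖x‖ ^ 2 / ((N : ℝ) + 1) ^ 2 := by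
    rw [le_div_iff₀ (by positivity)]
    nlinarith [Nat.cast_nonneg (α := ℝ) N]
  linarith

theorem hasCompactSupport_cutoff (N : ℕ) : HasCompactSupport (cutoff (n := n) N) := by
  refine HasCompactSupport.intro (isCompact_closedBall (0 : Sp n) (2 * ((N : ℝ) + 1)))
    fun x hx => cutoff_eq_zero ?_
  rw [mem_closedBall_zero_iff, not_le] at hx
  exact hx.le

/-- On the ball of radius `2(N + 1)` the inner derivative is `2‖x‖/(N + 1)² ≤ 4`, and outside of it
the cutoff vanishes. Uniformity in `N` is what dominated convergence needs. -/
theorem exists_norm_fderiv_cutoff_le :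
    ∃ C : ℝ, 0 ≤ C ∧ ∀ (N : ℕ) (x : Sp n), ‖fderiv ℝ (cutoff N) x‖ ≤ C := by
  obtain ⟨C, hC0, hC⟩ := exists_abs_deriv_smoothTransition_le
  refine ⟨4 * C, by positivity, fun N x => ?_⟩
  by_cases hx : 2 * ((N : ℝ) + 1) < ‖x‖
  · have : cutoff N =ᶠ[𝓝 x] fun _ => (0 : ℝ) := by
      filter_upwards [(isOpen_lt continuous_const continuous_norm).mem_nhds hx] with y hy
      exact cutoff_eq_zero (le_of_lt hy)
    rw [this.fderiv_eq, fderiv_const_apply, norm_zero]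
    positivity
  · have h1 : HasDerivAt Real.smoothTransition (deriv Real.smoothTransition
        (2 - ‖x‖ ^ 2 * (((N : ℝ) + 1) ^ 2)⁻¹)) (2 - ‖x‖ ^ 2 * (((N : ℝ) + 1) ^ 2)⁻¹) :=
      ((Real.smoothTransition.contDiff (n := 1)).differentiable (by simp)).differentiableAt.hasDerivAt
    have h2 := h1.comp_hasFDerivAt x
      (((hasStrictFDerivAt_norm_sq x).hasFDerivAt.mul_const ((((N : ℝ) + 1) ^ 2)⁻¹)).const_sub 2)
    have h3 : cutoff (n := n) N = Real.smoothTransition ∘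
        fun x => 2 - ‖x‖ ^ 2 * (((N : ℝ) + 1) ^ 2)⁻¹ := by
      funext y
      simp [cutoff, div_eq_mul_inv]
    rw [h3, h2.fderiv, norm_smul, norm_neg, norm_smul, ← Nat.cast_smul_eq_nsmul ℝ, norm_smul,
      innerSL_apply_norm, Real.norm_eq_abs, Real.norm_eq_abs, mul_comm 4 C]
    refine mul_le_mul (hC _) ?_ (by positivity) hC0
    rw [abs_of_nonneg (by positivity), inv_mul_le_iff₀ (by positivity)]
    push_cast
    rw [Real.norm_eq_abs, abs_two]
    nlinarith [Nat.cast_nonneg (α := ℝ) N]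

theorem eventually_cutoff_eventuallyEq_one (x : Sp n) :
    ∀ᶠ N : ℕ in atTop, cutoff N =ᶠ[𝓝 x] fun _ => (1 : ℝ) := by
  obtain ⟨k, hk⟩ := exists_nat_gt ‖x‖
  filter_upwards [eventually_ge_atTop k] with N hN
  have : ‖x‖ < N + 1 := by
    have : (k : ℝ) ≤ N := by exact_mod_cast hN
    linarith
  filter_upwards [(isOpen_lt continuous_norm continuous_const).mem_nhds this] with y hy
  exact cutoff_eq_one (le_of_lt hy)

end Cutoff

/-! ### Gradients and the last coordinate. -/

variable {n : ℕ}

theorem ae_gammaMeasure_of_ae {p : Sp n → Prop} (h : ∀ᵐ x, p x) : ∀ᵐ x ∂gammaMeasure n, p x :=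
  gammaMeasure_absolutelyContinuous.ae_le h

theorem norm_gradient (f : Sp n → ℝ) (x : Sp n) : ‖gradient f x‖ = ‖fderiv ℝ f x‖ := by
  rw [gradient, LinearIsometryEquiv.norm_map]

theorem fderiv_apply_eq_inner_gradient (f : Sp n → ℝ) (x e : Sp n) :
    fderiv ℝ f x e = inner ℝ (gradient f x) e := by
  rw [← toDual_gradient, InnerProductSpace.toDual_apply_apply]

theorem measurable_gradient (f : Sp n → ℝ) : Measurable (gradient f) :=
  (InnerProductSpace.toDual ℝ (Sp n)).symm.continuous.measurable.comp (measurable_fderiv ℝ f)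

theorem gradient_mul {f g : Sp n → ℝ} {x : Sp n} (hf : DifferentiableAt ℝ f x)
    (hg : DifferentiableAt ℝ g x) :
    gradient (fun y => f y * g y) x = f x • gradient g x + g x • gradient f x := by
  simp only [gradient]
  rw [fderiv_fun_mul hf hg, map_add, map_smulₛₗ, map_smulₛₗ]
  simp

theorem gradient_add {f g : Sp n → ℝ} {x : Sp n} (hf : DifferentiableAt ℝ f x)
    (hg : DifferentiableAt ℝ g x) :
    gradient (fun y => f y + g y) x = gradient f x + gradient g x := by
  simp only [gradient]
  rw [fderiv_fun_add hf hg, map_add]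

theorem gradient_inner_right (ξ x : Sp n) : gradient (fun y => inner ℝ ξ y) x = ξ := by
  have : HasGradientAt (fun y => inner ℝ ξ y) ξ x := by
    rw [hasGradientAt_iff_hasFDerivAt]
    exact (InnerProductSpace.toDual ℝ (Sp n) ξ).hasFDerivAt
  exact this.gradient

theorem gradient_comp {φ : ℝ → ℝ} {φ' : ℝ} {f : Sp n → ℝ} {x : Sp n} (hφ : HasDerivAt φ φ' (f x))
    (hf : DifferentiableAt ℝ f x) : gradient (fun y => φ (f y)) x = φ' • gradient f x := by
  have h := hφ.comp_hasFDerivAt x hf.hasFDerivAt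
  have h2 : fderiv ℝ (fun y => φ (f y)) x = φ' • fderiv ℝ f x := h.fderiv
  simp only [gradient, h2, map_smulₛₗ]
  simp

/-- The last coordinate as a continuous linear functional. -/
def lastCoord (n : ℕ) : Sp n →L[ℝ] ℝ := EuclideanSpace.proj (Fin.last n)

@[simp] theorem lastCoord_apply (x : Sp n) : lastCoord n x = x (Fin.last n) := rfl

@[simp] theorem lastCoord_eLast : (eLast n) (Fin.last n) = 1 := by simp [eLast]

@[simp] theorem norm_eLast : ‖eLast n‖ = 1 := by simp [eLast]

theorem inner_eLast (x : Sp n) : inner ℝ x (eLast n) = x (Fin.last n) := by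
  simp [eLast, EuclideanSpace.inner_single_right]

theorem abs_last_le_norm (x : Sp n) : |x (Fin.last n)| ≤ ‖x‖ := by
  simpa using EuclideanSpace.norm_eq x ▸ PiLp.norm_apply_le x (Fin.last n)

theorem ae_last_ne_zero : ∀ᵐ x : Sp n, x (Fin.last n) ≠ 0 := by
  have h : volume ((LinearMap.ker (lastCoord n : Sp n →ₗ[ℝ] ℝ) : Submodule ℝ (Sp n)) : Set (Sp n))
      = 0 := by
    refine Measure.addHaar_submodule volume _ fun htop => ?_
    have : eLast n ∈ LinearMap.ker (lastCoord n : Sp n →ₗ[ℝ] ℝ) := htop ▸ Submodule.mem_top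
    rw [LinearMap.mem_ker] at this
    simp at this
  rw [ae_iff]
  convert! h using 2
  ext x
  simp

/-- The sign of the last coordinate. -/
def sgn (x : Sp n) : ℝ := ((SignType.sign (x (Fin.last n)) : SignType) : ℝ)

theorem measurable_sgn : Measurable (sgn (n := n)) :=
  measurable_signType_cast.comp (lastCoord n).continuous.measurable

theorem abs_sgn_le_one (x : Sp n) : |sgn x| ≤ 1 := abs_sign_le_one _

/-! ### The two bilinear forms on the slice and limits in the test function. -/

/-- The weighted integral of the Gaussian divergence of `u g e`. -/
def ibpForm (w : Sp n → ℝ) (e : Sp n) (u g : Sp n → ℝ) : ℝ :=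
  ∫ x, w x * (fderiv ℝ u x e * g x + u x * fderiv ℝ g x e - 1 / 2 * inner ℝ x e * (u x * g x))
    ∂gammaMeasure n

/-- The weak form of `Δu - x/2·∇u + (lam/2) u`, up to the sign. -/
def heatForm (lam : ℝ) (u f : Sp n → ℝ) : ℝ :=
  ∫ x, (fderiv ℝ u x (gradient f x) - lam / 2 * u x * f x) ∂gammaMeasure n

/-- A measurable function that is bounded with bounded gradient. -/
structure BoundedC1 (C : ℝ) (f : Sp n → ℝ) : Prop where
  meas : Measurable f
  bound : ∀ x, |f x| ≤ C
  bound_fderiv : ∀ᵐ x, ‖fderiv ℝ f x‖ ≤ C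

theorem BoundedC1.nonneg {C : ℝ} {f : Sp n → ℝ} (h : BoundedC1 C f) : 0 ≤ C :=
  (abs_nonneg _).trans (h.bound 0)

theorem BoundedC1.mono {C D : ℝ} {f : Sp n → ℝ} (h : BoundedC1 C f) (hCD : C ≤ D) :
    BoundedC1 D f :=
  ⟨h.meas, fun x => (h.bound x).trans hCD, h.bound_fderiv.mono fun _ hx => hx.trans hCD⟩

/-- A common majorant for the integrands of both forms. The exponential absorbs the factor `‖x‖`
that comes from differentiating the Gaussian. -/
theorem Admissible.integrable_majorant {u : Sp n → ℝ} (hu : Admissible u) (C : ℝ) :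
    Integrable (fun x => C * ‖fderiv ℝ u x‖ + C * |Real.exp (1 * ‖x‖) * u x|)
      (gammaMeasure n) :=
  (hu.int_fderiv.const_mul C).add ((hu.int_exp 1).abs.const_mul C)

theorem abs_le_abs_exp_mul (x : Sp n) (a : ℝ) : (1 + ‖x‖) * |a| ≤ |Real.exp (1 * ‖x‖) * a| := by
  rw [abs_mul, Real.abs_exp, one_mul]
  gcongr
  linarith [Real.add_one_le_exp ‖x‖]

theorem ibp_integrand_bound {w : Sp n → ℝ} (hw : ∀ x, |w x| ≤ 1) (e : Sp n) {u g : Sp n → ℝ}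
    {C : ℝ} {x : Sp n} (h0 : |g x| ≤ C) (h1 : ‖fderiv ℝ g x‖ ≤ C) :
    ‖w x * (fderiv ℝ u x e * g x + u x * fderiv ℝ g x e - 1 / 2 * inner ℝ x e * (u x * g x))‖
      ≤ (‖e‖ * C) * ‖fderiv ℝ u x‖ + (‖e‖ * C) * |Real.exp (1 * ‖x‖) * u x| := by
  have hC : 0 ≤ C := (abs_nonneg _).trans h0
  have a1 : |fderiv ℝ u x e| ≤ ‖fderiv ℝ u x‖ * ‖e‖ := (fderiv ℝ u x).le_opNorm e
  have a2 : |fderiv ℝ g x e| ≤ C * ‖e‖ :=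
    ((fderiv ℝ g x).le_opNorm e).trans (mul_le_mul_of_nonneg_right h1 (norm_nonneg _))
  have a3 : |inner ℝ x e| ≤ ‖x‖ * ‖e‖ := abs_real_inner_le_norm x e
  have b1 : |fderiv ℝ u x e * g x| ≤ ‖fderiv ℝ u x‖ * ‖e‖ * C := by
    rw [abs_mul]; gcongr
  have b2 : |u x * fderiv ℝ g x e| ≤ |u x| * (C * ‖e‖) := by
    rw [abs_mul]; gcongr
  have b3 : |1 / 2 * inner ℝ x e * (u x * g x)| ≤ ‖x‖ * ‖e‖ * (|u x| * C) := by
    rw [abs_mul, abs_mul, abs_mul]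
    have : |(1 / 2 : ℝ)| * |inner ℝ x e| ≤ ‖x‖ * ‖e‖ := by
      rw [abs_of_pos (by norm_num : (0 : ℝ) < 1 / 2)]
      linarith [abs_nonneg (inner ℝ x e : ℝ)]
    gcongr
  rw [norm_mul, Real.norm_eq_abs, Real.norm_eq_abs]
  calc _ ≤ 1 * |fderiv ℝ u x e * g x + u x * fderiv ℝ g x e -
        1 / 2 * inner ℝ x e * (u x * g x)| := by gcongr; exact hw x
    _ ≤ |fderiv ℝ u x e * g x| + |u x * fderiv ℝ g x e| +
        |1 / 2 * inner ℝ x e * (u x * g x)| := by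
      rw [one_mul]
      exact (abs_sub _ _).trans (add_le_add_left (abs_add_le _ _) _)
    _ ≤ ‖fderiv ℝ u x‖ * ‖e‖ * C + (‖e‖ * C) * ((1 + ‖x‖) * |u x|) := by nlinarith
    _ ≤ _ := by
      have := mul_le_mul_of_nonneg_left (abs_le_abs_exp_mul x (u x))
        (mul_nonneg (norm_nonneg e) hC)
      linarith

theorem measurable_ibp_integrand {w : Sp n → ℝ} (hw : Measurable w) (e : Sp n) {u g : Sp n → ℝ}
    (hu : Measurable u) (hg : Measurable g) :
    Measurable fun x => w x * (fderiv ℝ u x e * g x + u x * fderiv ℝ g x e -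
      1 / 2 * inner ℝ x e * (u x * g x)) := by
  have h1 := measurable_fderiv_apply_const ℝ u e
  have h2 := measurable_fderiv_apply_const ℝ g e
  fun_prop

theorem integrable_ibp {w : Sp n → ℝ} (hw : Measurable w) (hw1 : ∀ x, |w x| ≤ 1) (e : Sp n)
    {u g : Sp n → ℝ} (hu : Admissible u) {C : ℝ} (hg : BoundedC1 C g) :
    Integrable (fun x => w x * (fderiv ℝ u x e * g x + u x * fderiv ℝ g x e -
      1 / 2 * inner ℝ x e * (u x * g x))) (gammaMeasure n) := by
  refine (hu.integrable_majorant (‖e‖ * C)).mono'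
    (measurable_ibp_integrand hw e hu.lip.continuous.measurable hg.meas).aestronglyMeasurable ?_
  filter_upwards [ae_gammaMeasure_of_ae hg.bound_fderiv] with x hx
  exact ibp_integrand_bound hw1 e (hg.bound x) hx

theorem tendsto_ibpForm {w : Sp n → ℝ} (hw : Measurable w) (hw1 : ∀ x, |w x| ≤ 1) (e : Sp n)
    {u : Sp n → ℝ} (hu : Admissible u) {C : ℝ} {G : ℕ → Sp n → ℝ} {g : Sp n → ℝ}
    (hG : ∀ N, BoundedC1 C (G N)) (h0 : ∀ᵐ x, Tendsto (fun N => G N x) atTop (𝓝 (g x)))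
    (h1 : ∀ᵐ x, Tendsto (fun N => fderiv ℝ (G N) x) atTop (𝓝 (fderiv ℝ g x))) :
    Tendsto (fun N => ibpForm w e u (G N)) atTop (𝓝 (ibpForm w e u g)) := by
  refine tendsto_integral_of_dominated_convergence _ (fun N => ?_)
    (hu.integrable_majorant (‖e‖ * C)) (fun N => ?_) ?_
  · exact (measurable_ibp_integrand hw e hu.lip.continuous.measurable
      (hG N).meas).aestronglyMeasurable
  · filter_upwards [ae_gammaMeasure_of_ae (hG N).bound_fderiv] with x hx
    exact ibp_integrand_bound hw1 e ((hG N).bound x) hx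
  · filter_upwards [ae_gammaMeasure_of_ae h0, ae_gammaMeasure_of_ae h1] with x hx0 hx1
    have hx2 : Tendsto (fun N => fderiv ℝ (G N) x e) atTop (𝓝 (fderiv ℝ g x e)) :=
      ((ContinuousLinearMap.apply ℝ ℝ e).continuous.tendsto _).comp hx1
    exact (((hx0.const_mul _).add (hx2.const_mul _)).sub
      ((hx0.const_mul _).const_mul _)).const_mul _

theorem heat_integrand_bound (lam : ℝ) {u f : Sp n → ℝ} {C : ℝ} {x : Sp n} (h0 : |f x| ≤ C)
    (h1 : ‖fderiv ℝ f x‖ ≤ C) :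
    ‖fderiv ℝ u x (gradient f x) - lam / 2 * u x * f x‖
      ≤ ((1 + |lam|) * C) * ‖fderiv ℝ u x‖ + ((1 + |lam|) * C) * |Real.exp (1 * ‖x‖) * u x| := by
  have hC : 0 ≤ C := (abs_nonneg _).trans h0
  have a1 : |fderiv ℝ u x (gradient f x)| ≤ ‖fderiv ℝ u x‖ * C := by
    refine ((fderiv ℝ u x).le_opNorm _).trans ?_
    rw [norm_gradient]
    gcongr
  have a2 : |lam / 2 * u x * f x| ≤ |lam| * |u x| * C := by
    rw [abs_mul, abs_mul]
    have : |lam / 2| ≤ |lam| := by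
      rw [abs_div, abs_two]; linarith [abs_nonneg lam]
    gcongr
  have a3 := abs_le_abs_exp_mul x (u x)
  have a4 : |u x| ≤ |Real.exp (1 * ‖x‖) * u x| := by
    nlinarith [abs_nonneg (u x), norm_nonneg x]
  have h5 : 0 ≤ |lam| := abs_nonneg _
  have h6 : |lam| * C * |u x| ≤ |lam| * C * |Real.exp (1 * ‖x‖) * u x| := by gcongr
  have h7 : 0 ≤ |lam| * C * ‖fderiv ℝ u x‖ := by positivity
  have h8 : 0 ≤ C * |Real.exp (1 * ‖x‖) * u x| := by positivity
  rw [Real.norm_eq_abs]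
  refine (abs_sub _ _).trans ?_
  nlinarith

theorem measurable_heat_integrand (lam : ℝ) {u f : Sp n → ℝ} (hu : Measurable u)
    (hf : Measurable f) :
    Measurable fun x => fderiv ℝ u x (gradient f x) - lam / 2 * u x * f x := by
  have h1 : Measurable fun x => fderiv ℝ u x (gradient f x) := by
    simp only [fderiv_apply_eq_inner_gradient]
    exact (measurable_gradient u).inner (measurable_gradient f)
  fun_prop

theorem integrable_heat (lam : ℝ) {u f : Sp n → ℝ} (hu : Admissible u) {C : ℝ}
    (hf : BoundedC1 C f) :
    Integrable (fun x => fderiv ℝ u x (gradient f x) - lam / 2 * u x * f x) (gammaMeasure n) := by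
  refine (hu.integrable_majorant ((1 + |lam|) * C)).mono'
    (measurable_heat_integrand lam hu.lip.continuous.measurable hf.meas).aestronglyMeasurable ?_
  filter_upwards [ae_gammaMeasure_of_ae hf.bound_fderiv] with x hx
  exact heat_integrand_bound lam (hf.bound x) hx

theorem tendsto_heatForm (lam : ℝ) {u : Sp n → ℝ} (hu : Admissible u) {C : ℝ}
    {G : ℕ → Sp n → ℝ} {g : Sp n → ℝ}
    (hG : ∀ N, BoundedC1 C (G N)) (h0 : ∀ᵐ x, Tendsto (fun N => G N x) atTop (𝓝 (g x)))
    (h1 : ∀ᵐ x, Tendsto (fun N => fderiv ℝ (G N) x) atTop (𝓝 (fderiv ℝ g x))) :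
    Tendsto (fun N => heatForm lam u (G N)) atTop (𝓝 (heatForm lam u g)) := by
  refine tendsto_integral_of_dominated_convergence _ (fun N => ?_)
    (hu.integrable_majorant ((1 + |lam|) * C)) (fun N => ?_) ?_
  · exact (measurable_heat_integrand lam hu.lip.continuous.measurable
      (hG N).meas).aestronglyMeasurable
  · filter_upwards [ae_gammaMeasure_of_ae (hG N).bound_fderiv] with x hx
    exact heat_integrand_bound lam ((hG N).bound x) hx
  · filter_upwards [ae_gammaMeasure_of_ae h0, ae_gammaMeasure_of_ae h1] with x hx0 hx1
    have hx2 : Tendsto (fun N => gradient (G N) x) atTop (𝓝 (gradient g x)) :=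
      ((InnerProductSpace.toDual ℝ (Sp n)).symm.continuous.tendsto _).comp hx1
    have hx3 : Tendsto (fun N => fderiv ℝ u x (gradient (G N) x)) atTop
        (𝓝 (fderiv ℝ u x (gradient g x))) := ((fderiv ℝ u x).continuous.tendsto _).comp hx2
    exact hx3.sub (hx0.const_mul _)

theorem heatForm_add (lam : ℝ) {u f g : Sp n → ℝ} (hu : Admissible u) {C D : ℝ}
    (hf : BoundedC1 C f) (hg : BoundedC1 D g) (hfd : ∀ᵐ x, DifferentiableAt ℝ f x)
    (hgd : ∀ᵐ x, DifferentiableAt ℝ g x) :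
    heatForm lam u (fun x => f x + g x) = heatForm lam u f + heatForm lam u g := by
  unfold heatForm
  rw [← integral_add (integrable_heat lam hu hf) (integrable_heat lam hu hg)]
  refine integral_congr_ae ?_
  filter_upwards [ae_gammaMeasure_of_ae hfd, ae_gammaMeasure_of_ae hgd] with x h1 h2
  rw [gradient_add h1 h2, map_add]
  ring

theorem heatForm_neg (lam : ℝ) (u f : Sp n → ℝ) :
    heatForm lam u (fun x => -f x) = -heatForm lam u f := by
  unfold heatForm
  rw [← integral_neg]
  congr 1
  funext x
  simp only [gradient, fderiv_fun_neg, map_neg]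
  ring

theorem heatForm_sub_left (lam : ℝ) {u v f : Sp n → ℝ} (hu : Admissible u) (hv : Admissible v)
    {C : ℝ} (hf : BoundedC1 C f) :
    heatForm lam (fun x => u x - v x) f = heatForm lam u f - heatForm lam v f := by
  unfold heatForm
  rw [← integral_sub (integrable_heat lam hu hf) (integrable_heat lam hv hf)]
  refine integral_congr_ae ?_
  filter_upwards [hu.ae_differentiableAt, hv.ae_differentiableAt] with x h1 h2
  rw [fderiv_fun_sub h1 h2]
  simp
  ring

theorem ibpForm_neg (w : Sp n → ℝ) (e : Sp n) (u g : Sp n → ℝ) :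
    ibpForm w e u (fun x => -g x) = -ibpForm w e u g := by
  unfold ibpForm
  rw [← integral_neg]
  congr 1
  funext x
  simp only [fderiv_fun_neg, neg_apply]
  ring

/-- The drift term in `ibpForm` is exactly the derivative of the Gaussian density, so the integrand
is a full derivative in the direction `e`, multiplied by `w`. -/
theorem ibpForm_eq_integral_fderiv (w : Sp n → ℝ) (e : Sp n) {u g : Sp n → ℝ}
    (hu : LocallyLipschitz u) (hg : LocallyLipschitz g) :
    ibpForm w e u g =
      ∫ x, w x * fderiv ℝ (fun y => u y * g y * gaussDensity n y) x e := by
  rw [ibpForm, integral_gammaMeasure]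
  refine integral_congr_ae ?_
  filter_upwards [ae_differentiableAt_of_locallyLipschitz volume hu,
    ae_differentiableAt_of_locallyLipschitz volume hg] with x h1 h2
  rw [fderiv_fun_mul (h1.fun_mul h2) (hasFDerivAt_gaussDensity x).differentiableAt,
    fderiv_fun_mul h1 h2]
  simp only [add_apply, smul_apply, smul_eq_mul,
    fderiv_gaussDensity_apply]
  ring

theorem locallyLipschitz_mul_gaussDensity {u g : Sp n → ℝ}
    (hu : LocallyLipschitz u) (hg : LocallyLipschitz g) :
    LocallyLipschitz (fun y => u y * g y * gaussDensity n y) :=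
  locallyLipschitz_mul (locallyLipschitz_mul hu hg)
    (ContDiff.locallyLipschitz (𝕂 := ℝ) contDiff_gaussDensity)

theorem ibpForm_one_eq_zero_of_hasCompactSupport (e : Sp n) {u g : Sp n → ℝ}
    (hu : LocallyLipschitz u) (hg : LocallyLipschitz g) (hc : HasCompactSupport g) :
    ibpForm (fun _ => 1) e u g = 0 := by
  rw [ibpForm_eq_integral_fderiv _ _ hu hg]
  simp only [one_mul]
  exact integral_fderiv_eq_zero_of_hasCompactSupport _ (locallyLipschitz_mul_gaussDensity hu hg)
    (hc.mul_left.mul_right) e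

/-- Formally the form equals `-2 ∫ u g` over the thin space with the Gaussian weight. Only the sign
of this trace is used, so no trace theory enters. -/
theorem ibpForm_sgn_nonpos_of_hasCompactSupport {u g : Sp n → ℝ}
    (hu : LocallyLipschitz u) (hg : LocallyLipschitz g) (hc : HasCompactSupport g)
    (hpos : ∀ x, x (Fin.last n) = 0 → 0 ≤ u x * g x) :
    ibpForm sgn (eLast n) u g ≤ 0 := by
  rw [ibpForm_eq_integral_fderiv _ _ hu hg]
  refine integral_sign_mul_fderiv_nonpos volume (locallyLipschitz_mul_gaussDensity hu hg)
    (hc.mul_left.mul_right) (lastCoord n) (eLast n) (by simp) fun x hx => ?_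
  exact mul_nonneg (hpos x hx) (gaussDensity_pos x).le

theorem exists_boundedC1_cutoff_mul :
    ∃ D : ℝ, ∀ (C : ℝ) (f : Sp n → ℝ), BoundedC1 C f → (∀ᵐ x, DifferentiableAt ℝ f x) →
      ∀ N, BoundedC1 (D * C) (fun x => cutoff N x * f x) := by
  obtain ⟨K, hK0, hK⟩ := exists_norm_fderiv_cutoff_le (n := n)
  refine ⟨1 + K, fun C f hf hfd N => ?_⟩
  have hC := hf.nonneg
  refine ⟨(contDiff_cutoff N (m := 0)).continuous.measurable.mul hf.meas, fun x => ?_, ?_⟩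
  · rw [abs_mul, abs_of_nonneg (cutoff_nonneg N x)]
    nlinarith [mul_le_mul (cutoff_le_one N x) (hf.bound x) (abs_nonneg _) zero_le_one,
      mul_nonneg hK0 hC]
  · filter_upwards [hfd, hf.bound_fderiv] with x h1 h2
    rw [fderiv_fun_mul ((contDiff_cutoff N (m := 1)).differentiable (by simp) x) h1]
    refine (norm_add_le _ _).trans ?_
    rw [norm_smul, norm_smul, Real.norm_of_nonneg (cutoff_nonneg N x), Real.norm_eq_abs]
    have := mul_le_mul (cutoff_le_one N x) h2 (norm_nonneg _) zero_le_one
    have := mul_le_mul (hf.bound x) (hK N x) (norm_nonneg _) hC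
    linarith

theorem eventually_cutoff_mul_eventuallyEq (f : Sp n → ℝ) (x : Sp n) :
    ∀ᶠ N : ℕ in atTop, (fun y => cutoff N y * f y) =ᶠ[𝓝 x] f := by
  filter_upwards [eventually_cutoff_eventuallyEq_one x] with N hN
  filter_upwards [hN] with y hy
  rw [hy, one_mul]

theorem tendsto_of_eventually_eventuallyEq {F : ℕ → Sp n → ℝ} {f : Sp n → ℝ} {x : Sp n}
    (h : ∀ᶠ N in atTop, F N =ᶠ[𝓝 x] f) :
    Tendsto (fun N => F N x) atTop (𝓝 (f x)) ∧
      Tendsto (fun N => fderiv ℝ (F N) x) atTop (𝓝 (fderiv ℝ f x)) :=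
  ⟨tendsto_const_nhds.congr' (h.mono fun _ hN => hN.eq_of_nhds.symm),
    tendsto_const_nhds.congr' (h.mono fun _ hN => hN.fderiv_eq.symm)⟩

theorem locallyLipschitz_cutoff_mul (N : ℕ) {g : Sp n → ℝ} (hg : LocallyLipschitz g) :
    LocallyLipschitz (fun x => cutoff N x * g x) :=
  locallyLipschitz_mul (ContDiff.locallyLipschitz (𝕂 := ℝ) (contDiff_cutoff N)) hg

theorem tendsto_ibpForm_cutoff {w : Sp n → ℝ} (hw : Measurable w) (hw1 : ∀ x, |w x| ≤ 1) (e : Sp n)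
    {u g : Sp n → ℝ} (hu : Admissible u) (hg : LocallyLipschitz g) {C : ℝ} (hgb : BoundedC1 C g) :
    Tendsto (fun N => ibpForm w e u (fun x => cutoff N x * g x)) atTop (𝓝 (ibpForm w e u g)) := by
  obtain ⟨D, hD⟩ := exists_boundedC1_cutoff_mul (n := n)
  exact tendsto_ibpForm hw hw1 e hu
    (hD C g hgb (ae_differentiableAt_of_locallyLipschitz volume hg))
    (Eventually.of_forall fun x =>
      (tendsto_of_eventually_eventuallyEq (eventually_cutoff_mul_eventuallyEq g x)).1)
    (Eventually.of_forall fun x =>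
      (tendsto_of_eventually_eventuallyEq (eventually_cutoff_mul_eventuallyEq g x)).2)

theorem ibpForm_one_eq_zero (e : Sp n) {u g : Sp n → ℝ} (hu : Admissible u)
    (hg : LocallyLipschitz g) {C : ℝ} (hgb : BoundedC1 C g) :
    ibpForm (fun _ => 1) e u g = 0 := by
  have h := tendsto_ibpForm_cutoff measurable_const (w := fun _ => 1) (by simp) e hu hg hgb
  refine tendsto_nhds_unique h ?_
  refine tendsto_const_nhds.congr fun N => ?_
  exact (ibpForm_one_eq_zero_of_hasCompactSupport e hu.lip (locallyLipschitz_cutoff_mul N hg)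
    (hasCompactSupport_cutoff N).mul_right).symm

theorem ibpForm_sgn_nonpos {u g : Sp n → ℝ} (hu : Admissible u)
    (hg : LocallyLipschitz g) {C : ℝ} (hgb : BoundedC1 C g)
    (hpos : ∀ x, x (Fin.last n) = 0 → 0 ≤ u x * g x) :
    ibpForm sgn (eLast n) u g ≤ 0 := by
  have h := tendsto_ibpForm_cutoff measurable_sgn abs_sgn_le_one (eLast n) hu hg hgb
  refine le_of_tendsto' h fun N => ?_
  refine ibpForm_sgn_nonpos_of_hasCompactSupport hu.lip (locallyLipschitz_cutoff_mul N hg)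
    (hasCompactSupport_cutoff N).mul_right fun x hx => ?_
  nlinarith [mul_nonneg (cutoff_nonneg N x) (hpos x hx)]

/-- The trace vanishes with `g`: the inequality applies both to `g` and to `-g`. -/
theorem ibpForm_sgn_eq_zero {u g : Sp n → ℝ} (hu : Admissible u)
    (hg : LocallyLipschitz g) {C : ℝ} (hgb : BoundedC1 C g)
    (hzero : ∀ x, x (Fin.last n) = 0 → g x = 0) :
    ibpForm sgn (eLast n) u g = 0 := by
  refine le_antisymm (ibpForm_sgn_nonpos hu hg hgb fun x hx => by simp [hzero x hx]) ?_
  have h := ibpForm_sgn_nonpos (g := fun x => -g x) (C := C) hu hg.neg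
    ⟨hgb.meas.neg, fun x => by simpa using hgb.bound x, by simpa using hgb.bound_fderiv⟩
    fun x hx => by simp [hzero x hx]
  rw [ibpForm_neg] at h
  linarith

/-! ### From space-time to the slice `t = -1` in similarity variables. -/

theorem isOpen_past : IsOpen (past n) := isOpen_lt continuous_snd continuous_const

theorem locallyLipschitz_slice {q : Sp n × ℝ → ℝ} (hq : LocallyLipschitzOn (past n) q) :
    LocallyLipschitz (fun x => q (x, -1)) := by
  intro x
  have hx : ((x, -1) : Sp n × ℝ) ∈ past n := by simp [past]
  obtain ⟨K, t, ht, hK⟩ := hq hx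
  rw [isOpen_past.nhdsWithin_eq hx] at ht
  have hc : Continuous fun y : Sp n => (y, (-1 : ℝ)) := by fun_prop
  refine ⟨K, _, hc.continuousAt.preimage_mem_nhds ht, ?_⟩
  intro a ha b hb
  simpa [Prod.edist_eq] using hK ha hb

/-- The similarity variable `x / √(-t)`. -/
def simVar (z : Sp n × ℝ) : Sp n := (√(-z.2))⁻¹ • z.1

theorem hasDerivAt_sqrt_neg {t : ℝ} (ht : t < 0) :
    HasDerivAt (fun t => √(-t)) (-(1 / (2 * √(-t)))) t := by
  have h := (hasDerivAt_neg t).sqrt (by linarith)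
  convert! h using 1
  ring

theorem sqrt_neg_pos {t : ℝ} (ht : t < 0) : 0 < √(-t) := Real.sqrt_pos.2 (by linarith)

theorem hasFDerivAt_comp_simVar {g : Sp n → ℝ} {z : Sp n × ℝ} (hz : z.2 < 0)
    (hg : DifferentiableAt ℝ g (simVar z)) :
    DifferentiableAt ℝ (fun z => g (simVar z)) z ∧
    ∀ (e : Sp n) (τ : ℝ), fderiv ℝ (fun z => g (simVar z)) z (e, τ) =
      fderiv ℝ g (simVar z) ((√(-z.2))⁻¹ • e + (τ * (1 / 2 * ((√(-z.2))⁻¹) ^ 2)) • simVar z) := by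
  have hm := sqrt_neg_pos hz
  have h1 := ((hasDerivAt_sqrt_neg hz).inv hm.ne').comp_hasFDerivAt z
    (hasFDerivAt_snd (𝕜 := ℝ) (E := Sp n) (F := ℝ) (p := z))
  have h2 := h1.smul (hasFDerivAt_fst (𝕜 := ℝ) (E := Sp n) (F := ℝ) (p := z))
  have h3 := hg.hasFDerivAt.comp z h2
  refine ⟨h3.differentiableAt, fun e τ => ?_⟩
  have h4 : fderiv ℝ (fun z => g (simVar z)) z = _ := h3.fderiv
  rw [h4, ContinuousLinearMap.comp_apply]
  congr 1
  simp only [add_apply, smul_apply, ContinuousLinearMap.coe_fst', ContinuousLinearMap.smulRight_apply,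
    ContinuousLinearMap.coe_snd', Function.comp, smul_eq_mul, simVar, smul_smul]
  congr 2
  field_simp

/-- Near `z` the function `q` is `√(-t) ^ lam * u (x / √(-t))`, so its derivative is read off from
that of the slice. Rademacher's theorem is then needed only on the slice. -/
theorem differentiableAt_of_homogeneous {lam : ℝ} {q : Sp n × ℝ → ℝ}
    (hhom : IsParabolicHomogeneous lam q) {z : Sp n × ℝ} (hz : z.2 < 0)
    (hu : DifferentiableAt ℝ (fun x => q (x, -1)) (simVar z)) (e : Sp n) (τ : ℝ) :
    fderiv ℝ q z (e, τ) = √(-z.2) ^ lam * fderiv ℝ (fun x => q (x, -1)) (simVar z)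
        ((√(-z.2))⁻¹ • e + (τ * (1 / 2 * ((√(-z.2))⁻¹) ^ 2)) • simVar z)
      - τ * (lam / 2) * √(-z.2) ^ (lam - 2) * q (simVar z, -1) := by
  have hm := sqrt_neg_pos hz
  have heq : q =ᶠ[𝓝 z] fun z => √(-z.2) ^ lam * q (simVar z, -1) := by
    filter_upwards [isOpen_past.mem_nhds hz] with w hw
    have hw' : w.2 < 0 := hw
    have := hhom (√(-w.2)) (sqrt_neg_pos hw') (simVar w) (-1) (by norm_num)
    rw [← this, simVar, smul_inv_smul₀ (sqrt_neg_pos hw').ne', Real.sq_sqrt (by linarith)]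
    simp
  obtain ⟨hd, hf⟩ := hasFDerivAt_comp_simVar hz hu
  have h1 := ((hasDerivAt_sqrt_neg hz).rpow_const (p := lam) (Or.inl hm.ne')).comp_hasFDerivAt z
    (hasFDerivAt_snd (𝕜 := ℝ) (E := Sp n) (F := ℝ) (p := z))
  have h2 := h1.mul hd.hasFDerivAt
  have h3 : fderiv ℝ (fun z => √(-z.2) ^ lam * q (simVar z, -1)) z = _ := h2.fderiv
  rw [heq.fderiv_eq, h3]
  simp only [add_apply, smul_apply, hf, ContinuousLinearMap.coe_snd', Function.comp, smul_eq_mul]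
  have : √(-z.2) ^ (lam - 2) = √(-z.2) ^ (lam - 1) * (√(-z.2))⁻¹ := by
    rw [← Real.rpow_neg_one, ← Real.rpow_add hm]
    ring_nf
  rw [this]
  field_simp
  ring

theorem sum_fderiv_mul_fderiv (u f : Sp n → ℝ) (x : Sp n) :
    ∑ i, fderiv ℝ u x (EuclideanSpace.single i 1) * fderiv ℝ f x (EuclideanSpace.single i 1) =
      fderiv ℝ u x (gradient f x) := by
  have h := (EuclideanSpace.basisFun (Fin (n + 1)) ℝ).sum_inner_mul_inner (gradient u x)
    (gradient f x)
  rw [fderiv_apply_eq_inner_gradient u, ← h]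
  refine Finset.sum_congr rfl fun i _ => ?_
  rw [fderiv_apply_eq_inner_gradient u, fderiv_apply_eq_inner_gradient f,
    real_inner_comm _ (gradient f x), EuclideanSpace.basisFun_apply]

/-- The bump in time used to pass from space-time to the slice `t = -1`. -/
def timeBump : ContDiffBump (-1 : ℝ) := ⟨1 / 4, 1 / 2, by norm_num, by norm_num⟩

theorem timeBump_eq_zero {t : ℝ} (ht : -(1 / 2) ≤ t) : timeBump t = 0 := by
  refine timeBump.zero_of_le_dist ?_
  rw [Real.dist_eq, abs_of_nonneg (by linarith)]
  simp only [timeBump]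
  linarith

/-- The space-time test function obtained from a function on the slice. -/
def spaceTimeTest (f : Sp n → ℝ) (z : Sp n × ℝ) : ℝ :=
  timeBump z.2 * (gaussDensity n (simVar z) * f (simVar z))

theorem contDiff_spaceTimeTest {f : Sp n → ℝ} (hf : ContDiff ℝ ∞ f) :
    ContDiff ℝ ∞ (spaceTimeTest f) := by
  rw [contDiff_iff_contDiffAt]
  intro z
  by_cases hz : z.2 < 0
  · have hm := sqrt_neg_pos hz
    have h1 : ContDiffAt ℝ ∞ (simVar (n := n)) z := by
      have h0 : ContDiffAt ℝ ∞ (fun z : Sp n × ℝ => √(-z.2)) z :=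
        (contDiff_snd.neg.contDiffAt).sqrt (by linarith)
      exact (h0.inv hm.ne').smul contDiff_fst.contDiffAt
    have h2 : ContDiffAt ℝ ∞ (fun z : Sp n × ℝ => timeBump z.2) z :=
      (timeBump.contDiff.comp contDiff_snd).contDiffAt
    exact h2.mul ((contDiff_gaussDensity.contDiffAt.comp z h1).mul (hf.contDiffAt.comp z h1))
  · have : spaceTimeTest f =ᶠ[𝓝 z] fun _ => (0 : ℝ) := by
      have hz' : -(1 / 2) < z.2 := by linarith
      filter_upwards [(isOpen_lt continuous_const continuous_snd).mem_nhds hz'] with w hw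
      rw [spaceTimeTest, timeBump_eq_zero (le_of_lt hw), zero_mul]
    exact contDiffAt_const.congr_of_eventuallyEq this

/-- The image of a set of the slice in the support of `timeBump`. -/
def spaceTimeCone (K : Set (Sp n)) : Set (Sp n × ℝ) :=
  (fun p : Sp n × ℝ => (√(-p.2) • p.1, p.2)) '' (K ×ˢ Metric.closedBall (-1 : ℝ) (1 / 2))

theorem isCompact_spaceTimeCone {K : Set (Sp n)} (hK : IsCompact K) :
    IsCompact (spaceTimeCone K) :=
  (hK.prod (isCompact_closedBall _ _)).image (by fun_prop)

theorem support_spaceTimeTest_subset (f : Sp n → ℝ) :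
    Function.support (spaceTimeTest f) ⊆ spaceTimeCone (tsupport f) := by
  intro z hz
  have h1 : timeBump z.2 ≠ 0 := left_ne_zero_of_mul hz
  have h2 : f (simVar z) ≠ 0 := right_ne_zero_of_mul (right_ne_zero_of_mul hz)
  have ht : z.2 < 0 := by
    by_contra h
    exact h1 (timeBump_eq_zero (by linarith))
  refine ⟨(simVar z, z.2), ⟨subset_tsupport f h2, ?_⟩, ?_⟩
  · have : z.2 ∈ Function.support timeBump := h1
    rw [timeBump.support_eq] at this
    exact Metric.ball_subset_closedBall this
  · simp [simVar, smul_inv_smul₀ (sqrt_neg_pos ht).ne']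

theorem spaceTimeCone_subset_past (K : Set (Sp n)) : spaceTimeCone K ⊆ past n := by
  rintro _ ⟨⟨y, t⟩, ⟨-, ht⟩, rfl⟩
  rw [Metric.mem_closedBall, Real.dist_eq] at ht
  have := (abs_le.1 ht).2
  simp only [past, mem_ofPred_eq]
  linarith

theorem tsupport_spaceTimeTest_subset {f : Sp n → ℝ} (hf : HasCompactSupport f) :
    tsupport (spaceTimeTest f) ⊆ spaceTimeCone (tsupport f) :=
  closure_minimal (support_spaceTimeTest_subset f) (isCompact_spaceTimeCone hf).isClosed

theorem isTest_spaceTimeTest {f : Sp n → ℝ} (hf : ContDiff ℝ ∞ f) (hc : HasCompactSupport f) :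
    IsTest (past n) (spaceTimeTest f) where
  smooth := contDiff_spaceTimeTest hf
  compact := (isCompact_spaceTimeCone hc).of_isClosed_subset (isClosed_tsupport _)
    (tsupport_spaceTimeTest_subset hc)
  support := (tsupport_spaceTimeTest_subset hc).trans (spaceTimeCone_subset_past _)

/-- The dilations `x ↦ √(-t) x`, `t < 0`, do not create zeros of `x_d`, so the lifted support stays
away from the thin space. -/
theorem isTest_spaceTimeTest_diff {f : Sp n → ℝ} (hf : ContDiff ℝ ∞ f)
    (hc : HasCompactSupport f) (q : Sp n × ℝ → ℝ) (hs : ∀ x ∈ tsupport f, x (Fin.last n) ≠ 0) :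
    IsTest (past n \ {z | z.1 (Fin.last n) = 0 ∧ q z = 0}) (spaceTimeTest f) where
  smooth := contDiff_spaceTimeTest hf
  compact := (isTest_spaceTimeTest hf hc).compact
  support := by
    intro z hz
    refine ⟨(isTest_spaceTimeTest hf hc).support hz, ?_⟩
    rintro ⟨h0, -⟩
    obtain ⟨⟨y, t⟩, ⟨hy, ht⟩, rfl⟩ := tsupport_spaceTimeTest_subset hc hz
    have htn : t < 0 := by
      have := spaceTimeCone_subset_past (tsupport f) (mem_image_of_mem _ ⟨hy, ht⟩)
      exact this
    have := sqrt_neg_pos htn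
    simp only [PiLp.smul_apply, smul_eq_mul, mul_eq_zero] at h0
    rcases h0 with h0 | h0
    · exact this.ne' h0
    · exact hs y hy h0

theorem spaceTimeTest_nonneg {f : Sp n → ℝ} (hf : ∀ x, 0 ≤ f x) (z : Sp n × ℝ) :
    0 ≤ spaceTimeTest f z :=
  mul_nonneg timeBump.nonneg (mul_nonneg (gaussDensity_pos _).le (hf _))

theorem integrable_heatPairing_integrand {q φ : Sp n × ℝ → ℝ}
    (hq : LocallyLipschitzOn (past n) q) (hφ : IsTest (past n) φ) :
    Integrable (fun z : Sp n × ℝ => (∑ i, dx i q z * dx i φ z) + dt q z * φ z) := by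
  obtain ⟨C, hC0, hC⟩ := exists_norm_fderiv_le_of_isCompact hq isOpen_past hφ.compact.isCompact
    hφ.support
  have hφ1 : ContDiff ℝ 1 φ := hφ.smooth.of_le (by simp)
  obtain ⟨D, hD⟩ := (hφ.compact.fderiv ℝ).exists_bound_of_continuous
    (hφ1.continuous_fderiv one_ne_zero)
  obtain ⟨M, hM⟩ := hφ.compact.exists_bound_of_continuous hφ.smooth.continuous
  have hD0 : 0 ≤ D := (norm_nonneg _).trans (hD 0)
  have hM0 : 0 ≤ M := (norm_nonneg _).trans (hM 0)
  refine Integrable.mono' (g := (tsupport φ).indicator fun _ => ∑ _i : Fin (n + 1), C * D + C * M)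
    ((integrable_indicator_iff hφ.compact.isCompact.measurableSet).2
      (integrableOn_const hφ.compact.isCompact.measure_lt_top.ne)) ?_
    (Eventually.of_forall fun z => ?_)
  · have h1 : ∀ (f : Sp n × ℝ → ℝ) v, Measurable fun z => fderiv ℝ f z v := fun f v =>
      measurable_fderiv_apply_const ℝ f v
    refine (Measurable.add ?_ ((h1 q _).mul hφ.smooth.continuous.measurable)).aestronglyMeasurable
    exact Finset.measurable_fun_sum _ fun i _ => (h1 q _).mul (h1 φ _)
  · by_cases hz : z ∈ tsupport φ
    · rw [indicator_of_mem hz]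
      have a1 : ∀ i, |dx i q z| ≤ C := fun i => by
        refine ((fderiv ℝ q z).le_opNorm _).trans ?_
        simpa using hC z hz
      have a2 : ∀ i, |dx i φ z| ≤ D := fun i => by
        refine ((fderiv ℝ φ z).le_opNorm _).trans ?_
        simpa using hD z
      have a3 : |dt q z| ≤ C := by
        refine ((fderiv ℝ q z).le_opNorm _).trans ?_
        simpa using hC z hz
      refine (norm_add_le _ _).trans (add_le_add ?_ ?_)
      · refine (norm_sum_le _ _).trans (Finset.sum_le_sum fun i _ => ?_)
        rw [norm_mul]
        exact mul_le_mul (a1 i) (a2 i) (norm_nonneg _) hC0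
      · rw [norm_mul]
        exact mul_le_mul a3 (hM z) (norm_nonneg _) hC0
    · have h1 : fderiv ℝ φ z = 0 := by
        by_contra h
        exact hz (support_fderiv_subset ℝ h)
      rw [indicator_of_notMem hz]
      simp [dx, h1, image_eq_zero_of_notMem_tsupport hz]

/-- The Gaussian factor is there for a cancellation. Differentiating it contributes `-(1/2) f y·∇u`,
while homogeneity turns the time derivative of `q` into `(1/2) y·∇u - (lam/2) u`, up to powers of
`√(-t)`. The drift terms cancel and a symmetric form remains. -/
theorem heatPairing_integrand_eq {lam : ℝ} {q : Sp n × ℝ → ℝ}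
    (hhom : IsParabolicHomogeneous lam q) {f : Sp n → ℝ} (hf : ContDiff ℝ ∞ f)
    {z : Sp n × ℝ} (hz : z.2 < 0) (hu : DifferentiableAt ℝ (fun x => q (x, -1)) (simVar z)) :
    (∑ i, dx i q z * dx i (spaceTimeTest f) z) + dt q z * spaceTimeTest f z =
      timeBump z.2 * √(-z.2) ^ (lam - 2) * (gaussDensity n (simVar z) *
        (fderiv ℝ (fun x => q (x, -1)) (simVar z) (gradient f (simVar z))
          - lam / 2 * q (simVar z, -1) * f (simVar z))) := by
  have hm := sqrt_neg_pos hz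
  set u : Sp n → ℝ := fun x => q (x, -1) with hudef
  set y := simVar z with hy
  set m := √(-z.2) with hmdef
  have hfd : DifferentiableAt ℝ f y := (hf.differentiable (by simp)) y
  have hρd : DifferentiableAt ℝ (gaussDensity n) y := (hasFDerivAt_gaussDensity y).differentiableAt
  set η : Sp n → ℝ := fun y => gaussDensity n y * f y with hη
  have hηd : DifferentiableAt ℝ η y := hρd.fun_mul hfd
  have hgη : gradient η y = gaussDensity n y • (gradient f y - (1 / 2 * f y) • y) := by
    have h1 : gradient (gaussDensity n) y = (-(1 / 2) * gaussDensity n y) • y := by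
      refine ext_inner_right ℝ fun e => ?_
      rw [← fderiv_apply_eq_inner_gradient, fderiv_gaussDensity_apply, inner_smul_left]
      simp
      ring
    rw [hη, gradient_mul hρd hfd, h1, smul_sub, smul_smul, smul_smul, sub_eq_add_neg, ← neg_smul]
    congr 2
    ring
  have hdφ : ∀ i, dx i (spaceTimeTest f) z =
      timeBump z.2 * (m⁻¹ * fderiv ℝ η y (EuclideanSpace.single i 1)) := fun i => by
    obtain ⟨hd, hfη⟩ := hasFDerivAt_comp_simVar (g := η) hz hηd
    have hb : DifferentiableAt ℝ (fun z : Sp n × ℝ => timeBump z.2) z :=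
      ((timeBump.contDiff (n := 1)).differentiable (by simp) z.2).comp z differentiableAt_snd
    have hb' : fderiv ℝ (fun z : Sp n × ℝ => timeBump z.2) z (EuclideanSpace.single i 1, 0) = 0 := by
      have h1 := (((timeBump.contDiff (n := 1)).differentiable (by simp)
        z.2).hasDerivAt).comp_hasFDerivAt z
        (hasFDerivAt_snd (𝕜 := ℝ) (E := Sp n) (F := ℝ) (p := z))
      have h2 : fderiv ℝ (fun z : Sp n × ℝ => timeBump z.2) z = _ := h1.fderiv
      rw [h2]
      simp
    have h3 : spaceTimeTest f = fun z => timeBump z.2 * η (simVar z) := rfl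
    rw [dx, h3, fderiv_fun_mul hb hd]
    simp only [add_apply, smul_apply, smul_eq_mul, hfη, hb', zero_mul, zero_smul, add_zero, mul_zero,
      map_smul]
    rfl
  have hdq : ∀ i, dx i q z = m ^ lam * (m⁻¹ * fderiv ℝ u y (EuclideanSpace.single i 1)) :=
    fun i => by
    rw [dx, differentiableAt_of_homogeneous hhom hz hu]
    simp only [zero_mul, zero_smul, add_zero, sub_zero, map_smul, smul_eq_mul]
    rfl
  have hdt : dt q z = m ^ lam * (1 / 2 * m⁻¹ ^ 2 * fderiv ℝ u y y)
      - lam / 2 * m ^ (lam - 2) * u y := by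
    rw [dt, differentiableAt_of_homogeneous hhom hz hu]
    simp only [smul_zero, zero_add, one_mul, map_smul, smul_eq_mul]
    rfl
  have hpow : m ^ lam = m ^ (lam - 2) * m ^ 2 := by
    rw [← Real.rpow_natCast, ← Real.rpow_add hm]
    norm_num
  have hs : ∑ i, dx i q z * dx i (spaceTimeTest f) z =
      timeBump z.2 * m ^ (lam - 2) * fderiv ℝ u y (gradient η y) := by
    rw [← sum_fderiv_mul_fderiv, Finset.mul_sum]
    refine Finset.sum_congr rfl fun i _ => ?_
    rw [hdφ, hdq, hpow]
    field_simp
  rw [hs, hdt, hpow, hgη]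
  simp only [map_smul, map_sub, smul_eq_mul, spaceTimeTest]
  rw [← hy]
  field_simp
  ring

theorem ae_simVar {p : Sp n → Prop} (h : ∀ᵐ x, p x) {t : ℝ} (ht : t < 0) :
    ∀ᵐ x : Sp n, p (simVar (x, t)) := by
  rw [ae_iff] at h ⊢
  have h1 : {x : Sp n | ¬p (simVar (x, t))} = (fun x => (√(-t))⁻¹ • x) ⁻¹' {x | ¬p x} := rfl
  rw [h1, Measure.addHaar_preimage_smul _ (inv_ne_zero (sqrt_neg_pos ht).ne'), h, mul_zero]

/-- Testing with `spaceTimeTest f` amounts to testing the slice with `f`. -/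
theorem exists_heatPairing_eq {lam : ℝ} (hlam : 2 < lam) : ∃ K : ℝ, 0 < K ∧
    ∀ (q : Sp n × ℝ → ℝ), LocallyLipschitzOn (past n) q → IsParabolicHomogeneous lam q →
    ∀ f : Sp n → ℝ, ContDiff ℝ ∞ f → HasCompactSupport f →
      heatPairing q (spaceTimeTest f) = -(K * heatForm lam (fun x => q (x, -1)) f) := by
  -- The weight collects the time bump, the power of `√(-t)` from homogeneity and the Jacobian of `x
  -- = √(-t) y` in dimension `n + 1`. Continuity at `t = 0` uses `lam > 2`.
  set κ : ℝ → ℝ := fun t => timeBump t * √(-t) ^ (lam - 2) * √(-t) ^ (n + 1) with hκ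
  have hκc : Continuous κ := by
    refine (timeBump.continuous.mul ?_).mul (by fun_prop)
    exact (by fun_prop : Continuous fun t : ℝ => √(-t)).rpow_const fun _ => Or.inr (by linarith)
  have hκs : HasCompactSupport κ := (timeBump.hasCompactSupport.mul_right).mul_right
  have hκ0 : 0 ≤ κ := fun t => by
    have := timeBump.nonneg (x := t)
    simp only [hκ, Pi.zero_apply]
    positivity
  refine ⟨∫ t, κ t, ?_, fun q hq hhom f hf hc => ?_⟩
  · refine hκc.integral_pos_of_hasCompactSupport_nonneg_nonzero hκs hκ0 (x := -1) ?_
    have : timeBump (-1) = 1 :=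
      timeBump.one_of_mem_closedBall (by simp [timeBump])
    simp [hκ, this]
  · have hdiff := ae_differentiableAt_of_locallyLipschitz (volume : Measure (Sp n))
      (locallyLipschitz_slice hq)
    have hint := integrable_heatPairing_integrand hq (isTest_spaceTimeTest hf hc)
    rw [heatPairing, Measure.volume_eq_prod, integral_prod_symm _
      (by rwa [Measure.volume_eq_prod] at hint), ← integral_mul_const]
    congr 1
    refine integral_congr_ae (Eventually.of_forall fun t => ?_)
    by_cases ht : t < 0
    · simp only
      rw [heatForm, integral_gammaMeasure]
      set G : Sp n → ℝ := fun y => gaussDensity n y *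
        (fderiv ℝ (fun x => q (x, -1)) y (gradient f y) - lam / 2 * q (y, -1) * f y) with hG
      have h1 : ∫ x : Sp n, (∑ i, dx i q (x, t) * dx i (spaceTimeTest f) (x, t)) +
          dt q (x, t) * spaceTimeTest f (x, t) =
          ∫ x, timeBump t * √(-t) ^ (lam - 2) * G ((√(-t))⁻¹ • x) := by
        refine integral_congr_ae ?_
        filter_upwards [ae_simVar hdiff ht] with x hx
        exact heatPairing_integrand_eq hhom hf (z := (x, t)) ht hx
      rw [h1, integral_const_mul,
        Measure.integral_comp_inv_smul_of_nonneg volume G (Real.sqrt_nonneg _)]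
      simp only [hκ, finrank_euclideanSpace, Fintype.card_fin, smul_eq_mul]
      ring
    · have h0 : timeBump t = 0 := timeBump_eq_zero (by linarith)
      have h1 : ∀ x : Sp n, (∑ i, dx i q (x, t) * dx i (spaceTimeTest f) (x, t)) +
          dt q (x, t) * spaceTimeTest f (x, t) = 0 := fun x => by
        have hz : (x, t) ∉ tsupport (spaceTimeTest f) := fun hz =>
          ht ((isTest_spaceTimeTest hf hc).support hz)
        have h2 : fderiv ℝ (spaceTimeTest f) (x, t) = 0 := by
          by_contra h
          exact hz (support_fderiv_subset ℝ h)
        simp [dx, h2, image_eq_zero_of_notMem_tsupport hz]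
      simp [h1, hκ, h0]

theorem heatForm_eq_zero_of_tsupport {lam : ℝ} (hlam : 2 < lam) {q : Sp n × ℝ → ℝ}
    (hq : IsComplementary q) (hhom : IsParabolicHomogeneous lam q) {f : Sp n → ℝ}
    (hf : ContDiff ℝ ∞ f) (hc : HasCompactSupport f)
    (hs : ∀ x ∈ tsupport f, x (Fin.last n) ≠ 0) : heatForm lam (fun x => q (x, -1)) f = 0 := by
  obtain ⟨K, hK, h⟩ := exists_heatPairing_eq (n := n) hlam
  have h1 := h q hq.lipschitz hhom f hf hc
  rw [hq.heat _ (isTest_spaceTimeTest_diff hf hc q hs)] at h1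
  have h2 : K * heatForm lam (fun x => q (x, -1)) f = 0 := by linarith
  exact (mul_eq_zero.1 h2).resolve_left hK.ne'

theorem heatForm_nonneg_of_heatNonpos {lam : ℝ} (hlam : 2 < lam) {q : Sp n × ℝ → ℝ}
    (hq : LocallyLipschitzOn (past n) q) (hs : HeatNonpos q)
    (hhom : IsParabolicHomogeneous lam q) {f : Sp n → ℝ}
    (hf : ContDiff ℝ ∞ f) (hc : HasCompactSupport f) (hf0 : ∀ x, 0 ≤ f x) :
    0 ≤ heatForm lam (fun x => q (x, -1)) f := by
  obtain ⟨K, hK, h⟩ := exists_heatPairing_eq (n := n) hlam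
  have h1 := h q hq hhom f hf hc
  have h2 := hs _ (isTest_spaceTimeTest hf hc) (spaceTimeTest_nonneg hf0)
  rw [h1] at h2
  by_contra! hcon
  nlinarith

/-! ### Larger classes of test functions on the slice. -/

/-- The weak equation off the thin space, for the slice. -/
def SolvesOffThin (lam : ℝ) (u : Sp n → ℝ) : Prop :=
  ∀ f : Sp n → ℝ, ContDiff ℝ ∞ f → HasCompactSupport f →
    (∀ x ∈ tsupport f, x (Fin.last n) ≠ 0) → heatForm lam u f = 0

/-- The sign of the distribution on the thin space, for the slice. -/
def Supersolution (lam : ℝ) (u : Sp n → ℝ) : Prop :=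
  ∀ f : Sp n → ℝ, ContDiff ℝ ∞ f → HasCompactSupport f → (∀ x, 0 ≤ f x) → 0 ≤ heatForm lam u f

/-- A smooth cutoff that vanishes near the thin space. -/
def thinCutoff (N : ℕ) (x : Sp n) : ℝ :=
  Real.smoothTransition (((N : ℝ) + 1) ^ 2 * x (Fin.last n) ^ 2 - 1)

theorem contDiff_thinCutoff (N : ℕ) {m : ℕ∞} : ContDiff ℝ m (thinCutoff (n := n) N) :=
  Real.smoothTransition.contDiff.comp
    ((contDiff_const.mul ((lastCoord n).contDiff.pow 2)).sub contDiff_const)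

theorem thinCutoff_eq_zero {N : ℕ} {x : Sp n} (hx : ((N : ℝ) + 1) ^ 2 * x (Fin.last n) ^ 2 ≤ 1) :
    thinCutoff N x = 0 :=
  Real.smoothTransition.zero_of_nonpos (by linarith)

theorem thinCutoff_nonneg (N : ℕ) (x : Sp n) : 0 ≤ thinCutoff N x :=
  Real.smoothTransition.nonneg _

theorem thinCutoff_le_one (N : ℕ) (x : Sp n) : thinCutoff N x ≤ 1 :=
  Real.smoothTransition.le_one _

/-- The gradient blows up like `N`, but only where `|x_d|` is at most of order `1/N`. The weight
`|x_d|` restores a bound uniform in `N`. -/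
theorem exists_norm_fderiv_thinCutoff_le : ∃ C : ℝ, 0 ≤ C ∧ ∀ (N : ℕ) (x : Sp n),
    |x (Fin.last n)| * ‖fderiv ℝ (thinCutoff N) x‖ ≤ C := by
  obtain ⟨C, hC0, hC⟩ := exists_abs_deriv_smoothTransition_le
  refine ⟨4 * C, by positivity, fun N x => ?_⟩
  set a : ℝ := (N : ℝ) + 1 with ha
  set s : ℝ := x (Fin.last n) with hs
  by_cases hx : 2 < a ^ 2 * s ^ 2
  · have : thinCutoff N =ᶠ[𝓝 x] fun _ => (1 : ℝ) := by
      have hc : Continuous fun y : Sp n => a ^ 2 * lastCoord n y ^ 2 := by fun_prop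
      filter_upwards [(isOpen_lt continuous_const hc).mem_nhds hx] with y hy
      have hy' : 2 < a ^ 2 * y (Fin.last n) ^ 2 := hy
      exact Real.smoothTransition.one_of_one_le (by rw [← ha]; linarith)
    rw [this.fderiv_eq, fderiv_const_apply, norm_zero, mul_zero]
    positivity
  · have h1 : HasDerivAt Real.smoothTransition (deriv Real.smoothTransition (a ^ 2 * s ^ 2 - 1))
        (a ^ 2 * s ^ 2 - 1) :=
      ((Real.smoothTransition.contDiff (n := 1)).differentiable (by simp)).differentiableAt.hasDerivAt
    have h2 : HasDerivAt (fun τ : ℝ => a ^ 2 * τ ^ 2 - 1) (a ^ 2 * (2 * s)) s := by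
      simpa using ((hasDerivAt_pow 2 s).const_mul (a ^ 2)).sub_const 1
    have h3 := (h1.comp s h2).comp_hasFDerivAt x (lastCoord n).hasFDerivAt
    have h4 : fderiv ℝ (thinCutoff (n := n) N) x = _ := h3.fderiv
    have hl : ‖lastCoord n‖ ≤ 1 :=
      (lastCoord n).opNorm_le_bound zero_le_one fun y => by
        simpa using abs_last_le_norm y
    rw [h4, norm_smul, Real.norm_eq_abs, abs_mul]
    have h5 : |s| * |a ^ 2 * (2 * s)| ≤ 4 := by
      rw [← abs_mul, abs_of_nonneg (by nlinarith [sq_nonneg (a * s)])]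
      nlinarith
    calc |s| * (|deriv Real.smoothTransition (a ^ 2 * s ^ 2 - 1)| * |a ^ 2 * (2 * s)|
          * ‖lastCoord n‖) = (|s| * |a ^ 2 * (2 * s)|) *
          |deriv Real.smoothTransition (a ^ 2 * s ^ 2 - 1)| * ‖lastCoord n‖ := by ring
      _ ≤ 4 * C * 1 := by gcongr; exact hC _
      _ = _ := mul_one _

theorem eventually_thinCutoff_eventuallyEq_one {x : Sp n} (hx : x (Fin.last n) ≠ 0) :
    ∀ᶠ N : ℕ in atTop, thinCutoff N =ᶠ[𝓝 x] fun _ => (1 : ℝ) := by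
  have hx' : 0 < |x (Fin.last n)| := abs_pos.2 hx
  obtain ⟨k, hk⟩ := exists_nat_gt (2 / |x (Fin.last n)|)
  filter_upwards [eventually_ge_atTop k] with N hN
  have hkN : (k : ℝ) ≤ N := by exact_mod_cast hN
  have h1 : 2 < ((N : ℝ) + 1) * |lastCoord n x| := by
    rw [div_lt_iff₀ hx'] at hk
    rw [lastCoord_apply]
    nlinarith
  have hc : Continuous fun y : Sp n => ((N : ℝ) + 1) * |lastCoord n y| := by fun_prop
  filter_upwards [(isOpen_lt continuous_const hc).mem_nhds h1] with y hy
  have hy' : 2 < ((N : ℝ) + 1) * |y (Fin.last n)| := hy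
  refine Real.smoothTransition.one_of_one_le ?_
  rw [← sq_abs (y (Fin.last n)), ← mul_pow]
  nlinarith

theorem differentiableAt_of_smooth_off_thin {f : Sp n → ℝ}
    (hs : ∀ x, x (Fin.last n) ≠ 0 → ContDiffAt ℝ ∞ f x) : ∀ᵐ x, DifferentiableAt ℝ f x := by
  filter_upwards [ae_last_ne_zero] with x hx
  exact (hs x hx).differentiableAt (by simp)

/-- The weak equation off the thin space extends to bounded test functions vanishing on it. -/
theorem SolvesOffThin.eq_zero {lam : ℝ} {u : Sp n → ℝ} (h : SolvesOffThin lam u)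
    (hu : Admissible u) {C : ℝ} {f : Sp n → ℝ} (hf : BoundedC1 C f)
    (hs : ∀ x, x (Fin.last n) ≠ 0 → ContDiffAt ℝ ∞ f x)
    (h0 : ∀ x, |f x| ≤ C * |x (Fin.last n)|) : heatForm lam u f = 0 := by
  obtain ⟨K, hK0, hK⟩ := exists_norm_fderiv_thinCutoff_le (n := n)
  obtain ⟨D, hD⟩ := exists_boundedC1_cutoff_mul (n := n)
  have hC := hf.nonneg
  have hfd := differentiableAt_of_smooth_off_thin hs
  have hdt : ∀ (N : ℕ) (x : Sp n), DifferentiableAt ℝ (thinCutoff N) x := fun N x =>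
    (contDiff_thinCutoff N (m := 1)).differentiable (by simp) x
  -- The delicate term is `f` times the gradient of the thin cutoff. It stays bounded because `f =
  -- O(|x_d|)`.
  have hg : ∀ N : ℕ, BoundedC1 ((1 + K) * C) (fun x => thinCutoff N x * f x) := fun N => by
    refine ⟨(contDiff_thinCutoff N (m := 0)).continuous.measurable.mul hf.meas, fun x => ?_, ?_⟩
    · rw [abs_mul, abs_of_nonneg (thinCutoff_nonneg N x)]
      have : thinCutoff N x * |f x| ≤ 1 * C :=
        mul_le_mul (thinCutoff_le_one N x) (hf.bound x) (abs_nonneg _) zero_le_one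
      have h1 := mul_nonneg hK0 hC
      linarith
    · filter_upwards [hfd, hf.bound_fderiv] with x h1 h2
      rw [fderiv_fun_mul (hdt N x) h1]
      refine (norm_add_le _ _).trans ?_
      rw [norm_smul, norm_smul, Real.norm_eq_abs, Real.norm_eq_abs,
        abs_of_nonneg (thinCutoff_nonneg N x)]
      have h3 : thinCutoff N x * ‖fderiv ℝ f x‖ ≤ 1 * C :=
        mul_le_mul (thinCutoff_le_one N x) h2 (norm_nonneg _) zero_le_one
      have h4 : |f x| * ‖fderiv ℝ (thinCutoff N) x‖ ≤ C * K := by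
        calc _ ≤ (C * |x (Fin.last n)|) * ‖fderiv ℝ (thinCutoff N) x‖ := by gcongr; exact h0 x
          _ = C * (|x (Fin.last n)| * ‖fderiv ℝ (thinCutoff N) x‖) := by ring
          _ ≤ _ := by gcongr; exact hK N x
      linarith
  have hG : ∀ N : ℕ, BoundedC1 (D * ((1 + K) * C))
      (fun x => cutoff N x * (thinCutoff N x * f x)) := fun N => by
    refine hD _ _ (hg N) ?_ N
    filter_upwards [hfd] with x hx using (hdt N x).fun_mul hx
  have hev : ∀ x : Sp n, x (Fin.last n) ≠ 0 →
      ∀ᶠ N : ℕ in atTop, (fun x => cutoff N x * (thinCutoff N x * f x)) =ᶠ[𝓝 x] f := fun x hx => by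
    filter_upwards [eventually_cutoff_eventuallyEq_one x,
      eventually_thinCutoff_eventuallyEq_one hx] with N h1 h2
    filter_upwards [h1, h2] with y hy1 hy2
    rw [hy1, hy2, one_mul, one_mul]
  have hlim := tendsto_heatForm lam hu hG
    (ae_last_ne_zero.mono fun x hx => (tendsto_of_eventually_eventuallyEq (hev x hx)).1)
    (ae_last_ne_zero.mono fun x hx => (tendsto_of_eventually_eventuallyEq (hev x hx)).2)
  refine tendsto_nhds_unique hlim (tendsto_const_nhds.congr fun N => ?_)
  refine (h _ ?_ (hasCompactSupport_cutoff N).mul_right ?_).symm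
  · rw [contDiff_iff_contDiffAt]
    intro x
    by_cases hx : x (Fin.last n) = 0
    · have hc : Continuous fun y : Sp n => ((N : ℝ) + 1) ^ 2 * lastCoord n y ^ 2 := by fun_prop
      have : (fun x => cutoff N x * (thinCutoff N x * f x)) =ᶠ[𝓝 x] fun _ => (0 : ℝ) := by
        filter_upwards [(isOpen_lt hc (continuous_const (y := (1 : ℝ)))).mem_nhds
          (by simp [hx] : ((N : ℝ) + 1) ^ 2 * lastCoord n x ^ 2 < 1)] with y hy
        rw [thinCutoff_eq_zero (le_of_lt hy), zero_mul, mul_zero]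
      exact contDiffAt_const.congr_of_eventuallyEq this
    · exact (contDiff_cutoff N).contDiffAt.mul ((contDiff_thinCutoff N).contDiffAt.mul (hs x hx))
  · intro x hx h0
    have hc : Continuous fun y : Sp n => ((N : ℝ) + 1) ^ 2 * lastCoord n y ^ 2 := by fun_prop
    have hsub : tsupport (fun x => cutoff N x * (thinCutoff N x * f x)) ⊆
        {y : Sp n | 1 ≤ ((N : ℝ) + 1) ^ 2 * lastCoord n y ^ 2} := by
      refine closure_minimal (fun y hy => ?_) (isClosed_le continuous_const hc)
      by_contra hcon
      refine hy ?_
      simp only [mem_ofPred_eq, not_le] at hcon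
      simp only [thinCutoff_eq_zero (le_of_lt hcon), zero_mul, mul_zero]
    have := hsub hx
    simp only [mem_ofPred_eq, lastCoord_apply, h0] at this
    norm_num at this

theorem Supersolution.nonneg {lam : ℝ} {u : Sp n → ℝ} (h : Supersolution lam u)
    (hu : Admissible u) {C : ℝ} {f : Sp n → ℝ} (hf : BoundedC1 C f) (hs : ContDiff ℝ ∞ f)
    (h0 : ∀ x, 0 ≤ f x) : 0 ≤ heatForm lam u f := by
  obtain ⟨D, hD⟩ := exists_boundedC1_cutoff_mul (n := n)
  have hlim := tendsto_heatForm lam hu (g := f)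
    (hD C f hf (Eventually.of_forall (hs.differentiable (by simp))))
    (Eventually.of_forall fun x =>
      (tendsto_of_eventually_eventuallyEq (eventually_cutoff_mul_eventuallyEq f x)).1)
    (Eventually.of_forall fun x =>
      (tendsto_of_eventually_eventuallyEq (eventually_cutoff_mul_eventuallyEq f x)).2)
  refine ge_of_tendsto' hlim fun N => ?_
  exact h _ ((contDiff_cutoff N).mul hs) (hasCompactSupport_cutoff N).mul_right
    fun x => mul_nonneg (cutoff_nonneg N x) (h0 x)

/-! ### Exponentials in the distance to the thin space. -/

/-- The function `exp (-a |x_d|)`. -/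
def expAbs (a : ℝ) (x : Sp n) : ℝ := Real.exp (-(a * |x (Fin.last n)|))

theorem expAbs_pos (a : ℝ) (x : Sp n) : 0 < expAbs a x := Real.exp_pos _

theorem expAbs_le_one {a : ℝ} (ha : 0 ≤ a) (x : Sp n) : expAbs a x ≤ 1 := by
  rw [expAbs, Real.exp_le_one_iff]
  have := mul_nonneg ha (abs_nonneg (x (Fin.last n)))
  linarith

theorem one_sub_expAbs_le (a : ℝ) (x : Sp n) : 1 - expAbs a x ≤ a * |x (Fin.last n)| := by
  have := Real.add_one_le_exp (-(a * |x (Fin.last n)|))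
  rw [expAbs]
  linarith

theorem locallyLipschitz_expAbs (a : ℝ) : LocallyLipschitz (expAbs (n := n) a) := by
  have h1 : LocallyLipschitz (fun τ : ℝ => Real.exp (-(a * τ))) :=
    ContDiff.locallyLipschitz (𝕂 := ℝ) (by fun_prop)
  have h2 : LocallyLipschitz (fun τ : ℝ => |τ|) := lipschitzWith_one_norm.locallyLipschitz
  exact h1.comp (h2.comp (lastCoord n).lipschitz.locallyLipschitz)

theorem hasFDerivAt_expAbs (a : ℝ) {x : Sp n} (hx : x (Fin.last n) ≠ 0) :
    HasFDerivAt (expAbs a) ((-(a * sgn x) * expAbs a x) • lastCoord n) x := by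
  have h1 := (((hasDerivAt_abs hx).const_mul a).neg.exp).comp_hasFDerivAt x
    (lastCoord n).hasFDerivAt
  convert! h1 using 1
  rw [mul_comm]
  rfl

theorem contDiffAt_expAbs (a : ℝ) {x : Sp n} (hx : x (Fin.last n) ≠ 0) :
    ContDiffAt ℝ ∞ (expAbs a) x := by
  have h1 : ContDiffAt ℝ ∞ (fun y : Sp n => |lastCoord n y|) x :=
    (lastCoord n).contDiff.contDiffAt.abs hx
  exact ((contDiffAt_const.mul h1).neg).exp

theorem norm_lastCoord_le : ‖lastCoord n‖ ≤ 1 :=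
  (lastCoord n).opNorm_le_bound zero_le_one fun y => by simpa using abs_last_le_norm y

theorem boundedC1_expAbs {a : ℝ} (ha : 0 ≤ a) : BoundedC1 (1 + a) (expAbs (n := n) a) := by
  refine ⟨(locallyLipschitz_expAbs a).continuous.measurable, fun x => ?_, ?_⟩
  · rw [abs_of_pos (expAbs_pos a x)]
    linarith [expAbs_le_one ha x]
  · filter_upwards [ae_last_ne_zero] with x hx
    rw [(hasFDerivAt_expAbs a hx).fderiv, norm_smul, Real.norm_eq_abs, abs_mul, abs_neg, abs_mul,
      abs_of_nonneg ha, abs_of_pos (expAbs_pos a x)]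
    calc a * |sgn x| * expAbs a x * ‖lastCoord n‖ ≤ a * 1 * 1 * 1 := by
          have := (expAbs_pos a x).le
          gcongr
          · exact abs_sgn_le_one x
          · exact expAbs_le_one ha x
          · exact norm_lastCoord_le
      _ ≤ 1 + a := by linarith

theorem BoundedC1.mul {C D : ℝ} {f g : Sp n → ℝ} (hf : BoundedC1 C f) (hg : BoundedC1 D g)
    (hfd : ∀ᵐ x, DifferentiableAt ℝ f x) (hgd : ∀ᵐ x, DifferentiableAt ℝ g x) :
    BoundedC1 (2 * (C * D)) (fun x => f x * g x) := by
  have hC := hf.nonneg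
  have hD := hg.nonneg
  refine ⟨hf.meas.mul hg.meas, fun x => ?_, ?_⟩
  · rw [abs_mul]
    have := mul_le_mul (hf.bound x) (hg.bound x) (abs_nonneg _) hC
    have := mul_nonneg hC hD
    linarith
  · filter_upwards [hfd, hgd, hf.bound_fderiv, hg.bound_fderiv] with x h1 h2 h3 h4
    rw [fderiv_fun_mul h1 h2]
    refine (norm_add_le _ _).trans ?_
    rw [norm_smul, norm_smul, Real.norm_eq_abs, Real.norm_eq_abs]
    have := mul_le_mul (hf.bound x) h4 (norm_nonneg _) hC
    have := mul_le_mul (hg.bound x) h3 (norm_nonneg _) hD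
    linarith

theorem BoundedC1.sub {C D : ℝ} {f g : Sp n → ℝ} (hf : BoundedC1 C f) (hg : BoundedC1 D g)
    (hfd : ∀ᵐ x, DifferentiableAt ℝ f x) (hgd : ∀ᵐ x, DifferentiableAt ℝ g x) :
    BoundedC1 (C + D) (fun x => f x - g x) := by
  refine ⟨hf.meas.sub hg.meas, fun x => ?_, ?_⟩
  · exact (abs_sub _ _).trans (add_le_add (hf.bound x) (hg.bound x))
  · filter_upwards [hfd, hgd, hf.bound_fderiv, hg.bound_fderiv] with x h1 h2 h3 h4
    rw [fderiv_fun_sub h1 h2]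
    exact (norm_sub_le _ _).trans (add_le_add h3 h4)

theorem boundedC1_const (c : ℝ) : BoundedC1 |c| (fun _ : Sp n => c) :=
  ⟨measurable_const, fun _ => le_rfl, by simp⟩

theorem exists_boundedC1_of_hasCompactSupport {f : Sp n → ℝ} (hf : LocallyLipschitz f)
    (hc : HasCompactSupport f) : ∃ C, BoundedC1 C f := by
  obtain ⟨M, hM⟩ := hc.exists_bound_of_continuous hf.continuous
  obtain ⟨K, hK⟩ := exists_lipschitzWith_of_hasCompactSupport hf hc
  exact ⟨max M K, hf.continuous.measurable, fun x => (hM x).trans (le_max_left _ _),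
    Eventually.of_forall fun x =>
      (norm_fderiv_le_of_lipschitz ℝ hK).trans (le_max_right _ _)⟩

theorem admissible_of_hasCompactSupport {u : Sp n → ℝ} (hu : LocallyLipschitz u)
    (hc : HasCompactSupport u) : Admissible u := by
  obtain ⟨K, hK⟩ := exists_lipschitzWith_of_hasCompactSupport hu hc
  refine ⟨hu, fun c => ?_, ?_⟩
  · refine Continuous.integrable_of_hasCompactSupport ?_ hc.mul_left
    exact (by fun_prop : Continuous fun x : Sp n => Real.exp (c * ‖x‖)).mul hu.continuous
  · refine (integrable_const (K : ℝ)).mono' (measurable_fderiv ℝ u).norm.aestronglyMeasurable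
      (Eventually.of_forall fun x => ?_)
    rw [norm_norm]
    exact norm_fderiv_le_of_lipschitz ℝ hK

/-- Only the values of `u` near the support of `g` matter, so `u` may be multiplied by a cutoff
equal to `1` there. This serves the difference of `u` and `u ∘ thinProj`, for which no Gaussian
integrability is established. -/
theorem integrable_ibp_of_hasCompactSupport {w : Sp n → ℝ} (hw : Measurable w)
    (hw1 : ∀ x, |w x| ≤ 1) (e : Sp n) {u g : Sp n → ℝ} (hu : LocallyLipschitz u)
    (hg : LocallyLipschitz g) (hc : HasCompactSupport g) :
    Integrable (fun x => w x * (fderiv ℝ u x e * g x + u x * fderiv ℝ g x e -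
      1 / 2 * inner ℝ x e * (u x * g x))) (gammaMeasure n) := by
  obtain ⟨R, hR⟩ := hc.isCompact.isBounded.subset_closedBall (0 : Sp n)
  obtain ⟨N, hN⟩ := exists_nat_gt R
  obtain ⟨C, hC⟩ := exists_boundedC1_of_hasCompactSupport hg hc
  have h := integrable_ibp hw hw1 e (admissible_of_hasCompactSupport
    (locallyLipschitz_cutoff_mul N hu) (hasCompactSupport_cutoff N).mul_right) hC
  refine h.congr (Eventually.of_forall fun x => ?_)
  by_cases hx : x ∈ tsupport g
  · have hxR : ‖x‖ < (N : ℝ) + 1 := by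
      have := hR hx
      rw [mem_closedBall_zero_iff] at this
      linarith
    have : (fun y => cutoff N y * u y) =ᶠ[𝓝 x] u := by
      filter_upwards [(isOpen_lt continuous_norm continuous_const).mem_nhds hxR] with y hy
      rw [cutoff_eq_one (le_of_lt hy), one_mul]
    simp only [this.fderiv_eq]
    rw [show cutoff N x * u x = u x from this.eq_of_nhds]
  · have h1 : fderiv ℝ g x = 0 := by
      by_contra h
      exact hx (support_fderiv_subset ℝ h)
    simp [h1, image_eq_zero_of_notMem_tsupport hx]

/-! ### From the one-sided to the two-sided boundary condition. -/

/-- The projection onto the thin space. -/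
def thinProj (x : Sp n) : Sp n := x - x (Fin.last n) • eLast n

theorem lipschitz_thinProj : LocallyLipschitz (thinProj (n := n)) := by
  have h : LipschitzWith _ (ContinuousLinearMap.id ℝ (Sp n) -
    (lastCoord n).smulRight (eLast n)) := ContinuousLinearMap.lipschitz _
  exact h.locallyLipschitz

theorem thinProj_last (x : Sp n) : thinProj x (Fin.last n) = 0 := by simp [thinProj]

theorem thinProj_add (x : Sp n) (h : ℝ) : thinProj (x + h • eLast n) = thinProj x := by
  simp only [thinProj, PiLp.add_apply, PiLp.smul_apply, lastCoord_eLast, smul_eq_mul, mul_one]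
  module

theorem norm_thinProj_le (x : Sp n) : ‖thinProj x‖ ≤ ‖x‖ := by
  have h := norm_sub_sq_real x (x (Fin.last n) • eLast n)
  rw [inner_smul_right, inner_eLast, norm_smul, norm_eLast, mul_one, Real.norm_eq_abs, sq_abs] at h
  refine (le_abs_self _).trans (abs_le_of_sq_le_sq ?_ (norm_nonneg _))
  rw [thinProj, h]
  nlinarith [sq_nonneg (x (Fin.last n))]

theorem norm_sub_thinProj (x : Sp n) : ‖x - thinProj x‖ = |x (Fin.last n)| := by
  simp [thinProj, norm_smul]

/-- The subtracted function is constant along `eLast n`. A line derivative is used because `u` need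
not be differentiable at `thinProj x`. -/
theorem fderiv_sub_comp_thinProj {u : Sp n → ℝ} {x : Sp n} (hu : DifferentiableAt ℝ u x)
    (hv : DifferentiableAt ℝ (fun x => u x - u (thinProj x)) x) :
    fderiv ℝ (fun x => u x - u (thinProj x)) x (eLast n) = fderiv ℝ u x (eLast n) := by
  rw [← hv.lineDeriv_eq_fderiv, ← hu.lineDeriv_eq_fderiv, lineDeriv, lineDeriv]
  simp only [thinProj_add]
  rw [deriv_sub_const_fun]

/-- Scaling of the last coordinate. -/
def stretch (a : ℝ) : Sp n →ₗ[ℝ] Sp n :=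
  LinearMap.transvection ((lastCoord n : Sp n →L[ℝ] ℝ) : Sp n →ₗ[ℝ] ℝ) ((a - 1) • eLast n)

theorem stretch_apply (a : ℝ) (x : Sp n) :
    stretch a x = thinProj x + (a * x (Fin.last n)) • eLast n := by
  simp only [stretch, LinearMap.transvection.apply, ContinuousLinearMap.coe_coe, lastCoord_apply,
    thinProj]
  module

theorem integral_comp_stretch {a : ℝ} (ha : 0 < a) (h : Sp n → ℝ) (hh : Continuous h) :
    ∫ x, h (stretch a x) = a⁻¹ * ∫ x, h x := by
  have hdet : LinearMap.det (stretch (n := n) a) = a := by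
    rw [stretch, LinearMap.transvection.det]
    simp
  have h1 := Measure.map_linearMap_addHaar_eq_smul_addHaar (volume : Measure (Sp n))
    (f := stretch a) (by rw [hdet]; exact ha.ne')
  have hc : Continuous (stretch (n := n) a) := LinearMap.continuous_of_finiteDimensional _
  rw [← integral_map hc.aemeasurable (hh.aestronglyMeasurable), h1, hdet, integral_smul_measure,
    ENNReal.toReal_ofReal (abs_nonneg _), abs_of_pos (inv_pos.2 ha), smul_eq_mul]

/-- On a cylinder around the `x_d` axis, exponential decay in `x_d` beats any power of `‖x‖`. The
power `n + 2` exceeds the dimension and so gives an integrable majorant. -/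
theorem integrable_exp_neg_abs_last (R : ℝ) (hR : 0 ≤ R) :
    ∃ g : Sp n → ℝ, Integrable g ∧ (∀ x, 0 ≤ g x) ∧ ∀ x, ‖thinProj x‖ ≤ R →
      |x (Fin.last n)| * Real.exp (-|x (Fin.last n)|) ≤ g x := by
  set p : ℕ := n + 2 with hp
  set K : ℝ := (p + 1).factorial * Real.exp 1 * (1 + R) ^ p with hK
  have hi : Integrable (fun x : Sp n => (1 + ‖x‖) ^ (-(p : ℝ))) :=
    integrable_one_add_norm (by simp [hp])
  refine ⟨fun x => K * (1 + ‖x‖) ^ (-(p : ℝ)), hi.const_mul K, fun x => by positivity,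
    fun x hx => ?_⟩
  set s := |x (Fin.last n)| with hs
  have hs0 : 0 ≤ s := abs_nonneg _
  have hxn : ‖x‖ ≤ R + s := by
    calc ‖x‖ = ‖thinProj x + (x - thinProj x)‖ := by simp
      _ ≤ ‖thinProj x‖ + ‖x - thinProj x‖ := norm_add_le _ _
      _ ≤ R + s := by rw [norm_sub_thinProj]; linarith
  have h1 : (1 + ‖x‖) ^ p ≤ (1 + R) ^ p * (1 + s) ^ p := by
    rw [← mul_pow]
    gcongr
    nlinarith
  have h2 : (1 + s) ^ (p + 1) ≤ (p + 1).factorial * Real.exp (1 + s) := by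
    have := Real.pow_div_factorial_le_exp (1 + s) (by positivity) (p + 1)
    rwa [div_le_iff₀ (by positivity), mul_comm] at this
  change _ ≤ K * (1 + ‖x‖) ^ (-(p : ℝ))
  rw [Real.rpow_neg (by positivity), Real.rpow_natCast, ← div_eq_mul_inv,
    le_div_iff₀ (by positivity)]
  calc s * Real.exp (-s) * (1 + ‖x‖) ^ p
      ≤ (1 + s) * Real.exp (-s) * ((1 + R) ^ p * (1 + s) ^ p) := by gcongr; linarith
    _ = (1 + R) ^ p * Real.exp (-s) * (1 + s) ^ (p + 1) := by ring
    _ ≤ (1 + R) ^ p * Real.exp (-s) * ((p + 1).factorial * Real.exp (1 + s)) := by gcongr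
    _ = K * (Real.exp (-s) * Real.exp s) := by rw [hK, Real.exp_add]; ring
    _ = K := by rw [← Real.exp_add]; simp

theorem gaussDensity_le (x : Sp n) : gaussDensity n x ≤ gaussDensity n 0 := by
  unfold gaussDensity
  have := Real.pi_pos
  gcongr
  · simp

/-- The part of `∫ N² (u - u ∘ thinProj) e^{-N |x_d|} f dγ` with the unfavourable sign vanishes in
the limit when the upper normal derivative of `u` is nonpositive. -/
theorem tendsto_integral_posPart {u : Sp n → ℝ} (hu : LocallyLipschitz u)
    (heven : ∀ x, u (thinProj x + x (Fin.last n) • eLast n) =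
      u (thinProj x + |x (Fin.last n)| • eLast n))
    (hN : ∀ x : Sp n, x (Fin.last n) = 0 → ∀ ε > (0 : ℝ), ∀ᶠ h in 𝓝[>] (0 : ℝ),
      u (x + h • eLast n) - u x ≤ ε * h)
    {f : Sp n → ℝ} (hf : Continuous f) (hc : HasCompactSupport f) (hf0 : ∀ x, 0 ≤ f x) :
    Tendsto (fun N : ℕ => ∫ x, ((N : ℝ) + 1) ^ 2 * (max (u x - u (thinProj x)) 0 *
      expAbs ((N : ℝ) + 1) x * f x) ∂gammaMeasure n) atTop (𝓝 0) := by
  obtain ⟨R, hR⟩ := hc.isCompact.isBounded.subset_closedBall (0 : Sp n)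
  obtain ⟨R', hR', hRR'⟩ : ∃ R' : ℝ, 0 ≤ R' ∧ R ≤ R' := ⟨|R|, abs_nonneg R, le_abs_self R⟩
  have hfz : ∀ x, R' < ‖x‖ → f x = 0 := fun x hx => by
    by_contra h
    have := hR (subset_tsupport f h)
    rw [mem_closedBall_zero_iff] at this
    linarith
  obtain ⟨L, hL⟩ := LocallyLipschitzOn.exists_lipschitzOnWith_of_compact
    (isCompact_closedBall (0 : Sp n) R') (hu.locallyLipschitzOn.mono (subset_univ _))
  obtain ⟨M, hM⟩ := hc.exists_bound_of_continuous hf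
  have hM0 : 0 ≤ M := (norm_nonneg _).trans (hM 0)
  obtain ⟨g, hg, hg0, hgb⟩ := integrable_exp_neg_abs_last (n := n) R' hR'
  have hP : Continuous (thinProj (n := n)) := lipschitz_thinProj.continuous
  have huc := hu.continuous
  -- Blow up the last coordinate by `N + 1`. The Jacobian uses one of the two powers of `N + 1`, and
  -- the other turns the increment of `u` at height `|x_d|/(N + 1)` into `|x_d|` times a difference
  -- quotient.
  have hscale : ∀ N : ℕ, ∫ x, ((N : ℝ) + 1) ^ 2 * (max (u x - u (thinProj x)) 0 *
      expAbs ((N : ℝ) + 1) x * f x) ∂gammaMeasure n =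
      ∫ x, gaussDensity n (stretch ((N : ℝ) + 1)⁻¹ x) * (((N : ℝ) + 1) *
        max (u (stretch ((N : ℝ) + 1)⁻¹ x) - u (thinProj x)) 0 *
        Real.exp (-|x (Fin.last n)|) * f (stretch ((N : ℝ) + 1)⁻¹ x)) := fun N => by
    have ha : (0 : ℝ) < (N : ℝ) + 1 := by positivity
    rw [integral_gammaMeasure]
    have hcont : Continuous fun x : Sp n => gaussDensity n x * (((N : ℝ) + 1) ^ 2 *
        (max (u x - u (thinProj x)) 0 * expAbs ((N : ℝ) + 1) x * f x)) := by
      have h1 := (contDiff_gaussDensity (n := n) (m := 0)).continuous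
      have h2 := (locallyLipschitz_expAbs (n := n) ((N : ℝ) + 1)).continuous
      fun_prop
    have h := integral_comp_stretch (inv_pos.2 ha) _ hcont
    rw [inv_inv, ← inv_mul_eq_iff_eq_mul₀ ha.ne', ← integral_const_mul] at h
    rw [← h]
    refine integral_congr_ae (Eventually.of_forall fun x => ?_)
    have e1 : thinProj (stretch ((N : ℝ) + 1)⁻¹ x) = thinProj x := by
      rw [stretch_apply, thinProj_add]
      simp [thinProj]
    have e2 : (stretch ((N : ℝ) + 1)⁻¹ x) (Fin.last n) = ((N : ℝ) + 1)⁻¹ * x (Fin.last n) := by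
      rw [stretch_apply]
      simp [thinProj_last]
    simp only [e1, expAbs, e2, abs_mul, abs_of_pos (inv_pos.2 ha)]
    rw [mul_inv_cancel_left₀ ha.ne']
    field_simp
  simp only [hscale]
  have h0 : ∫ _ : Sp n, (0 : ℝ) = 0 := integral_zero _ _
  refine (congrArg (fun c : ℝ => Tendsto _ atTop (𝓝 c)) h0).mp ?_
  refine tendsto_integral_of_dominated_convergence
    (fun x => gaussDensity n 0 * L * M * g x) (fun N => ?_) (hg.const_mul _) (fun N => ?_) ?_
  · refine Continuous.aestronglyMeasurable ?_
    have h1 := (contDiff_gaussDensity (n := n) (m := 0)).continuous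
    have h3 : Continuous (stretch (n := n) ((N : ℝ) + 1)⁻¹) :=
      LinearMap.continuous_of_finiteDimensional _
    have h4 : Continuous fun x : Sp n => x (Fin.last n) := (lastCoord n).continuous
    fun_prop
  · refine Eventually.of_forall fun x => ?_
    have ha : (0 : ℝ) < (N : ℝ) + 1 := by positivity
    set y := stretch ((N : ℝ) + 1)⁻¹ x with hy
    have e1 : thinProj y = thinProj x := by
      rw [hy, stretch_apply, thinProj_add]
      simp [thinProj]
    have e2 : y (Fin.last n) = ((N : ℝ) + 1)⁻¹ * x (Fin.last n) := by
      rw [hy, stretch_apply]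
      simp [thinProj_last]
    have hd := gaussDensity_pos y
    have hd0 := gaussDensity_pos (0 : Sp n)
    by_cases hyR : ‖y‖ ≤ R'
    · have h1 : ‖thinProj x‖ ≤ R' := by
        rw [← e1]
        exact (norm_thinProj_le y).trans hyR
      have h2 : |u y - u (thinProj x)| ≤ L * (((N : ℝ) + 1)⁻¹ * |x (Fin.last n)|) := by
        have h3 := hL.dist_le_mul y (by simpa using hyR) (thinProj x) (by simpa using h1)
        rwa [← e1, dist_eq_norm y, norm_sub_thinProj, e2, abs_mul, abs_of_pos (inv_pos.2 ha),
          Real.dist_eq, e1] at h3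
      have h4 : max (u y - u (thinProj x)) 0 ≤ L * (((N : ℝ) + 1)⁻¹ * |x (Fin.last n)|) :=
        max_le ((le_abs_self _).trans h2) (by have := L.2; positivity)
      have h5 : ((N : ℝ) + 1) * max (u y - u (thinProj x)) 0 ≤ L * |x (Fin.last n)| := by
        calc _ ≤ ((N : ℝ) + 1) * (L * (((N : ℝ) + 1)⁻¹ * |x (Fin.last n)|)) := by gcongr
          _ = _ := by field_simp
      have h6 : f y ≤ M := (le_abs_self _).trans (hM y)
      have h7 := hf0 y
      rw [Real.norm_of_nonneg (by positivity)]
      calc _ ≤ gaussDensity n 0 * ((L * |x (Fin.last n)|) * Real.exp (-|x (Fin.last n)|) * M) := by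
            gcongr
            exact gaussDensity_le y
        _ = gaussDensity n 0 * L * M * (|x (Fin.last n)| * Real.exp (-|x (Fin.last n)|)) := by ring
        _ ≤ _ := by gcongr; exact hgb x h1
    · rw [hfz y (not_le.1 hyR), mul_zero, mul_zero, norm_zero]
      have := hg0 x
      positivity
  · refine Eventually.of_forall fun x => ?_
    have key : Tendsto (fun N : ℕ => ((N : ℝ) + 1) *
        max (u (stretch ((N : ℝ) + 1)⁻¹ x) - u (thinProj x)) 0) atTop (𝓝 0) := by
      by_cases hx : x (Fin.last n) = 0
      · have : ∀ N : ℕ, stretch ((N : ℝ) + 1)⁻¹ x = thinProj x := fun N => by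
          simp [stretch_apply, hx]
        simp [this]
      have hs : 0 < |x (Fin.last n)| := abs_pos.2 hx
      have hh : Tendsto (fun N : ℕ => ((N : ℝ) + 1)⁻¹ * |x (Fin.last n)|) atTop (𝓝[>] 0) := by
        refine tendsto_nhdsWithin_iff.2 ⟨?_, Eventually.of_forall fun N => ?_⟩
        · have := tendsto_one_div_add_atTop_nhds_zero_nat (𝕜 := ℝ)
          simpa using this.mul_const |x (Fin.last n)|
        · simp only [mem_Ioi]
          positivity
      refine tendsto_order.2 ⟨fun b hb => Eventually.of_forall fun N => ?_, fun b hb => ?_⟩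
      · exact hb.trans_le (by positivity)
      · have hε : 0 < b / (2 * |x (Fin.last n)|) := by positivity
        filter_upwards [hh.eventually (hN (thinProj x) (thinProj_last x) _ hε)] with N hNN
        have ha : (0 : ℝ) < (N : ℝ) + 1 := by positivity
        have e3 : u (stretch ((N : ℝ) + 1)⁻¹ x) =
            u (thinProj x + (((N : ℝ) + 1)⁻¹ * |x (Fin.last n)|) • eLast n) := by
          have := heven (stretch ((N : ℝ) + 1)⁻¹ x)
          have e1 : thinProj (stretch ((N : ℝ) + 1)⁻¹ x) = thinProj x := by
            rw [stretch_apply, thinProj_add]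
            simp [thinProj]
          have e2 : (stretch ((N : ℝ) + 1)⁻¹ x) (Fin.last n) =
              ((N : ℝ) + 1)⁻¹ * x (Fin.last n) := by
            rw [stretch_apply]
            simp [thinProj_last]
          rw [e1, e2, abs_mul, abs_of_pos (inv_pos.2 ha), ← stretch_apply] at this
          exact this
        rw [← e3] at hNN
        have h8 : max (u (stretch ((N : ℝ) + 1)⁻¹ x) - u (thinProj x)) 0 ≤
            b / (2 * |x (Fin.last n)|) * (((N : ℝ) + 1)⁻¹ * |x (Fin.last n)|) :=
          max_le hNN (by positivity)
        calc _ ≤ ((N : ℝ) + 1) *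
              (b / (2 * |x (Fin.last n)|) * (((N : ℝ) + 1)⁻¹ * |x (Fin.last n)|)) := by gcongr
          _ = b / 2 := by field_simp
          _ < b := by linarith
    have hbd : ∀ N : ℕ, ‖gaussDensity n (stretch ((N : ℝ) + 1)⁻¹ x) * (((N : ℝ) + 1) *
        max (u (stretch ((N : ℝ) + 1)⁻¹ x) - u (thinProj x)) 0 *
        Real.exp (-|x (Fin.last n)|) * f (stretch ((N : ℝ) + 1)⁻¹ x))‖ ≤
        (gaussDensity n 0 * 1 * M) * (((N : ℝ) + 1) *
        max (u (stretch ((N : ℝ) + 1)⁻¹ x) - u (thinProj x)) 0) := fun N => by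
      have hd := gaussDensity_pos (stretch ((N : ℝ) + 1)⁻¹ x)
      have hd0 := gaussDensity_pos (0 : Sp n)
      have h6 : f (stretch ((N : ℝ) + 1)⁻¹ x) ≤ M := (le_abs_self _).trans (hM _)
      have h7 := hf0 (stretch ((N : ℝ) + 1)⁻¹ x)
      have h8 : Real.exp (-|x (Fin.last n)|) ≤ 1 := by simp
      rw [Real.norm_of_nonneg (by positivity)]
      calc _ ≤ gaussDensity n 0 * (((N : ℝ) + 1) *
            max (u (stretch ((N : ℝ) + 1)⁻¹ x) - u (thinProj x)) 0 * 1 * M) := by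
            gcongr
            exact gaussDensity_le _
        _ = _ := by ring
    refine squeeze_zero_norm hbd ?_
    simpa using key.const_mul (gaussDensity n 0 * 1 * M)

theorem gradient_expAbs (a : ℝ) {x : Sp n} (hx : x (Fin.last n) ≠ 0) :
    gradient (expAbs a) x = (-(a * sgn x) * expAbs a x) • eLast n := by
  refine ext_inner_right ℝ fun e => ?_
  rw [← fderiv_apply_eq_inner_gradient, (hasFDerivAt_expAbs a hx).fderiv, inner_smul_left,
    real_inner_comm, inner_eLast]
  simp

theorem sgn_mul_self {x : Sp n} (hx : x (Fin.last n) ≠ 0) : sgn x * sgn x = 1 := by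
  rcases lt_or_gt_of_ne hx with h | h
  · simp [sgn, sign_neg h]
  · simp [sgn, sign_pos h]

/-- The difference of the two test functions is `(1 - e^{-a|x_d|}) f = O(|x_d|)`, which the equation
off the thin space annihilates. -/
theorem SolvesOffThin.heatForm_expAbs_mul {lam : ℝ} {u : Sp n → ℝ} (h : SolvesOffThin lam u)
    (hu : Admissible u) {a : ℝ} (ha : 0 ≤ a) {C : ℝ} {f : Sp n → ℝ} (hf : ContDiff ℝ ∞ f)
    (hC : BoundedC1 C f) : heatForm lam u (fun x => expAbs a x * f x) = heatForm lam u f := by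
  have hC0 := hC.nonneg
  have hfd : ∀ᵐ x, DifferentiableAt ℝ f x :=
    Eventually.of_forall (hf.differentiable (by simp))
  have hEd : ∀ᵐ x : Sp n, DifferentiableAt ℝ (expAbs a) x := by
    filter_upwards [ae_last_ne_zero] with x hx using (hasFDerivAt_expAbs a hx).differentiableAt
  have hEfd : ∀ᵐ x : Sp n, DifferentiableAt ℝ (fun x => expAbs a x * f x) x := by
    filter_upwards [hfd, hEd] with x h1 h2 using h2.fun_mul h1
  have hEf := (boundedC1_expAbs (n := n) ha).mul hC hEd hfd
  have hg := hC.sub hEf hfd hEfd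
  have hgd : ∀ᵐ x : Sp n, DifferentiableAt ℝ (fun x => f x - expAbs a x * f x) x := by
    filter_upwards [hfd, hEfd] with x h1 h2 using h1.fun_sub h2
  have hzero : heatForm lam u (fun x => f x - expAbs a x * f x) = 0 := by
    refine h.eq_zero hu (hg.mono (le_add_of_nonneg_right (mul_nonneg ha hC0)))
      (fun x hx => hf.contDiffAt.sub ((contDiffAt_expAbs a hx).mul hf.contDiffAt)) fun x => ?_
    have e1 : f x - expAbs a x * f x = (1 - expAbs a x) * f x := by ring
    rw [e1, abs_mul, abs_of_nonneg (by linarith [expAbs_le_one ha x])]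
    have h1 := mul_le_mul (one_sub_expAbs_le a x) (hC.bound x) (abs_nonneg _) (by positivity)
    have h2 := hg.nonneg
    have := mul_nonneg h2 (abs_nonneg (x (Fin.last n)))
    linarith
  have hadd := heatForm_add lam hu hEf hg hEfd hgd
  rw [hzero, add_zero] at hadd
  rw [← hadd]
  congr 1
  funext x
  ring

/-- For solutions symmetric in the last coordinate, the one-sided boundary condition implies the
two-sided one. -/
theorem supersolution_of_normalDeriv {lam : ℝ} {u : Sp n → ℝ} (hu : Admissible u)
    (hH : SolvesOffThin lam u)
    (heven : ∀ x, u (thinProj x + x (Fin.last n) • eLast n) =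
      u (thinProj x + |x (Fin.last n)| • eLast n))
    (hN : ∀ x : Sp n, x (Fin.last n) = 0 → ∀ ε > (0 : ℝ), ∀ᶠ h in 𝓝[>] (0 : ℝ),
      u (x + h • eLast n) - u x ≤ ε * h) : Supersolution lam u := by
  intro f hf hc hf0
  obtain ⟨C, hC⟩ := exists_boundedC1_of_hasCompactSupport
    (ContDiff.locallyLipschitz (𝕂 := ℝ) (hf.of_le (by simp))) hc
  obtain ⟨R, hR⟩ := hc.isCompact.isBounded.subset_closedBall (0 : Sp n)
  obtain ⟨L, hL⟩ := LocallyLipschitzOn.exists_lipschitzOnWith_of_compact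
    (isCompact_closedBall (0 : Sp n) R) (hu.lip.locallyLipschitzOn.mono (subset_univ _))
  -- Subtracting the values on the thin space keeps the normal derivative and makes `v = O(|x_d|)`
  -- on the support of `f`.
  set v : Sp n → ℝ := fun x => u x - u (thinProj x) with hv
  have hvl : LocallyLipschitz v := hu.lip.sub (hu.lip.comp lipschitz_thinProj)
  have hv0 : ∀ x, x (Fin.last n) = 0 → v x = 0 := fun x hx => by simp [hv, thinProj, hx]
  have hvL : ∀ x ∈ tsupport f, |v x| ≤ L * |x (Fin.last n)| := fun x hx => by
    have h1 : ‖x‖ ≤ R := by simpa using hR hx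
    have h2 := hL.dist_le_mul x (by simpa using h1) (thinProj x)
      (by simpa using (norm_thinProj_le x).trans h1)
    rwa [dist_eq_norm x, norm_sub_thinProj, Real.dist_eq] at h2
  -- This is the `x_d`-derivative of `f` times the Gaussian density, divided by the density.
  set k : Sp n → ℝ := fun x => fderiv ℝ f x (eLast n) - 1 / 2 * x (Fin.last n) * f x with hk
  have hfc : Continuous f := hf.continuous
  have hf1 : ContDiff ℝ 1 f := hf.of_le (by simp)
  have hfdiff : Differentiable ℝ f := hf.differentiable (by simp)
  have hkc : Continuous k := by
    have h1 : Continuous fun x => fderiv ℝ f x (eLast n) :=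
      (hf1.continuous_fderiv one_ne_zero).clm_apply continuous_const
    have h2 : Continuous fun x : Sp n => x (Fin.last n) := (lastCoord n).continuous
    fun_prop
  have hk0 : ∀ x, x ∉ tsupport f → k x = 0 := fun x hx => by
    have h1 : fderiv ℝ f x = 0 := by
      by_contra h
      exact hx (support_fderiv_subset ℝ h)
    simp [hk, h1, image_eq_zero_of_notMem_tsupport hx]
  obtain ⟨M, hM⟩ := (HasCompactSupport.intro hc.isCompact hk0).exists_bound_of_continuous hkc
  have hM0 : 0 ≤ M := (norm_nonneg _).trans (hM 0)
  set H : Sp n → ℝ := fun x => fderiv ℝ u x (gradient f x) - lam / 2 * u x * f x with hHdef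
  have hHint : Integrable H (gammaMeasure n) := integrable_heat lam hu hC
  -- The form tested with `f` will be at least `∫ A N - ∫ P N`, and both integrals tend to `0`. In
  -- `A` the factor `N + 1` is harmless since `(N + 1) |x_d| e^{-(N + 1)|x_d|} ≤ 1`.
  set A : ℕ → Sp n → ℝ := fun N x => expAbs ((N : ℝ) + 1) x * H x +
    ((N : ℝ) + 1) * sgn x * v x * expAbs ((N : ℝ) + 1) x * k x with hA
  set P : ℕ → Sp n → ℝ := fun N x => ((N : ℝ) + 1) ^ 2 * (max (u x - u (thinProj x)) 0 *
      expAbs ((N : ℝ) + 1) x * f x) with hPdef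
  have hEc : ∀ a : ℝ, Continuous (expAbs (n := n) a) := fun a => (locallyLipschitz_expAbs a).continuous
  have hAm : ∀ N, AEStronglyMeasurable (A N) (gammaMeasure n) := fun N => by
    refine AEStronglyMeasurable.add ((hEc _).aestronglyMeasurable.mul hHint.1) ?_
    refine Measurable.aestronglyMeasurable ?_
    exact (((measurable_const.mul measurable_sgn).mul hvl.continuous.measurable).mul
      (hEc _).measurable).mul hkc.measurable
  have hAb : ∀ N x, ‖A N x‖ ≤ ‖H x‖ + L * M := fun N x => by
    have ha : (0 : ℝ) < (N : ℝ) + 1 := by positivity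
    have hE := expAbs_pos ((N : ℝ) + 1) x
    refine (norm_add_le _ _).trans (add_le_add ?_ ?_)
    · rw [norm_mul, Real.norm_of_nonneg hE.le]
      exact mul_le_of_le_one_left (norm_nonneg _) (expAbs_le_one ha.le x)
    · by_cases hx : x ∈ tsupport f
      · have h1 : ((N : ℝ) + 1) * |x (Fin.last n)| * expAbs ((N : ℝ) + 1) x ≤ 1 := by
          rw [expAbs, Real.exp_neg, ← div_eq_mul_inv, div_le_one (Real.exp_pos _)]
          linarith [Real.add_one_le_exp (((N : ℝ) + 1) * |x (Fin.last n)|)]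
        rw [norm_mul, norm_mul, norm_mul, norm_mul, Real.norm_of_nonneg hE.le,
          Real.norm_of_nonneg ha.le]
        calc ((N : ℝ) + 1) * ‖sgn x‖ * ‖v x‖ * expAbs ((N : ℝ) + 1) x * ‖k x‖
            ≤ ((N : ℝ) + 1) * 1 * (L * |x (Fin.last n)|) * expAbs ((N : ℝ) + 1) x * M := by
              gcongr
              · exact abs_sgn_le_one x
              · exact hvL x hx
              · exact hM x
          _ = L * (((N : ℝ) + 1) * |x (Fin.last n)| * expAbs ((N : ℝ) + 1) x) * M := by ring
          _ ≤ L * 1 * M := by gcongr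
          _ = L * M := by ring
      · rw [hk0 x hx, mul_zero, norm_zero]
        have := L.2
        positivity
  have hAint : ∀ N, Integrable (A N) (gammaMeasure n) := fun N =>
    (hHint.norm.add (integrable_const (L * M))).mono' (hAm N)
      (Eventually.of_forall fun x => hAb N x)
  have hPint : ∀ N, Integrable (P N) (gammaMeasure n) := fun N => by
    refine Continuous.integrable_of_hasCompactSupport ?_ (hc.mul_left.mul_left)
    have h1 := hEc ((N : ℝ) + 1)
    have h2 : Continuous fun x => u x - u (thinProj x) := hvl.continuous
    exact continuous_const.mul (((h2.max continuous_const).mul h1).mul hfc)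
  have hlimA : Tendsto (fun N => ∫ x, A N x ∂gammaMeasure n) atTop (𝓝 0) := by
    have h0 : ∫ _ : Sp n, (0 : ℝ) ∂gammaMeasure n = 0 := integral_zero _ _
    refine (congrArg (fun c : ℝ => Tendsto _ atTop (𝓝 c)) h0).mp ?_
    refine tendsto_integral_of_dominated_convergence (fun x => ‖H x‖ + L * M) hAm
      (hHint.norm.add (integrable_const _)) (fun N => Eventually.of_forall fun x => hAb N x) ?_
    filter_upwards [ae_gammaMeasure_of_ae ae_last_ne_zero] with x hx
    have hs : 0 < |x (Fin.last n)| := abs_pos.2 hx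
    have hN1 : Tendsto (fun N : ℕ => (N : ℝ) + 1) atTop atTop :=
      tendsto_natCast_atTop_atTop.atTop_add tendsto_const_nhds
    have e0 : Tendsto (fun N : ℕ => expAbs ((N : ℝ) + 1) x) atTop (𝓝 0) := by
      have := (tendsto_rpow_mul_exp_neg_mul_atTop_nhds_zero 0 _ hs).comp hN1
      refine this.congr fun N => ?_
      simp [expAbs, mul_comm]
    have e1 : Tendsto (fun N : ℕ => ((N : ℝ) + 1) * expAbs ((N : ℝ) + 1) x) atTop (𝓝 0) := by
      have := (tendsto_rpow_mul_exp_neg_mul_atTop_nhds_zero 1 _ hs).comp hN1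
      refine this.congr fun N => ?_
      simp [expAbs, mul_comm]
    have e2 := (e0.mul_const (H x)).add (e1.mul_const (sgn x * v x * k x))
    simp only [zero_mul, add_zero] at e2
    refine e2.congr fun N => ?_
    simp only [hA]
    ring
  have hlim := hlimA.sub (tendsto_integral_posPart hu.lip heven hN hfc hc hf0)
  rw [sub_zero] at hlim
  refine le_of_tendsto' hlim fun N => ?_
  have ha : (0 : ℝ) < (N : ℝ) + 1 := by positivity
  set a : ℝ := (N : ℝ) + 1 with hadef
  have hEd : ∀ᵐ x : Sp n, DifferentiableAt ℝ (expAbs a) x := by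
    filter_upwards [ae_last_ne_zero] with x hx using (hasFDerivAt_expAbs a hx).differentiableAt
  have hEf := (boundedC1_expAbs (n := n) ha.le).mul hC hEd (Eventually.of_forall hfdiff)
  have hgl : LocallyLipschitz (fun x => expAbs a x * f x) :=
    locallyLipschitz_mul (locallyLipschitz_expAbs a)
      (ContDiff.locallyLipschitz (𝕂 := ℝ) hf1)
  have hgc : HasCompactSupport (fun x => expAbs a x * f x) := hc.mul_left
  have hibp : ibpForm sgn (eLast n) v (fun x => expAbs a x * f x) = 0 := by
    refine le_antisymm (ibpForm_sgn_nonpos_of_hasCompactSupport hvl hgl hgc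
      fun x hx => by simp [hv0 x hx]) ?_
    have := ibpForm_sgn_nonpos_of_hasCompactSupport hvl hgl.neg hgc.neg
      fun x hx => by simp [hv0 x hx]
    change ibpForm sgn (eLast n) v (fun x => -(expAbs a x * f x)) ≤ 0 at this
    rw [ibpForm_neg] at this
    linarith
  -- Test with `e^{-a|x_d|} f` and add `a` times an integration by parts whose value is zero. This
  -- removes the term containing the normal derivative of `u` and leaves `-a² v e^{-a|x_d|} f`, to
  -- which only the positive part of `v` contributes unfavourably.
  have hsplit : heatForm lam u f = ∫ x, ((fderiv ℝ u x (gradient (fun x => expAbs a x * f x) x) -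
      lam / 2 * u x * (expAbs a x * f x)) + a * (sgn x * (fderiv ℝ v x (eLast n) *
      (expAbs a x * f x) + v x * fderiv ℝ (fun x => expAbs a x * f x) x (eLast n) -
      1 / 2 * inner ℝ x (eLast n) * (v x * (expAbs a x * f x))))) ∂gammaMeasure n := by
    rw [integral_add (integrable_heat lam hu hEf)
      ((integrable_ibp_of_hasCompactSupport measurable_sgn abs_sgn_le_one _ hvl hgl hgc).const_mul a),
      integral_const_mul]
    change _ = heatForm lam u (fun x => expAbs a x * f x) +
      a * ibpForm sgn (eLast n) v (fun x => expAbs a x * f x)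
    rw [hibp, hH.heatForm_expAbs_mul hu ha.le hf hC, mul_zero, add_zero]
  rw [hsplit, ← integral_sub (hAint N) (hPint N)]
  refine integral_mono_ae ((hAint N).sub (hPint N)) ((integrable_heat lam hu hEf).add
    ((integrable_ibp_of_hasCompactSupport measurable_sgn abs_sgn_le_one _ hvl hgl hgc).const_mul a))
    ?_
  filter_upwards [hu.ae_differentiableAt,
    ae_gammaMeasure_of_ae (ae_differentiableAt_of_locallyLipschitz volume hvl),
    ae_gammaMeasure_of_ae ae_last_ne_zero] with x hxu hxv hx
  have hEx := (hasFDerivAt_expAbs a hx).differentiableAt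
  have e1 : fderiv ℝ v x (eLast n) = fderiv ℝ u x (eLast n) := fderiv_sub_comp_thinProj hxu hxv
  have e2 : fderiv ℝ (fun x => expAbs a x * f x) x (eLast n) =
      expAbs a x * fderiv ℝ f x (eLast n) - a * sgn x * expAbs a x * f x := by
    rw [fderiv_fun_mul hEx (hfdiff x), (hasFDerivAt_expAbs a hx).fderiv]
    simp
    ring
  have e3 : fderiv ℝ u x (gradient (fun x => expAbs a x * f x) x) =
      expAbs a x * fderiv ℝ u x (gradient f x) -
        a * sgn x * expAbs a x * f x * fderiv ℝ u x (eLast n) := by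
    rw [gradient_mul hEx (hfdiff x), gradient_expAbs a hx]
    simp
    ring
  have e4 := sgn_mul_self hx
  rw [e1, e2, e3, inner_eLast]
  have e5 : v x ≤ max (u x - u (thinProj x)) 0 := le_max_left _ _
  have e6 : a ^ 2 * (v x * expAbs a x * f x) ≤
      a ^ 2 * (max (u x - u (thinProj x)) 0 * expAbs a x * f x) := by
    have := (expAbs_pos a x).le
    have := hf0 x
    gcongr
  have e7 : a * (sgn x * (v x * (a * sgn x * expAbs a x * f x))) =
      a ^ 2 * (v x * expAbs a x * f x) := by
    linear_combination (a ^ 2 * v x * expAbs a x * f x) * e4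
  simp only [hA, hPdef, hHdef, hk, ← hadef]
  linarith

/-! ### The Euler equation `r K' - lam K = ρ`. -/

theorem eq_zero_of_continuous_of_eqOn_Ioi {G : ℝ → ℝ} (hG : Continuous G)
    (h : ∀ r, 0 < r → G r = 0) : G 0 = 0 := by
  have h1 : Tendsto G (𝓝[>] 0) (𝓝 (G 0)) := hG.continuousAt.tendsto.mono_left nhdsWithin_le_nhds
  refine tendsto_nhds_unique h1 (tendsto_const_nhds.congr' ?_)
  filter_upwards [self_mem_nhdsWithin] with r hr using (h r hr).symm

theorem deriv_eq_zero_of_eqOn_Ioi {G : ℝ → ℝ} (h : ∀ r, 0 < r → G r = 0) :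
    ∀ r, 0 < r → deriv G r = 0 := fun r hr => by
  have : G =ᶠ[𝓝 r] fun _ => (0 : ℝ) := by
    filter_upwards [Ioi_mem_nhds hr] with y hy using h y hy
  rw [this.deriv_eq, deriv_const]

theorem contDiff_deriv_of_contDiff {f : ℝ → ℝ} (hf : ContDiff ℝ ∞ f) : ContDiff ℝ ∞ (deriv f) :=
  ((contDiff_infty_iff_deriv).1 hf).2

/-- A smooth solution of `r K' - lam K = ρ`, with `ρ = O(r³)` and `lam ∉ {0, 1, 2}`, is `O(r³)`. -/
theorem exists_le_mul_cube_of_euler_ode {lam : ℝ} (hlam : 2 < lam) {K ρ : ℝ → ℝ}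
    (hK : ContDiff ℝ ∞ K) (hρ : ContDiff ℝ ∞ ρ) (h0 : ρ 0 = 0) (h1 : deriv ρ 0 = 0)
    (h2 : deriv (deriv ρ) 0 = 0) (hode : ∀ r, 0 < r → r * deriv K r - lam * K r = ρ r) :
    ∃ C, ∀ r ∈ Icc (0 : ℝ) 1, |K r| ≤ C * r ^ 3 := by
  have hK1 := contDiff_deriv_of_contDiff hK
  have hK2 := contDiff_deriv_of_contDiff hK1
  have hρ1 := contDiff_deriv_of_contDiff hρ
  have hρ2 := contDiff_deriv_of_contDiff hρ1
  have d0 : ∀ r, HasDerivAt K (deriv K r) r := fun r => (hK.differentiable (by simp) r).hasDerivAt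
  have d1 : ∀ r, HasDerivAt (deriv K) (deriv (deriv K) r) r := fun r =>
    (hK1.differentiable (by simp) r).hasDerivAt
  have d2 : ∀ r, HasDerivAt (deriv (deriv K)) (deriv (deriv (deriv K)) r) r := fun r =>
    (hK2.differentiable (by simp) r).hasDerivAt
  have e0 : ∀ r, HasDerivAt ρ (deriv ρ r) r := fun r => (hρ.differentiable (by simp) r).hasDerivAt
  have e1 : ∀ r, HasDerivAt (deriv ρ) (deriv (deriv ρ) r) r := fun r =>
    (hρ1.differentiable (by simp) r).hasDerivAt
  -- Differentiating the equation `j` times, `j = 0, 1, 2`, and letting `r ↓ 0` gives `(j - lam)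
  -- K⁽ʲ⁾(0) = 0`. Hence the second-order Taylor polynomial of `K` vanishes.
  have hz0 : ∀ r, 0 < r → (fun r => r * deriv K r - lam * K r - ρ r) r = 0 := fun r hr => by
    simp [hode r hr]
  have g1 : deriv (fun r => r * deriv K r - lam * K r - ρ r) =
      fun r => (1 - lam) * deriv K r + r * deriv (deriv K) r - deriv ρ r := by
    funext r
    have := ((((hasDerivAt_id r).mul (d1 r)).sub ((d0 r).const_mul lam)).sub (e0 r)).deriv
    refine this.trans ?_
    simp only [id]
    ring
  have hz1 := deriv_eq_zero_of_eqOn_Ioi hz0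
  have g2 : deriv (fun r => (1 - lam) * deriv K r + r * deriv (deriv K) r - deriv ρ r) =
      fun r => (2 - lam) * deriv (deriv K) r + r * deriv (deriv (deriv K)) r
        - deriv (deriv ρ) r := by
    funext r
    have := ((((d1 r).const_mul (1 - lam)).add ((hasDerivAt_id r).mul (d2 r))).sub (e1 r)).deriv
    refine this.trans ?_
    simp only [id]
    ring
  rw [g1] at hz1
  have hz2 := deriv_eq_zero_of_eqOn_Ioi hz1
  rw [g2] at hz2
  have c1 := hK.continuous
  have c2 := hK1.continuous
  have c3 := hK2.continuous
  have c4 := (contDiff_deriv_of_contDiff hK2).continuous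
  have c5 := hρ.continuous
  have c6 := hρ1.continuous
  have c7 := hρ2.continuous
  have k0 := eq_zero_of_continuous_of_eqOn_Ioi (by fun_prop) hz0
  have k1 := eq_zero_of_continuous_of_eqOn_Ioi (by fun_prop) hz1
  have k2 := eq_zero_of_continuous_of_eqOn_Ioi (by fun_prop) hz2
  simp only [zero_mul, h0, h1, h2, sub_zero, add_zero, zero_sub, neg_eq_zero, mul_eq_zero] at k0 k1 k2
  replace k0 : K 0 = 0 := k0.resolve_left (by linarith)
  replace k1 : deriv K 0 = 0 := k1.resolve_left (by linarith)
  replace k2 : deriv (deriv K) 0 = 0 := k2.resolve_left (by linarith)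
  obtain ⟨C, hC⟩ := exists_taylor_mean_remainder_bound (n := 2) (zero_le_one' ℝ)
    (f := K) (by exact_mod_cast (contDiff_infty.1 hK (2 + 1)).contDiffOn)
  refine ⟨C, fun r hr => ?_⟩
  have h := hC r hr
  have hit : ∀ m : ℕ, iteratedDerivWithin m K (Icc (0 : ℝ) 1) 0 = iteratedDeriv m K 0 := fun m =>
    iteratedDerivWithin_eq_iteratedDeriv (uniqueDiffOn_Icc zero_lt_one)
      ((hK.of_le (by exact_mod_cast le_top)).contDiffAt) (by simp)
  rw [taylor_within_apply] at h
  simp only [hit, Finset.sum_range_succ, Finset.sum_range_zero, iteratedDeriv_zero,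
    iteratedDeriv_succ, k0, k1, k2, smul_zero, add_zero, sub_zero,
    Real.norm_eq_abs] at h
  simpa using h

/-- This is where `lam < 3` enters: the homogeneous solution `r ^ lam` is larger near `0` than a
cubic error. -/
theorem tendsto_rpow_neg_mul_of_le_cube {lam : ℝ} (hlam : lam < 3) {K : ℝ → ℝ} {C : ℝ}
    (hC : ∀ r ∈ Icc (0 : ℝ) 1, |K r| ≤ C * r ^ 3) :
    Tendsto (fun r => r ^ (-lam) * K r) (𝓝[>] 0) (𝓝 0) := by
  have h1 : Tendsto (fun r : ℝ => C * r ^ (3 - lam)) (𝓝[>] 0) (𝓝 0) := by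
    have h2 : Tendsto (fun r : ℝ => r ^ (3 - lam)) (𝓝 0) (𝓝 0) := by
      have := (Real.continuousAt_rpow_const 0 (3 - lam) (Or.inr (by linarith))).tendsto
      rwa [Real.zero_rpow (by linarith)] at this
    simpa using (h2.mono_left nhdsWithin_le_nhds).const_mul C
  refine squeeze_zero_norm' ?_ h1
  have : Ioc (0 : ℝ) 1 ∈ 𝓝[>] (0 : ℝ) := Ioc_mem_nhdsGT zero_lt_one
  filter_upwards [this] with r hr
  rw [norm_mul, Real.norm_of_nonneg (Real.rpow_nonneg hr.1.le _), Real.norm_eq_abs]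
  calc r ^ (-lam) * |K r| ≤ r ^ (-lam) * (C * r ^ 3) :=
        mul_le_mul_of_nonneg_left (hC r ⟨hr.1.le, hr.2⟩) (Real.rpow_nonneg hr.1.le _)
    _ = C * (r ^ (-lam) * r ^ (3 : ℝ)) := by
        rw [show r ^ (3 : ℝ) = r ^ 3 by exact_mod_cast Real.rpow_natCast r 3]; ring
    _ = C * r ^ (3 - lam) := by
        rw [← Real.rpow_add hr.1]; ring_nf

/-- With a nonnegative right-hand side, `r ^ (-lam) K` increases from its limit `0` at `0`. -/
theorem euler_ode_monotone {lam : ℝ} (h2lam : 2 < lam) (hlam : lam < 3) {K ρ : ℝ → ℝ}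
    (hK : ContDiff ℝ ∞ K) (hρ : ContDiff ℝ ∞ ρ) (h0 : ρ 0 = 0) (h1 : deriv ρ 0 = 0)
    (h2 : deriv (deriv ρ) 0 = 0) (hode : ∀ r, 0 < r → r * deriv K r - lam * K r = ρ r)
    (hρ0 : ∀ r, 0 < r → 0 ≤ ρ r) :
    MonotoneOn (fun r => r ^ (-lam) * K r) (Ioi 0) ∧ ∀ r, 0 < r → 0 ≤ K r := by
  obtain ⟨C, hC⟩ := exists_le_mul_cube_of_euler_ode h2lam hK hρ h0 h1 h2 hode
  -- The integrating factor of the Euler equation: the sign of the derivative is that of `ρ`.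
  have hd : ∀ r : ℝ, 0 < r → HasDerivAt (fun r => r ^ (-lam) * K r) (r ^ (-lam - 1) * ρ r) r :=
    fun r hr => by
    have := (Real.hasDerivAt_rpow_const (p := -lam) (Or.inl hr.ne')).mul
      (hK.differentiable (by simp) r).hasDerivAt
    convert! this using 1
    rw [← hode r hr]
    have : r ^ (-lam) = r ^ (-lam - 1) * r := by
      rw [← Real.rpow_add_one hr.ne']; ring_nf
    rw [this]
    ring
  have hmono : MonotoneOn (fun r => r ^ (-lam) * K r) (Ioi 0) := by
    refine monotoneOn_of_deriv_nonneg (convex_Ioi 0)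
      (fun r hr => (hd r hr).continuousAt.continuousWithinAt)
      (fun r hr => ?_) fun r hr => ?_
    · rw [interior_Ioi] at hr
      exact (hd r hr).differentiableAt.differentiableWithinAt
    · rw [interior_Ioi] at hr
      rw [(hd r hr).deriv]
      exact mul_nonneg (Real.rpow_nonneg (le_of_lt hr) _) (hρ0 r hr)
  refine ⟨hmono, fun r hr => ?_⟩
  have hlim := tendsto_rpow_neg_mul_of_le_cube hlam hC
  have : 0 ≤ r ^ (-lam) * K r := by
    refine le_of_tendsto hlim ?_
    filter_upwards [Ioc_mem_nhdsGT hr] with s hs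
    exact hmono hs.1 hr hs.2
  exact (mul_nonneg_iff_of_pos_left (Real.rpow_pos_of_pos hr _)).1 this

/-! ### Integrals depending on a parameter. -/

section Parametric

/-- By `|X|^j ≤ j! e^{|X|}`, every derivative in the parameter is dominated by an exponential moment
of `u`, uniformly for bounded parameters. This is why `Admissible` asks for all exponential rates.
-/
theorem paramIntegrand_bound {u X : Sp n → ℝ} {c : ℝ} (hXc : ∀ x, |X x| ≤ c * ‖x‖) {ψ : ℕ → ℝ → ℝ}
    (hψb : ∀ j y, |ψ j y| ≤ Real.exp |y|) (j : ℕ) {r r' : ℝ} (hr : |r'| ≤ r) (x : Sp n) :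
    ‖u x * (X x ^ j * ψ j (r' * X x))‖ ≤
      (j.factorial : ℝ) * |Real.exp ((1 + r) * c * ‖x‖) * u x| := by
  have hc : 0 ≤ c * ‖x‖ := (abs_nonneg _).trans (hXc x)
  have h1 : |X x| ^ j ≤ j.factorial * Real.exp (c * ‖x‖) := by
    have := Real.pow_div_factorial_le_exp |X x| (abs_nonneg _) j
    rw [div_le_iff₀ (by positivity), mul_comm] at this
    refine this.trans ?_
    gcongr
    exact hXc x
  have h2 : |ψ j (r' * X x)| ≤ Real.exp (r * (c * ‖x‖)) := by
    refine (hψb _ _).trans (Real.exp_le_exp.2 ?_)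
    rw [abs_mul]
    exact mul_le_mul hr (hXc x) (abs_nonneg _) ((abs_nonneg _).trans hr)
  rw [norm_mul, norm_mul, norm_pow, Real.norm_eq_abs, Real.norm_eq_abs, Real.norm_eq_abs,
    abs_mul, Real.abs_exp]
  calc |u x| * (|X x| ^ j * |ψ j (r' * X x)|)
      ≤ |u x| * ((j.factorial * Real.exp (c * ‖x‖)) * Real.exp (r * (c * ‖x‖))) := by gcongr
    _ = _ := by
      rw [mul_assoc (j.factorial : ℝ), ← Real.exp_add]
      ring_nf

theorem aestronglyMeasurable_paramIntegrand {u : Sp n → ℝ} (hu : Admissible u) {X : Sp n → ℝ}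
    (hX : Measurable X) {ψ : ℕ → ℝ → ℝ} (hψ : ∀ j y, HasDerivAt (ψ j) (ψ (j + 1) y) y)
    (j : ℕ) (r : ℝ) :
    AEStronglyMeasurable (fun x => u x * (X x ^ j * ψ j (r * X x))) (gammaMeasure n) := by
  have hψc : Measurable (ψ j) :=
    (continuous_iff_continuousAt.2 fun y => (hψ j y).continuousAt).measurable
  exact (hu.lip.continuous.measurable.mul ((hX.pow_const j).mul
    (hψc.comp (hX.const_mul r)))).aestronglyMeasurable

theorem integrable_paramIntegrand {u : Sp n → ℝ} (hu : Admissible u) {X : Sp n → ℝ}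
    (hX : Measurable X) {c : ℝ} (hXc : ∀ x, |X x| ≤ c * ‖x‖) {ψ : ℕ → ℝ → ℝ}
    (hψ : ∀ j y, HasDerivAt (ψ j) (ψ (j + 1) y) y) (hψb : ∀ j y, |ψ j y| ≤ Real.exp |y|)
    (j : ℕ) (r : ℝ) :
    Integrable (fun x => u x * (X x ^ j * ψ j (r * X x))) (gammaMeasure n) :=
  (((hu.int_exp ((1 + |r|) * c)).abs).const_mul (j.factorial : ℝ)).mono'
    (aestronglyMeasurable_paramIntegrand hu hX hψ j r)
    (Eventually.of_forall fun x => paramIntegrand_bound hXc hψb j le_rfl x)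

/-- Differentiation of `∫ u φ(r X) dγ` for functions `φ` whose derivatives `ψ j` grow at most
exponentially. -/
theorem hasDerivAt_paramIntegral {u : Sp n → ℝ} (hu : Admissible u) {X : Sp n → ℝ}
    (hX : Measurable X) {c : ℝ} (hXc : ∀ x, |X x| ≤ c * ‖x‖) {ψ : ℕ → ℝ → ℝ}
    (hψ : ∀ j y, HasDerivAt (ψ j) (ψ (j + 1) y) y) (hψb : ∀ j y, |ψ j y| ≤ Real.exp |y|)
    (j : ℕ) (r : ℝ) :
    HasDerivAt (fun r => ∫ x, u x * (X x ^ j * ψ j (r * X x)) ∂gammaMeasure n)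
      (∫ x, u x * (X x ^ (j + 1) * ψ (j + 1) (r * X x)) ∂gammaMeasure n) r := by
  refine (hasDerivAt_integral_of_dominated_loc_of_deriv_le (s := Metric.ball r 1)
    (F := fun r x => u x * (X x ^ j * ψ j (r * X x)))
    (F' := fun r x => u x * (X x ^ (j + 1) * ψ (j + 1) (r * X x)))
    (bound := fun x => ((j + 1).factorial : ℝ) * |Real.exp ((1 + (|r| + 1)) * c * ‖x‖) * u x|)
    (Metric.ball_mem_nhds r one_pos)
    (Eventually.of_forall fun r => aestronglyMeasurable_paramIntegrand hu hX hψ j r)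
    (integrable_paramIntegrand hu hX hXc hψ hψb j r)
    (aestronglyMeasurable_paramIntegrand hu hX hψ (j + 1) r)
    (Eventually.of_forall fun x r' hr' => paramIntegrand_bound hXc hψb (j + 1) ?_ x)
    (((hu.int_exp _).abs).const_mul _) (Eventually.of_forall fun x r' _ => ?_)).2
  · rw [Metric.mem_ball, Real.dist_eq] at hr'
    have := abs_sub_abs_le_abs_sub r' r
    linarith
  · have h := (((hψ j (r' * X x)).comp r' ((hasDerivAt_id r').mul_const (X x))).const_mul
      (X x ^ j)).const_mul (u x)
    convert! h using 1
    ring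

theorem contDiff_of_hasDerivAt_seq {A : ℕ → ℝ → ℝ} (h : ∀ j r, HasDerivAt (A j) (A (j + 1) r) r) :
    ∀ j, ContDiff ℝ ∞ (A j) := by
  have h1 : ∀ m j : ℕ, ContDiff ℝ m (A j) := by
    intro m
    induction m with
    | zero =>
      intro j
      exact contDiff_zero.2 (continuous_iff_continuousAt.2 fun r => (h j r).continuousAt)
    | succ m ih =>
      intro j
      have hd : deriv (A j) = A (j + 1) := funext fun r => (h j r).deriv
      have : ContDiff ℝ ((m : WithTop ℕ∞) + 1) (A j) := by
        refine contDiff_succ_iff_deriv.2 ⟨fun r => (h j r).differentiableAt, by simp, ?_⟩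
        rw [hd]
        exact ih (j + 1)
      exact_mod_cast this
  exact fun j => contDiff_infty.2 fun m => h1 m j

end Parametric

/-! ### Plane waves and eigenfunctions of the Ornstein-Uhlenbeck operator. -/

/-- Plane waves. -/
def wave (ξ : Sp n) (θ : ℝ) (x : Sp n) : ℝ := Real.cos (inner ℝ ξ x + θ)

theorem contDiff_wave (ξ : Sp n) (θ : ℝ) {m : WithTop ℕ∞} : ContDiff ℝ m (wave ξ θ) :=
  Real.contDiff_cos.comp ((contDiff_const.inner ℝ contDiff_id).add contDiff_const)

theorem gradient_wave (ξ : Sp n) (θ : ℝ) (x : Sp n) :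
    gradient (wave ξ θ) x = -Real.sin (inner ℝ ξ x + θ) • ξ := by
  have h1 : HasDerivAt (fun y : ℝ => Real.cos (y + θ)) (-Real.sin (inner ℝ ξ x + θ))
      (inner ℝ ξ x) := by
    simpa using ((hasDerivAt_id (inner ℝ ξ x)).add_const θ).cos
  have h2 := gradient_comp (f := fun y : Sp n => inner ℝ ξ y) h1
    ((InnerProductSpace.toDual ℝ (Sp n) ξ).differentiableAt)
  rw [gradient_inner_right] at h2
  exact h2

theorem boundedC1_wave (ξ : Sp n) (θ : ℝ) : BoundedC1 (1 + ‖ξ‖) (wave ξ θ) := by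
  refine ⟨(contDiff_wave (m := 0) ξ θ).continuous.measurable, fun x => ?_,
    Eventually.of_forall fun x => ?_⟩
  · exact (Real.abs_cos_le_one _).trans (by linarith [norm_nonneg ξ])
  · rw [← norm_gradient, gradient_wave, norm_smul, norm_neg, Real.norm_eq_abs]
    have := mul_le_mul_of_nonneg_right (Real.abs_sin_le_one (inner ℝ ξ x + θ)) (norm_nonneg ξ)
    linarith

/-- The derivatives of `y ↦ cos (y + θ)`. -/
def shiftedCos (θ : ℝ) (j : ℕ) (y : ℝ) : ℝ := Real.cos (y + (θ + j * (Real.pi / 2)))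

theorem hasDerivAt_shiftedCos (θ : ℝ) (j : ℕ) (y : ℝ) :
    HasDerivAt (shiftedCos θ j) (shiftedCos θ (j + 1) y) y := by
  have h := ((hasDerivAt_id y).add_const (θ + j * (Real.pi / 2))).cos
  convert! h using 1
  rw [shiftedCos, mul_one, ← Real.cos_add_pi_div_two]
  push_cast
  congr 1
  simp only [id]
  ring

theorem abs_shiftedCos_le (θ : ℝ) (j : ℕ) (y : ℝ) : |shiftedCos θ j y| ≤ Real.exp |y| :=
  (Real.abs_cos_le_one _).trans (Real.one_le_exp (abs_nonneg y))

/-- Along the ray `r ξ` let `A(r) = ∫ u cos(r ξ·x + θ) dγ`. Testing with the wave and removing `∇u`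
by a Gaussian integration by parts gives `(r²‖ξ‖² - lam/2) A + (r/2) A' = 0`, so `e^{‖ξ‖² r²} A`
satisfies `r K' = lam K`. It is smooth at `0`, which leaves only the zero solution. -/
theorem integral_mul_wave_eq_zero {lam : ℝ} (h2 : 2 < lam) (h3 : lam < 3) {u : Sp n → ℝ}
    (hu : Admissible u) (h : ∀ ξ θ, heatForm lam u (wave ξ θ) = 0) (ξ : Sp n) (θ : ℝ) :
    ∫ x, u x * wave ξ θ x ∂gammaMeasure n = 0 := by
  set X : Sp n → ℝ := fun x => inner ℝ ξ x with hX
  have hXm : Measurable X := (by fun_prop : Continuous fun x : Sp n => inner ℝ ξ x).measurable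
  have hXc : ∀ x, |X x| ≤ ‖ξ‖ * ‖x‖ := fun x => abs_real_inner_le_norm ξ x
  set A : ℕ → ℝ → ℝ := fun j r => ∫ x, u x * (X x ^ j * shiftedCos θ j (r * X x)) ∂gammaMeasure n
    with hA
  have hAd : ∀ j r, HasDerivAt (A j) (A (j + 1) r) r := fun j r =>
    hasDerivAt_paramIntegral hu hXm hXc (hasDerivAt_shiftedCos θ) (abs_shiftedCos_le θ) j r
  have hAint := fun j r => integrable_paramIntegrand hu hXm hXc (hasDerivAt_shiftedCos θ)
    (abs_shiftedCos_le θ) j r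
  have hAs := contDiff_of_hasDerivAt_seq hAd 0
  have hid : ∀ r, (r ^ 2 * ‖ξ‖ ^ 2 - lam / 2) * A 0 r + r / 2 * A 1 r = 0 := fun r => by
    have e1 := h (r • ξ) θ
    -- The phase shift by `π/2` turns the cosine into `-sin`, the factor in the gradient of the
    -- wave.
    have e2 := ibpForm_one_eq_zero ξ hu
      (ContDiff.locallyLipschitz (𝕂 := ℝ) (contDiff_wave (r • ξ) (θ + Real.pi / 2)))
      (boundedC1_wave (r • ξ) (θ + Real.pi / 2))
    have e3 : heatForm lam u (wave (r • ξ) θ) -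
        r * ibpForm (fun _ => 1) ξ u (wave (r • ξ) (θ + Real.pi / 2)) =
        (r ^ 2 * ‖ξ‖ ^ 2 - lam / 2) * A 0 r + r / 2 * A 1 r := by
      rw [heatForm, ibpForm, hA, ← integral_const_mul, ← integral_const_mul, ← integral_const_mul,
        ← integral_sub (integrable_heat lam hu (boundedC1_wave _ _))
          ((integrable_ibp measurable_const (by simp) ξ hu (boundedC1_wave _ _)).const_mul r),
        ← integral_add ((hAint 0 r).const_mul _) ((hAint 1 r).const_mul _)]
      refine integral_congr_ae (Eventually.of_forall fun x => ?_)
      have i1 : inner ℝ (r • ξ) x = r * X x := by rw [hX, inner_smul_left]; rfl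
      have i2 : inner ℝ x ξ = X x := real_inner_comm _ _
      have s0 : shiftedCos θ 0 (r * X x) = Real.cos (r * X x + θ) := by simp [shiftedCos]
      have s1 : shiftedCos θ 1 (r * X x) = -Real.sin (r * X x + θ) := by
        rw [shiftedCos, ← Real.cos_add_pi_div_two]
        push_cast
        ring_nf
      have w0 : wave (r • ξ) θ x = Real.cos (r * X x + θ) := by rw [wave, i1]
      have w1 : wave (r • ξ) (θ + Real.pi / 2) x = -Real.sin (r * X x + θ) := by
        rw [wave, i1, ← add_assoc, Real.cos_add_pi_div_two]
      have w2 : fderiv ℝ (wave (r • ξ) (θ + Real.pi / 2)) x ξ =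
          -Real.cos (r * X x + θ) * (r * ‖ξ‖ ^ 2) := by
        rw [fderiv_apply_eq_inner_gradient, gradient_wave, i1, ← add_assoc,
          Real.sin_add_pi_div_two, inner_smul_left, inner_smul_left, real_inner_self_eq_norm_sq]
        simp
      simp only [gradient_wave, w0, w1, w2, i1, i2, s0, s1, map_smul, smul_eq_mul]
      ring
    rw [← e3, e1, e2]
    ring
  set K : ℝ → ℝ := fun r => Real.exp (‖ξ‖ ^ 2 * r ^ 2) * A 0 r with hK
  have hKs : ContDiff ℝ ∞ K := by
    refine ContDiff.mul ?_ hAs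
    fun_prop
  have hKd : ∀ r, deriv K r = Real.exp (‖ξ‖ ^ 2 * r ^ 2) * (2 * r * ‖ξ‖ ^ 2 * A 0 r + A 1 r) :=
    fun r => by
    have := ((((hasDerivAt_pow 2 r).const_mul (‖ξ‖ ^ 2)).exp).mul (hAd 0 r)).deriv
    refine this.trans ?_
    push_cast
    ring
  have hode : ∀ r, 0 < r → r * deriv K r - lam * K r = 0 := fun r _ => by
    rw [hKd, hK]
    have := hid r
    linear_combination (2 * Real.exp (‖ξ‖ ^ 2 * r ^ 2)) * this
  have p1 := (euler_ode_monotone h2 h3 hKs contDiff_const (ρ := fun _ => 0) rfl (by simp)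
    (by simp) hode (fun _ _ => le_rfl)).2 1 one_pos
  -- With `ρ = 0` the positivity result applies to `-K` as well as to `K`.
  have p2 := (euler_ode_monotone h2 h3 hKs.neg contDiff_const (ρ := fun _ => 0) rfl (by simp)
    (by simp) (fun r hr => by
      have := hode r hr
      rw [deriv.fun_neg]
      linarith) (fun _ _ => le_rfl)).2 1 one_pos
  have hK1 : K 1 = 0 := le_antisymm (by simpa using p2) p1
  have hA1 : A 0 1 = 0 := (mul_eq_zero.1 hK1).resolve_left (Real.exp_pos _).ne'
  rw [← hA1]
  refine integral_congr_ae (Eventually.of_forall fun x => ?_)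
  simp [wave, shiftedCos, hX]

/-- Eigenfunctions of the Ornstein-Uhlenbeck operator for an eigenvalue between `1` and `3/2`
vanish. -/
theorem eq_zero_of_heatForm_wave {lam : ℝ} (h2 : 2 < lam) (h3 : lam < 3) {u : Sp n → ℝ}
    (hu : Admissible u) (h : ∀ ξ θ, heatForm lam u (wave ξ θ) = 0) (x : Sp n) : u x = 0 := by
  have h0 := integral_mul_wave_eq_zero h2 h3 hu h
  set f : Sp n → ℂ := fun x => ((gaussDensity n x * u x : ℝ) : ℂ) with hf
  have hρc : Continuous (gaussDensity n) := (contDiff_gaussDensity (m := 0)).continuous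
  have hfc : Continuous f := Complex.continuous_ofReal.comp (hρc.mul hu.lip.continuous)
  have hfi : Integrable f := ((integrable_gammaMeasure_iff u).1 hu.integrable).ofReal
  have hwi : ∀ ξ θ, Integrable (fun y => gaussDensity n y * (u y * wave ξ θ y)) := fun ξ θ => by
    rw [← integrable_gammaMeasure_iff]
    refine hu.integrable.mul_bdd (c := 1)
      (contDiff_wave (m := 0) ξ θ).continuous.aestronglyMeasurable
      (Eventually.of_forall fun y => Real.abs_cos_le_one _)
  -- The real and imaginary parts of the exponential are plane waves of phases `0` and `-π/2`.
  have hF : FourierTransform.fourier f = fun _ => (0 : ℂ) := by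
    funext w
    rw [Real.fourier_eq']
    have e : ∀ v : Sp n, Complex.exp (((-2 * Real.pi * inner ℝ v w : ℝ) : ℂ) * Complex.I) • f v =
        ((gaussDensity n v * (u v * wave ((-2 * Real.pi) • w) 0 v) : ℝ) : ℂ) +
        ((gaussDensity n v * (u v * wave ((-2 * Real.pi) • w) (-(Real.pi / 2)) v) : ℝ) : ℂ)
          * Complex.I := fun v => by
      have i1 : inner ℝ ((-2 * Real.pi) • w) v = -2 * Real.pi * inner ℝ v w := by
        rw [inner_smul_left, real_inner_comm]; rfl
      rw [Complex.exp_mul_I, wave, wave, i1, add_zero, ← sub_eq_add_neg, Real.cos_sub_pi_div_two,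
        ← Complex.ofReal_cos, ← Complex.ofReal_sin, hf, smul_eq_mul]
      push_cast
      ring
    simp_rw [e]
    rw [integral_add (hwi _ _).ofReal ((hwi _ _).ofReal.mul_const _), integral_mul_const,
      integral_complex_ofReal, integral_complex_ofReal, ← integral_gammaMeasure, ← integral_gammaMeasure, h0, h0]
    simp
  -- Continuity of `f` makes Fourier inversion valid at every point, not just almost everywhere.
  have hinv := hfc.fourierInv_fourier_eq hfi (by rw [hF]; exact integrable_zero _ _ _)
  have hx : f x = 0 := by
    rw [← hinv, hF, Real.fourierInv_eq']
    simp
  have hx' : gaussDensity n x * u x = 0 := Complex.ofReal_eq_zero.1 hx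
  exact (mul_eq_zero.1 hx').resolve_left (gaussDensity_pos x).ne'

/-! ### One-sided exponential moments and the total mass on the thin space. -/

theorem ibpForm_sub {w : Sp n → ℝ} (hw : Measurable w) (hw1 : ∀ x, |w x| ≤ 1) (e : Sp n)
    {u f g : Sp n → ℝ} (hu : Admissible u) {C D : ℝ} (hf : BoundedC1 C f) (hg : BoundedC1 D g)
    (hfd : ∀ᵐ x, DifferentiableAt ℝ f x) (hgd : ∀ᵐ x, DifferentiableAt ℝ g x) :
    ibpForm w e u (fun x => f x - g x) = ibpForm w e u f - ibpForm w e u g := by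
  unfold ibpForm
  rw [← integral_sub (integrable_ibp hw hw1 e hu hf) (integrable_ibp hw hw1 e hu hg)]
  refine integral_congr_ae ?_
  filter_upwards [ae_gammaMeasure_of_ae hfd, ae_gammaMeasure_of_ae hgd] with x h1 h2
  rw [fderiv_fun_sub h1 h2, sub_apply]
  ring

/-- The right-hand side of the ordinary differential equation for the one-sided exponential moments
of a slice. -/
def momentRhs (M β k : ℝ) : ℝ :=
  2 * M * (Real.exp (-k ^ 2) - 1 + k ^ 2) - 2 * β * (k * (Real.exp (-k ^ 2) - 1))

theorem hasDerivAt_exp_neg_sq (k : ℝ) :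
    HasDerivAt (fun k : ℝ => Real.exp (-k ^ 2)) (-2 * k * Real.exp (-k ^ 2)) k := by
  have := ((hasDerivAt_pow 2 k).fun_neg).exp
  convert! this using 1
  push_cast
  ring

theorem contDiff_momentRhs (M β : ℝ) : ContDiff ℝ ∞ (momentRhs M β) := by
  unfold momentRhs
  fun_prop

theorem deriv_momentRhs (M β : ℝ) : deriv (momentRhs M β) = fun k =>
    2 * M * (-2 * k * Real.exp (-k ^ 2) + 2 * k) -
      2 * β * (Real.exp (-k ^ 2) - 1 - 2 * k ^ 2 * Real.exp (-k ^ 2)) := by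
  funext k
  have h := hasDerivAt_exp_neg_sq k
  have := ((((h.sub_const 1).add (hasDerivAt_pow 2 k)).const_mul (2 * M)).sub
    (((hasDerivAt_id k).mul (h.sub_const 1)).const_mul (2 * β))).deriv
  refine this.trans ?_
  push_cast
  simp only [id]
  ring

theorem deriv_deriv_momentRhs_zero (M β : ℝ) : deriv (deriv (momentRhs M β)) 0 = 0 := by
  rw [deriv_momentRhs]
  have h := hasDerivAt_exp_neg_sq 0
  have h2 := hasDerivAt_id (0 : ℝ)
  have := (((((h2.const_mul (-2)).mul h).add (h2.const_mul 2)).const_mul (2 * M)).sub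
    (((h.sub_const 1).sub ((((hasDerivAt_pow 2 (0 : ℝ)).const_mul 2)).mul h)).const_mul
      (2 * β))).deriv
  refine this.trans ?_
  simp

/-- Both terms have a sign, by `e^{-s} ≥ 1 - s` and `e^{-s} ≤ 1` with `s = k²`. -/
theorem momentRhs_nonneg {M β : ℝ} (hM : 0 ≤ M) (hβ : 0 ≤ β) {k : ℝ} (hk : 0 < k) :
    0 ≤ momentRhs M β k := by
  have h1 := Real.add_one_le_exp (-k ^ 2)
  have h2 : Real.exp (-k ^ 2) ≤ 1 := Real.exp_le_one_iff.2 (by nlinarith)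
  have h3 : 0 ≤ M * (Real.exp (-k ^ 2) - 1 + k ^ 2) := mul_nonneg hM (by linarith)
  have h4 : 0 ≤ β * (k * (1 - Real.exp (-k ^ 2))) :=
    mul_nonneg hβ (mul_nonneg hk.le (by linarith))
  rw [momentRhs]
  nlinarith

/-- A bounded function plus a quadratic polynomial is negligible against `k ^ lam`, `lam > 2`. -/
theorem tendsto_rpow_neg_mul_quadratic {lam : ℝ} (h2 : 2 < lam) (a b c : ℝ) :
    Tendsto (fun k : ℝ => k ^ (-lam) * (a + b * k + c * k ^ 2)) atTop (𝓝 0) := by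
  have t0 := (tendsto_rpow_neg_atTop (show 0 < lam by linarith)).const_mul a
  have t1 := (tendsto_rpow_neg_atTop (show 0 < lam - 1 by linarith)).const_mul b
  have t2 := (tendsto_rpow_neg_atTop (show 0 < lam - 2 by linarith)).const_mul c
  have := (t0.add t1).add t2
  simp only [mul_zero, add_zero] at this
  refine this.congr' ?_
  filter_upwards [eventually_gt_atTop 0] with k hk
  rw [show -(lam - 1) = -lam + 1 by ring, show -(lam - 2) = -lam + (2 : ℕ) by push_cast; ring,
    Real.rpow_add hk, Real.rpow_add hk, Real.rpow_natCast, Real.rpow_one]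
  ring

section Moments

variable {lam : ℝ} {u : Sp n → ℝ}

theorem abs_exp_neg_abs_last_le (x : Sp n) : |(-|x (Fin.last n)|)| ≤ 1 * ‖x‖ := by
  rw [abs_neg, abs_abs, one_mul]
  exact abs_last_le_norm x

/-- The one-sided exponential moments of `u` and their derivatives. -/
def expMoment (u : Sp n → ℝ) (j : ℕ) (k : ℝ) : ℝ :=
  ∫ x, u x * ((-|x (Fin.last n)|) ^ j * Real.exp (k * (-|x (Fin.last n)|))) ∂gammaMeasure n

theorem measurable_neg_abs_last : Measurable fun x : Sp n => -|x (Fin.last n)| :=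
  ((lastCoord n).continuous.abs.neg).measurable

theorem integrable_expMoment (hu : Admissible u) (j : ℕ) (k : ℝ) :
    Integrable (fun x => u x * ((-|x (Fin.last n)|) ^ j * Real.exp (k * (-|x (Fin.last n)|))))
      (gammaMeasure n) :=
  integrable_paramIntegrand hu measurable_neg_abs_last abs_exp_neg_abs_last_le
    (ψ := fun _ => Real.exp) (fun _ => Real.hasDerivAt_exp)
    (fun _ y => by rw [Real.abs_exp]; exact Real.exp_le_exp.2 (le_abs_self y)) j k

theorem hasDerivAt_expMoment (hu : Admissible u) (j : ℕ) (k : ℝ) :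
    HasDerivAt (expMoment u j) (expMoment u (j + 1) k) k :=
  hasDerivAt_paramIntegral hu measurable_neg_abs_last abs_exp_neg_abs_last_le
    (ψ := fun _ => Real.exp) (fun _ => Real.hasDerivAt_exp)
    (fun _ y => by rw [Real.abs_exp]; exact Real.exp_le_exp.2 (le_abs_self y)) j k

theorem abs_expMoment_zero_le (hu : Admissible u) {k : ℝ} (hk : 0 < k) :
    |expMoment u 0 k| ≤ ∫ x, |u x| ∂gammaMeasure n := by
  refine (abs_integral_le_integral_abs).trans
    (integral_mono (integrable_expMoment hu 0 k).abs hu.integrable.abs fun x => ?_)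
  simp only [pow_zero, one_mul, abs_mul, Real.abs_exp]
  refine mul_le_of_le_one_right (abs_nonneg _) (Real.exp_le_one_iff.2 ?_)
  have := mul_nonneg hk.le (abs_nonneg (x (Fin.last n)))
  linarith

/-- The multiple `k` of the second form cancels the normal derivative of `u` in the first. The rest
needs only `sgn² = 1` and `sgn x * x_d = |x_d|`. -/
theorem heatForm_expAbs_eq (hu : Admissible u) {k : ℝ} (hk : 0 < k) :
    heatForm lam u (expAbs k) + k * ibpForm sgn (eLast n) u (expAbs k) =
      -(lam / 2 + k ^ 2) * expMoment u 0 k + k / 2 * expMoment u 1 k := by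
  rw [heatForm, ibpForm, expMoment, expMoment, ← integral_const_mul, ← integral_const_mul,
    ← integral_const_mul, ← integral_add (integrable_heat lam hu (boundedC1_expAbs hk.le))
      ((integrable_ibp measurable_sgn abs_sgn_le_one _ hu (boundedC1_expAbs hk.le)).const_mul k),
    ← integral_add ((integrable_expMoment hu 0 k).const_mul _)
      ((integrable_expMoment hu 1 k).const_mul _)]
  refine integral_congr_ae ?_
  filter_upwards [ae_gammaMeasure_of_ae ae_last_ne_zero] with x hx
  have e1 : expAbs k x = Real.exp (k * (-|x (Fin.last n)|)) := by rw [expAbs, mul_neg]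
  have s1 : sgn x * sgn x = 1 := sgn_mul_self hx
  have s2 : sgn x * x (Fin.last n) = |x (Fin.last n)| := sign_mul_self _
  rw [gradient_expAbs k hx, inner_eLast, (hasFDerivAt_expAbs k hx).fderiv, map_smul,
    smul_apply, lastCoord_apply, lastCoord_eLast, ← e1]
  simp only [smul_eq_mul, pow_zero, pow_one]
  linear_combination (-k ^ 2 * u x * expAbs k x) * s1 - (k / 2 * u x * expAbs k x) * s2

/-- The equation holds on constants: the total mass of the distribution on the thin space
vanishes. -/
theorem heatForm_one_eq_zero (h2 : 2 < lam) (h3 : lam < 3) (hu : Admissible u)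
    (hH : SolvesOffThin lam u) (hS : Supersolution lam u)
    (h0 : ∀ x : Sp n, x (Fin.last n) = 0 → 0 ≤ u x) : heatForm lam u (fun _ => 1) = 0 := by
  have b1 : BoundedC1 1 (fun _ : Sp n => (1 : ℝ)) := by simpa using boundedC1_const (n := n) 1
  have d1 : ∀ᵐ x : Sp n, DifferentiableAt ℝ (fun _ : Sp n => (1 : ℝ)) x :=
    Eventually.of_forall fun x => differentiableAt_const _
  set M := heatForm lam u (fun _ => 1) with hM
  -- Formally `β` is twice the Gaussian integral of `u` over the thin space, hence nonnegative.
  set β := -ibpForm sgn (eLast n) u (fun _ => 1) with hβ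
  have hM0 : 0 ≤ M := hS.nonneg hu b1 contDiff_const fun _ => zero_le_one
  have hβ0 : 0 ≤ β := neg_nonneg.2 (ibpForm_sgn_nonpos hu
    (LipschitzWith.const (1 : ℝ)).locallyLipschitz b1 fun x hx => by simpa using h0 x hx)
  -- Neither `M` nor `β` changes when `1` is replaced by `e^{-k|x_d|}`, since both depend on the
  -- test function only through its values on the thin space.
  have hid : ∀ k : ℝ, 0 < k →
      M - k * β = -(lam / 2 + k ^ 2) * expMoment u 0 k + k / 2 * expMoment u 1 k := fun k hk => by
    have hEd : ∀ᵐ x : Sp n, DifferentiableAt ℝ (expAbs k) x := by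
      filter_upwards [ae_last_ne_zero] with x hx using (hasFDerivAt_expAbs k hx).differentiableAt
    have m1 : heatForm lam u (expAbs k) = M := by
      have := hH.heatForm_expAbs_mul hu hk.le (contDiff_const (c := (1 : ℝ))) b1
      simpa using this
    have m2 : ibpForm sgn (eLast n) u (expAbs k) = -β := by
      have z := ibpForm_sgn_eq_zero hu
        ((locallyLipschitz_expAbs k).sub (LipschitzWith.const (1 : ℝ)).locallyLipschitz)
        ((boundedC1_expAbs hk.le).sub b1 hEd d1) fun x hx => by simp [expAbs, hx]
      rw [ibpForm_sub measurable_sgn abs_sgn_le_one _ hu (boundedC1_expAbs hk.le) b1 hEd d1] at z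
      rw [hβ]
      linarith
    rw [← heatForm_expAbs_eq hu hk, m1, m2]
    ring
  have l0 : lam ≠ 0 := by linarith
  have l1 : lam - 1 ≠ 0 := by linarith
  have l2 : lam - 2 ≠ 0 := by linarith
  -- The coefficients are chosen so that `k P' - lam P = 2M - 2βk - 2Mk²` for `P = -a + bk + ck²`.
  -- Subtracting `P` removes the Taylor terms of `2e^{-k²}(M - βk)` of order at most two at `0`.
  set a := 2 / lam * M with ha
  set b := 2 * β / (lam - 1) with hb
  set c := 2 * M / (lam - 2) with hc
  have ea : lam * a = 2 * M := by rw [ha]; field_simp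
  have eb : (lam - 1) * b = 2 * β := by rw [hb]; field_simp
  have ec : (lam - 2) * c = 2 * M := by rw [hc]; field_simp
  have hA := contDiff_of_hasDerivAt_seq (hasDerivAt_expMoment hu) 0
  set K : ℝ → ℝ := fun k => Real.exp (-k ^ 2) * expMoment u 0 k - (-a + b * k + c * k ^ 2) with hK
  have hKs : ContDiff ℝ ∞ K := by
    refine (ContDiff.mul ?_ hA).sub ?_ <;> fun_prop
  have hKd : ∀ k, deriv K k = Real.exp (-k ^ 2) * (expMoment u 1 k - 2 * k * expMoment u 0 k) -
      (b + 2 * c * k) := fun k => by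
    have := (((hasDerivAt_exp_neg_sq k).mul (hasDerivAt_expMoment hu 0 k)).sub
      ((((hasDerivAt_id k).const_mul b).const_add (-a)).add
        ((hasDerivAt_pow 2 k).const_mul c))).deriv
    refine this.trans ?_
    push_cast
    ring
  have hode : ∀ k, 0 < k → k * deriv K k - lam * K k = momentRhs M β k := fun k hk => by
    rw [hKd, hK, momentRhs]
    linear_combination (-2 * Real.exp (-k ^ 2)) * hid k hk - ea + k * eb + k ^ 2 * ec
  obtain ⟨hmono, hpos⟩ := euler_ode_monotone h2 h3 hKs (contDiff_momentRhs M β)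
    (by simp [momentRhs]) (by simp [deriv_momentRhs]) (deriv_deriv_momentRhs_zero M β) hode
    (fun k hk => momentRhs_nonneg hM0 hβ0 hk)
  -- The moment is bounded by the `L¹` norm of `u`, and `lam > 2` beats the subtracted quadratic
  -- polynomial.
  have hlim : Tendsto (fun k : ℝ => k ^ (-lam) * K k) atTop (𝓝 0) := by
    refine squeeze_zero_norm' ?_ (tendsto_rpow_neg_mul_quadratic h2
      ((∫ x, |u x| ∂gammaMeasure n) + |a|) |b| |c|)
    filter_upwards [eventually_gt_atTop 0] with k hk
    rw [norm_mul, Real.norm_of_nonneg (Real.rpow_nonneg hk.le _), Real.norm_eq_abs]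
    refine mul_le_mul_of_nonneg_left ?_ (Real.rpow_nonneg hk.le _)
    have g1 : |Real.exp (-k ^ 2) * expMoment u 0 k| ≤ ∫ x, |u x| ∂gammaMeasure n := by
      rw [abs_mul, Real.abs_exp]
      refine (mul_le_of_le_one_left (abs_nonneg _) (Real.exp_le_one_iff.2 ?_)).trans
        (abs_expMoment_zero_le hu hk)
      nlinarith
    have g2 : |b * k| = |b| * k := by rw [abs_mul, abs_of_pos hk]
    have g3 : |c * k ^ 2| = |c| * k ^ 2 := by rw [abs_mul, abs_of_nonneg (sq_nonneg k)]
    rw [hK]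
    refine (abs_sub _ _).trans ?_
    have g4 := abs_add_le (-a + b * k) (c * k ^ 2)
    have g5 := abs_add_le (-a) (b * k)
    rw [abs_neg] at g5
    linarith
  -- A nonnegative monotone function tending to `0` at infinity vanishes.
  have hK0 : ∀ k, 0 < k → K k = 0 := fun k hk => by
    refine le_antisymm ?_ (hpos k hk)
    have h1 : k ^ (-lam) * K k ≤ 0 := by
      refine ge_of_tendsto hlim ?_
      filter_upwards [eventually_ge_atTop k] with s hs
      exact hmono hk (hk.trans_le hs) hs
    by_contra! h4
    exact absurd h1 (not_le.2 (mul_pos (Real.rpow_pos_of_pos hk _) h4))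
  -- At `k = 1` the vanishing right-hand side is `2M e^{-1} + 2β (1 - e^{-1})`, a sum of nonnegative
  -- terms.
  have hρ1 := hode 1 one_pos
  rw [deriv_eq_zero_of_eqOn_Ioi hK0 1 one_pos, hK0 1 one_pos] at hρ1
  rw [momentRhs] at hρ1
  have h4 : Real.exp (-1 ^ 2) ≤ 1 := Real.exp_le_one_iff.2 (by norm_num)
  have h5 := Real.exp_pos (-1 ^ 2)
  have h6 := mul_nonneg hβ0 (sub_nonneg.2 h4)
  have h7 : M * Real.exp (-1 ^ 2) ≤ 0 := by nlinarith
  exact le_antisymm (by by_contra! h8; exact absurd h7 (not_le.2 (mul_pos h8 h5))) hM0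

end Moments

/-! ### Isometries, reflection in the thin space and evenness. -/

theorem BoundedC1.neg {C : ℝ} {f : Sp n → ℝ} (hf : BoundedC1 C f) :
    BoundedC1 C (fun x => -f x) :=
  ⟨hf.meas.neg, fun x => by simpa using hf.bound x, by simpa using hf.bound_fderiv⟩

theorem BoundedC1.add {C D : ℝ} {f g : Sp n → ℝ} (hf : BoundedC1 C f) (hg : BoundedC1 D g)
    (hfd : ∀ᵐ x, DifferentiableAt ℝ f x) (hgd : ∀ᵐ x, DifferentiableAt ℝ g x) :
    BoundedC1 (C + D) (fun x => f x + g x) := by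
  simpa using hf.sub hg.neg hfd (hgd.mono fun x hx => hx.fun_neg)

theorem Admissible.sub {u v : Sp n → ℝ} (hu : Admissible u) (hv : Admissible v) :
    Admissible (fun x => u x - v x) := by
  refine ⟨hu.lip.sub hv.lip, fun c => ?_, ?_⟩
  · simp only [mul_sub]
    exact (hu.int_exp c).sub (hv.int_exp c)
  · refine (hu.int_fderiv.add hv.int_fderiv).mono'
      (measurable_fderiv ℝ _).norm.aestronglyMeasurable ?_
    filter_upwards [hu.ae_differentiableAt, hv.ae_differentiableAt] with x h1 h2
    rw [norm_norm, fderiv_fun_sub h1 h2]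
    exact norm_sub_le _ _

section Isometry

variable (L : Sp n ≃ₗᵢ[ℝ] Sp n)

theorem gaussDensity_isometry (x : Sp n) : gaussDensity n (L x) = gaussDensity n x := by
  simp [gaussDensity]

theorem integral_gammaMeasure_comp_isometry (f : Sp n → ℝ) :
    ∫ x, f (L x) ∂gammaMeasure n = ∫ x, f x ∂gammaMeasure n := by
  rw [integral_gammaMeasure, integral_gammaMeasure,
    ← L.measurePreserving.integral_comp L.toHomeomorph.measurableEmbedding
      (fun x => gaussDensity n x * f x)]
  simp [gaussDensity_isometry]

theorem integrable_gammaMeasure_comp_isometry {f : Sp n → ℝ} (hf : Integrable f (gammaMeasure n)) :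
    Integrable (fun x => f (L x)) (gammaMeasure n) := by
  rw [integrable_gammaMeasure_iff] at hf ⊢
  have := (L.measurePreserving.integrable_comp_emb L.toHomeomorph.measurableEmbedding).2 hf
  refine this.congr (Eventually.of_forall fun x => ?_)
  simp [gaussDensity_isometry]

theorem fderiv_comp_isometry (f : Sp n → ℝ) (x : Sp n) :
    fderiv ℝ (fun y => f (L y)) x = (fderiv ℝ f (L x)).comp (L.toContinuousLinearEquiv :
      Sp n →L[ℝ] Sp n) :=
  L.toContinuousLinearEquiv.comp_right_fderiv

theorem gradient_comp_isometry (f : Sp n → ℝ) (x : Sp n) :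
    gradient (fun y => f (L y)) x = L.symm (gradient f (L x)) := by
  refine ext_inner_right ℝ fun e => ?_
  rw [← fderiv_apply_eq_inner_gradient, fderiv_comp_isometry, ← L.inner_map_map,
    L.apply_symm_apply, ← fderiv_apply_eq_inner_gradient]
  rfl

variable {L} in
theorem Admissible.comp_isometry {u : Sp n → ℝ} (hu : Admissible u) :
    Admissible (fun x => u (L x)) := by
  refine ⟨hu.lip.comp L.lipschitz.locallyLipschitz, fun c => ?_, ?_⟩
  · simpa using integrable_gammaMeasure_comp_isometry L (hu.int_exp c)
  · refine (integrable_gammaMeasure_comp_isometry L hu.int_fderiv).congr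
      (Eventually.of_forall fun x => ?_)
    simp only [← norm_gradient, gradient_comp_isometry, LinearIsometryEquiv.norm_map]

theorem heatForm_comp_isometry (lam : ℝ) (u f : Sp n → ℝ) :
    heatForm lam (fun x => u (L x)) (fun x => f (L x)) = heatForm lam u f := by
  refine Eq.trans (integral_congr_ae (Eventually.of_forall fun x => ?_))
    (integral_gammaMeasure_comp_isometry L
      fun x => fderiv ℝ u x (gradient f x) - lam / 2 * u x * f x)
  beta_reduce
  rw [gradient_comp_isometry, fderiv_comp_isometry]
  simp

end Isometry

/-- The reflection in the thin space. -/
def reflectLast (n : ℕ) : Sp n ≃ₗᵢ[ℝ] Sp n := (ℝ ∙ eLast n)ᗮ.reflection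

theorem reflectLast_apply (x : Sp n) :
    reflectLast n x = x - (2 * x (Fin.last n)) • eLast n := by
  rw [reflectLast, Submodule.reflection_orthogonal_apply, Submodule.reflection_singleton_apply,
    real_inner_comm, inner_eLast, norm_eLast]
  simp only [RCLike.ofReal_one, one_pow, div_one]
  module

theorem reflectLast_reflectLast (x : Sp n) : reflectLast n (reflectLast n x) = x :=
  Submodule.reflection_reflection _ _

theorem reflectLast_thinProj (x : Sp n) (h : ℝ) :
    reflectLast n (thinProj x + h • eLast n) = thinProj x + (-h) • eLast n := by
  rw [reflectLast_apply, PiLp.add_apply, thinProj_last, PiLp.smul_apply, lastCoord_eLast,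
    smul_eq_mul]
  module

/-- The reflection is an involution preserving the Gaussian measure, so it can be moved from one
argument of the form to the other. -/
theorem heatForm_comp_reflectLast (lam : ℝ) (u f : Sp n → ℝ) :
    heatForm lam (fun x => u (reflectLast n x)) f =
      heatForm lam u (fun x => f (reflectLast n x)) := by
  rw [← heatForm_comp_isometry (reflectLast n) lam u]
  simp only [reflectLast_reflectLast]

theorem abs_wave_sub_comp_reflectLast_le (ξ : Sp n) (θ : ℝ) (x : Sp n) :
    |wave ξ θ x - wave ξ θ (reflectLast n x)| ≤ 2 * ‖ξ‖ * |x (Fin.last n)| := by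
  refine (Real.abs_cos_sub_cos_le _ _).trans ?_
  rw [add_sub_add_right_eq_sub, ← inner_sub_right, reflectLast_apply, sub_sub_cancel,
    inner_smul_right, abs_mul, abs_mul, abs_two]
  have h := abs_real_inner_le_norm ξ (eLast n)
  rw [norm_eLast, mul_one] at h
  have := mul_le_mul_of_nonneg_left h (abs_nonneg (x (Fin.last n)))
  linarith

theorem wave_comp_reflectLast (ξ : Sp n) (θ : ℝ) :
    (fun x => wave ξ θ (reflectLast n x)) = wave (reflectLast n ξ) θ := by
  funext x
  rw [wave, wave, ← (reflectLast n).inner_map_map ξ, reflectLast_reflectLast]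

/-- Solutions are even in the last variable: the odd part is an eigenfunction of the
Ornstein-Uhlenbeck operator. -/
theorem SolvesOffThin.comp_reflectLast {lam : ℝ} (h2 : 2 < lam) (h3 : lam < 3) {u : Sp n → ℝ}
    (hu : Admissible u) (h : SolvesOffThin lam u) (x : Sp n) : u (reflectLast n x) = u x := by
  have hur : Admissible (fun x => u (reflectLast n x)) := hu.comp_isometry
  have hv : Admissible (fun x => u x - u (reflectLast n x)) := hu.sub hur
  refine (sub_eq_zero.1 (eq_zero_of_heatForm_wave h2 h3 hv (fun ξ θ => ?_) x)).symm
  have d : ∀ ξ : Sp n, ∀ᵐ x, DifferentiableAt ℝ (wave ξ θ) x := fun ξ =>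
    Eventually.of_forall fun x => (contDiff_wave ξ θ (m := 1)).differentiable (by simp) x
  have hb := (boundedC1_wave ξ θ).sub (boundedC1_wave (reflectLast n ξ) θ) (d _) (d _)
  -- The odd part of a wave vanishes on the thin space and is therefore an allowed test function.
  -- Moving the reflection onto the wave then gives the equation for the odd part of `u` with every
  -- plane wave.
  have key : heatForm lam u (fun x => wave ξ θ x - wave (reflectLast n ξ) θ x) = 0 := by
    refine h.eq_zero hu hb (fun x _ =>
      ((contDiff_wave ξ θ).sub (contDiff_wave _ θ)).contDiffAt) fun x => ?_
    rw [← wave_comp_reflectLast, LinearIsometryEquiv.norm_map]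
    refine (abs_wave_sub_comp_reflectLast_le ξ θ x).trans ?_
    have := abs_nonneg (x (Fin.last n))
    nlinarith [norm_nonneg ξ]
  rw [heatForm_sub_left lam hu hur (boundedC1_wave ξ θ), heatForm_comp_reflectLast,
    wave_comp_reflectLast]
  simp only [sub_eq_add_neg] at key
  rw [heatForm_add lam hu (boundedC1_wave ξ θ) (g := fun x => -wave (reflectLast n ξ) θ x)
    (boundedC1_wave (reflectLast n ξ) θ).neg (d _) ((d _).mono fun x hx => hx.fun_neg),
    heatForm_neg] at key
  linarith

/-! ### Conclusion. -/

/-- A supersolution that solves the equation off the thin space and is nonnegative there vanishes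
if `2 < lam < 3`. -/
theorem Supersolution.eq_zero {lam : ℝ} (h2 : 2 < lam) (h3 : lam < 3) {u : Sp n → ℝ}
    (hu : Admissible u) (hH : SolvesOffThin lam u) (hS : Supersolution lam u)
    (h0 : ∀ x : Sp n, x (Fin.last n) = 0 → 0 ≤ u x) (x : Sp n) : u x = 0 := by
  have hM := heatForm_one_eq_zero h2 h3 hu hH hS h0
  have b1 : BoundedC1 1 (fun _ : Sp n => (1 : ℝ)) := by simpa using boundedC1_const (n := n) 1
  have d1 : ∀ᵐ x : Sp n, DifferentiableAt ℝ (fun _ : Sp n => (1 : ℝ)) x :=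
    Eventually.of_forall fun x => differentiableAt_const _
  have hnonneg : ∀ (ξ : Sp n) (θ : ℝ), 0 ≤ heatForm lam u (wave ξ θ) := fun ξ θ => by
    have d : ∀ᵐ x, DifferentiableAt ℝ (wave ξ θ) x :=
      Eventually.of_forall fun x => (contDiff_wave ξ θ (m := 1)).differentiable (by simp) x
    -- Test with `1 + cos ≥ 0`; the constant contributes nothing because the total mass is zero.
    have := hS.nonneg hu (b1.add (boundedC1_wave ξ θ) d1 d)
      (contDiff_const.add (contDiff_wave ξ θ)) fun x => by
        have := Real.neg_one_le_cos (inner ℝ ξ x + θ)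
        change 0 ≤ 1 + Real.cos (inner ℝ ξ x + θ)
        linarith
    rwa [heatForm_add lam hu b1 (boundedC1_wave ξ θ) d1 d, hM, zero_add] at this
  refine eq_zero_of_heatForm_wave h2 h3 hu (fun ξ θ => le_antisymm ?_ (hnonneg ξ θ)) x
  -- A phase shift by `π` changes the sign of the wave and gives the reverse inequality.
  have := hnonneg ξ (θ + Real.pi)
  have e : wave ξ (θ + Real.pi) = fun x => -wave ξ θ x := by
    funext x
    rw [wave, wave, ← add_assoc, Real.cos_add_pi]
  rw [e, heatForm_neg] at this
  linarith

end ParabolicSignorini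

end

theorem theorem3p1 (n : ℕ) (lam : ℝ) (hlam : lam ∈ Set.Ioo (2 : ℝ) 3)
    (q : ParabolicSignorini.Sp n × ℝ → ℝ)
    (hq : ParabolicSignorini.IsSignoriniSolution q ∨ ParabolicSignorini.IsThinObstacleSolution q)
    (hhom : ParabolicSignorini.IsParabolicHomogeneous lam q)
    (henergy : ParabolicSignorini.HasFiniteEnergy q) :
    ∀ (x : ParabolicSignorini.Sp n) (t : ℝ), t < 0 → q (x, t) = 0 := by
  open ParabolicSignorini in
  obtain ⟨h2, h3⟩ := hlam
  have hc : IsComplementary q := hq.elim (·.toIsComplementary) (·.toIsComplementary)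
  have hu : Admissible fun x => q (x, -1) :=
    admissible_of_sq (locallyLipschitz_slice hc.lipschitz) henergy
  have hH : SolvesOffThin lam fun x => q (x, -1) := fun f hf hcs hs =>
    heatForm_eq_zero_of_tsupport h2 hc hhom hf hcs hs
  have hS : Supersolution lam fun x => q (x, -1) := by
    rcases hq with hq | hq
    -- The one-sided condition controls only the side `x_d > 0`. Evenness, which needs no sign
    -- condition, transfers it to the other side.
    · refine supersolution_of_normalDeriv hu hH (fun x => ?_) fun x hx ε hε =>
        hq.normal (x, -1) ⟨hx, by norm_num⟩ ε hε
      rcases abs_choice (x (Fin.last n)) with h | h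
      · rw [h]
      · rw [h, ← reflectLast_thinProj, hH.comp_reflectLast h2 h3 hu]
    · exact fun f hf hcs hf0 =>
        heatForm_nonneg_of_heatNonpos h2 hq.lipschitz hq.supercaloric hhom hf hcs hf0
  have h0 : ∀ x, q (x, -1) = 0 := hS.eq_zero h2 h3 hu hH fun x hx =>
    hc.nonneg (x, -1) ⟨hx, by norm_num⟩
  intro x t ht
  have hr : 0 < Real.sqrt (-t) := Real.sqrt_pos.2 (by linarith)
  -- Homogeneity with factor `√(-t)` carries the vanishing from the slice to every negative time.
  have h := hhom _ hr ((Real.sqrt (-t))⁻¹ • x) (-1) (by norm_num)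
  rwa [smul_inv_smul₀ hr.ne', Real.sq_sqrt (by linarith), neg_mul_neg, mul_one, h0, mul_zero] at h
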